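/- **Proposition (Koszul dual of $\mathrm{Lie}^1_2\mathrm{Bi}$).** Let $\mathbb K$ be a field of characteristic zero. *Conventions.* A graded $\mathbb S$-bimodule $M$ consists of graded vector spaces $M(m,n)$ with a left action of $S_m$ (outputs) and a commuting right action of $S_n$ (inputs). A dioperad is a graded $\mathbb S$-bimodule with a unit in arity $(1,1)$ and compositions $\mu_G(p\otimes q)$ along all connected directed graphs $G$ of genus zero with two vertices ($p$ decorates the lower vertex, $q$ the upper one, and the single internal edge runs from the upper to the lower vertex), equivariant, unital, and independent, with Koszul signs, of the order in which a tree with three vertices is contracted. $\mathcal F(M)$ is the free dioperad on $M$. $\mathcal F_{(2)}(M)(m,n)$ is the span of the two-vertex graphs $(G,[p\otimes q])$ decorated by $M$, modulo changes of the local labelings. For $R\subset\mathcal F_{(2)}(M)$, $\mathcal F(M)/(R)$ is the quotient by the ideal generated by $R$; the weight-two part $(R)_{(2)}$ of that ideal is the sub-$\mathbb S$-bimodule generated by $R$. The Czech dual is $M^\vee(m,n)=\mathrm{sgn}_m\otimes M(m,n)^*\otimes\mathrm{sgn}_n$, where the dual of degree $-d$ has degree $d$. There is a natural pairing $\langle\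 ,\ \rangle:\mathcal F_{(2)}(M^\vee)(m,n)\otimes\mathcal F_{(2)}(M)(m,n)\to\mathbb K$: if $G\not\cong G'$, then $(G,[\varphi\otimes\psi])$ and $(G',[p\otimes q])$ pair to zero, and $$\langle (G,[\varphi\otimes\psi]),(G,[p\otimes q])\rangle=\varepsilon(G)\,\varphi(p)\,\psi(q).$$ Here $\varepsilon(G)=(-1)^{m_1}\varepsilon_{\rm out}\varepsilon_{\rm in}$ for a locally labeled graph $G$, where $m_1$ is the number of outputs of the lower vertex, $\varepsilon_{\rm out}$ is the sign of the permutation taking (internal edge, global outputs $1,\dots,m$) to (outputs of the lower vertex, outputs of the upper vertex), and $\varepsilon_{\rm in}$ is defined in the same way with inputs. The Koszul dual of a quadratic dioperad $\mathcal P=\mathcal F(M)/(R)$ is $\mathcal P^!=\mathcal F(M^\vee)/(R^\perp)$, where $R^\perp\subset\mathcal F_{(2)}(M^\vee)$ is the orthogonal complement of $(R)_{(2)}$. *Notation for graphs.* Given a generator $Y$ of arity $(1,2)$ (one output, two inputs) and generators $C_0,C_1$ (white, black) of arity $(2,1)$ (two outputs, one input), let - $YY(a,b,c)$: the upper $Y$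 has inputs $a,b$, the lower $Y$ has inputs (edge, $c$); - $C_uC_l(a,b,c)$: the lower $C_l$ has outputs $a,b$, the upper $C_u$ has outputs (edge, $c$); - $YC_i$: upper $Y$ with inputs $1,2$, lower $C_i$ with outputs $1,2$; - $P_i(a,b;j,k)$: upper $C_i$ with input $j$ and outputs ($a$, edge), lower $Y$ with inputs (edge, $k$) and output $b$. *The dioperad.* $\mathrm{Lie}^1_2\mathrm{Bi}=\mathcal F(M)/(R)$, where $M(1,2)=\mathbf 1_1\otimes\mathbf 1_2[-1]$ (spanned by $Y$ in degree $1$), $M(2,1)=(\mathrm{sgn}_2\oplus\mathrm{sgn}_2)\otimes\mathbf 1_1$ (spanned by $C_0,C_1$ in degree $0$), $M(m,n)=0$ otherwise, and $R$ consists of - $YY(1,2,3)+YY(2,3,1)+YY(3,1,2)$; - $C_iC_i(1,2,3)+C_iC_i(2,3,1)+C_iC_i(3,1,2)$ for $i=0,1$, and $\sum_{(a,b,c)}\big(C_0C_1(a,b,c)+C_1C_0(a,b,c)\big)$, summed over the cyclic permutations of $(1,2,3)$; - $YC_i-P_i(1,2;1,2)+P_i(2,1;1,2)-P_i(1,2;2,1)+P_i(2,1;2,1)$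 for $i=0,1$. *Claim.* Let $N(1,2)=\mathbf 1_1\otimes\mathrm{sgn}_2[1]$ (spanned by $Y$ in degree $-1$), $N(2,1)=(\mathbf 1_2\oplus\mathbf 1_2)\otimes\mathbf 1_1$ (spanned by $C_0,C_1$ in degree $0$), $N(m,n)=0$ otherwise, and let $S\subset\mathcal F_{(2)}(N)$ consist of - (associativity) $YY(1,2,3)-YY(2,3,1)$ and $YY(1,2,3)-YY(3,1,2)$; - (coassociativity) $C_iC_i(1,2,3)-C_iC_i(2,3,1)$ and $C_iC_i(1,2,3)-C_iC_i(3,1,2)$ for $i=0,1$; - (total compatibility) $C_0C_1(1,2,3)-C_0C_1(2,3,1)$, $C_0C_1(1,2,3)-C_0C_1(3,1,2)$, and $C_0C_1(a,b,c)-C_1C_0(a,b,c)$ for the three cyclic permutations $(a,b,c)$ of $(1,2,3)$; - (Frobenius-type compatibility) for $i=0,1$: $YC_i-P_i(1,2;1,2)$, $\;YC_i-P_i(2,1;1,2)$, $\;YC_i+P_i(1,2;2,1)$, $\;YC_i+P_i(2,1;2,1)$. Then there is an isomorphism of graded $\mathbb S$-bimodules $\theta:N\to M^\vee$ which sends the natural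 basis of $N$ to the basis dual to the natural basis of $M$. Under $\theta$, the weight-two part $(S)_{(2)}$ of the ideal generated by $S$ is the orthogonal complement of $(R)_{(2)}$ with respect to $\langle\ ,\ \rangle$ in every arity and degree. Consequently $$(\mathrm{Lie}^1_2\mathrm{Bi})^!\cong\mathcal F(N)/(S)$$ as dioperads, by an isomorphism which identifies the generators via $\theta$. -/

import Mathlib

open scoped TensorProduct DirectSum

universe u

namespace Dioperads

/-! ### Graded S-bimodules -/

/-- A graded `S`-bimodule over `K`: for all `m n : ℕ` and every degree `d : ℤ` a vector space
`M(m,n)^d` with a left action of `S_m` and a commuting right action of `S_n`;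
`act σ τ x` is `σ x τ`. -/
structure SBimodule (K : Type u) [Field K] where
  carrier : ℕ → ℕ → ℤ → Type u
  [addCommGroup : ∀ m n d, AddCommGroup (carrier m n d)]
  [module : ∀ m n d, Module K (carrier m n d)]
  act : ∀ {m n : ℕ} {d : ℤ}, Equiv.Perm (Fin m) → Equiv.Perm (Fin n) →
    carrier m n d →ₗ[K] carrier m n d
  act_one : ∀ {m n : ℕ} {d : ℤ} (x : carrier m n d), act 1 1 x = x
  act_mul : ∀ {m n : ℕ} {d : ℤ} (σ σ' : Equiv.Perm (Fin m)) (τ τ' : Equiv.Perm (Fin n))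
    (x : carrier m n d), act (σ * σ') (τ' * τ) x = act σ τ (act σ' τ' x)

attribute [instance] SBimodule.addCommGroup SBimodule.module

/-- Isomorphisms (of degree zero) of graded `S`-bimodules. -/
structure SBimodule.Iso {K : Type u} [Field K] (M N : SBimodule K) where
  toEquiv : ∀ {m n : ℕ} {d : ℤ}, M.carrier m n d ≃ₗ[K] N.carrier m n d
  map_act : ∀ {m n : ℕ} {d : ℤ} (σ : Equiv.Perm (Fin m)) (τ : Equiv.Perm (Fin n))
    (x : M.carrier m n d), toEquiv (M.act σ τ x) = N.act σ τ (toEquiv x)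

/-- The Czech dual `M^∨(m,n) = sgn_m ⊗ M(m,n)^* ⊗ sgn_n`; the linear dual of the part of
degree `-d` sits in degree `d`, and `(σ φ τ)(x) = sgn σ sgn τ φ(σ⁻¹ x τ⁻¹)`. -/
noncomputable abbrev SBimodule.czechDual {K : Type u} [Field K] (M : SBimodule K) : SBimodule K where
  carrier m n d := Module.Dual K (M.carrier m n (-d))
  act σ τ := (Equiv.Perm.sign σ * Equiv.Perm.sign τ) • (M.act σ⁻¹ τ⁻¹).dualMap
  act_one φ := by
    ext x
    simp [M.act_one]
  act_mul σ σ' τ τ' φ := by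
    ext x
    simp only [LinearMap.smul_apply, LinearMap.dualMap_apply, mul_inv_rev, M.act_mul, map_mul]
    simp only [smul_smul]
    congr 1
    ac_rfl

/-- The value of an element of the Czech dual on an element of `M`. -/
def SBimodule.czechEval {K : Type u} [Field K] (M : SBimodule K) {m n : ℕ} {d : ℤ}
    (φ : M.czechDual.carrier m n d) : M.carrier m n (-d) →ₗ[K] K := φ

/-! ### Two-vertex graphs -/

/-- A connected directed graph of genus zero with two vertices, `m` global outputs and `n` global
inputs, together with local labelings. The *lower* vertex has `m₁` outputs and `n₁` inputs, the
*upper* vertex has `m₂` outputs and `n₂` inputs, and the single internal edge goes from the upper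
vertex to the lower one. `out` tells to which global output each local output is attached, `inp`
does the same for the inputs; the value `none` stands for the internal edge. -/
@[ext]
structure TwoVertexGraph (m n m₁ n₁ m₂ n₂ : ℕ) where
  out : Fin m₁ ⊕ Fin m₂ ≃ Option (Fin m)
  inp : Fin n₁ ⊕ Fin n₂ ≃ Option (Fin n)
  edge_out : ∃ j, out (Sum.inr j) = none
  edge_inp : ∃ i, inp (Sum.inl i) = none

/-- Tuples `(σ₁, ρ₁, σ₂, ρ₂)` of permutations of the local outputs and inputs of the lower and of
the upper vertex. -/
abbrev LocalGroup (m₁ n₁ m₂ n₂ : ℕ) : Type :=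
  Equiv.Perm (Fin m₁) × Equiv.Perm (Fin n₁) × Equiv.Perm (Fin m₂) × Equiv.Perm (Fin n₂)

namespace TwoVertexGraph

variable {m n m₁ n₁ m₂ n₂ : ℕ}

/-- Changing the local labelings. -/
def relabelLocal (G : TwoVertexGraph m n m₁ n₁ m₂ n₂) (g : LocalGroup m₁ n₁ m₂ n₂) :
    TwoVertexGraph m n m₁ n₁ m₂ n₂ where
  out := (Equiv.sumCongr g.1 g.2.2.1).trans G.out
  inp := (Equiv.sumCongr g.2.1 g.2.2.2).trans G.inp
  edge_out := by
    obtain ⟨j, hj⟩ := G.edge_out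
    exact ⟨g.2.2.1.symm j, by simpa using hj⟩
  edge_inp := by
    obtain ⟨i, hi⟩ := G.edge_inp
    exact ⟨g.2.1.symm i, by simpa using hi⟩

/-- The graph `σ G τ`: the actions of `S_m` and `S_n` on the global labels. -/
def relabelGlobal (G : TwoVertexGraph m n m₁ n₁ m₂ n₂) (σ : Equiv.Perm (Fin m))
    (τ : Equiv.Perm (Fin n)) : TwoVertexGraph m n m₁ n₁ m₂ n₂ where
  out := G.out.trans (Equiv.optionCongr σ)
  inp := G.inp.trans (Equiv.optionCongr τ⁻¹)
  edge_out := by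
    obtain ⟨j, hj⟩ := G.edge_out
    exact ⟨j, by simp [hj]⟩
  edge_inp := by
    obtain ⟨i, hi⟩ := G.edge_inp
    exact ⟨i, by simp [hi]⟩

/-- The graph given by the lists of labels of the outputs and inputs of the lower vertex
(`lo`, `li`) and of the upper vertex (`uo`, `ui`). -/
noncomputable def ofLabels (lo : Fin m₁ → Option (Fin m)) (li : Fin n₁ → Option (Fin n))
    (uo : Fin m₂ → Option (Fin m)) (ui : Fin n₂ → Option (Fin n))
    (ho : Function.Bijective (Sum.elim lo uo)) (hi : Function.Bijective (Sum.elim li ui))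
    (heo : ∃ j, uo j = none) (hei : ∃ i, li i = none) :
    TwoVertexGraph m n m₁ n₁ m₂ n₂ where
  out := Equiv.ofBijective _ ho
  inp := Equiv.ofBijective _ hi
  edge_out := heo
  edge_inp := hei

end TwoVertexGraph

/-- The two ways of contracting the chain of three vertices `1 ← 2 ← 3`: first the edge `1 ← 2`
by `G₁` and then `2 ← 3` by `G₂`, or first `2 ← 3` by `H₁` and then `1 ← 2` by `H₂`.
The conditions say that both describe the same labeled three-vertex graph: every local output and
input is attached to the same global label, or is internal, in both descriptions. -/
structure IsChain {m n k l k' l' m₁ n₁ m₂ n₂ m₃ n₃ : ℕ}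
    (G₁ : TwoVertexGraph k l m₁ n₁ m₂ n₂) (G₂ : TwoVertexGraph m n k l m₃ n₃)
    (H₁ : TwoVertexGraph k' l' m₂ n₂ m₃ n₃) (H₂ : TwoVertexGraph m n m₁ n₁ k' l') : Prop where
  out₁ : ∀ j, (G₁.out (.inl j)).bind (fun x => G₂.out (.inl x)) = H₂.out (.inl j)
  out₂ : ∀ j, (G₁.out (.inr j)).bind (fun x => G₂.out (.inl x)) =
    (H₁.out (.inl j)).bind (fun x => H₂.out (.inr x))
  out₃ : ∀ j, G₂.out (.inr j) = (H₁.out (.inr j)).bind (fun x => H₂.out (.inr x))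
  inp₁ : ∀ i, (G₁.inp (.inl i)).bind (fun x => G₂.inp (.inl x)) = H₂.inp (.inl i)
  inp₂ : ∀ i, (G₁.inp (.inr i)).bind (fun x => G₂.inp (.inl x)) =
    (H₁.inp (.inl i)).bind (fun x => H₂.inp (.inr x))
  inp₃ : ∀ i, G₂.inp (.inr i) = (H₁.inp (.inr i)).bind (fun x => H₂.inp (.inr x))

/-- The two ways of contracting `2 → 1 ← 3`: first `2 → 1` by `G₁` and then `3 → 1` by `G₂`, or
first `3 → 1` by `H₁` and then `2 → 1` by `H₂`. -/
structure IsFork {m n k l k' l' m₁ n₁ m₂ n₂ m₃ n₃ : ℕ}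
    (G₁ : TwoVertexGraph k l m₁ n₁ m₂ n₂) (G₂ : TwoVertexGraph m n k l m₃ n₃)
    (H₁ : TwoVertexGraph k' l' m₁ n₁ m₃ n₃) (H₂ : TwoVertexGraph m n k' l' m₂ n₂) : Prop where
  out₁ : ∀ j, (G₁.out (.inl j)).bind (fun x => G₂.out (.inl x)) =
    (H₁.out (.inl j)).bind (fun x => H₂.out (.inl x))
  out₂ : ∀ j, (G₁.out (.inr j)).bind (fun x => G₂.out (.inl x)) = H₂.out (.inr j)
  out₃ : ∀ j, G₂.out (.inr j) = (H₁.out (.inr j)).bind (fun x => H₂.out (.inl x))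
  inp₁ : ∀ i, (G₁.inp (.inl i)).bind (fun x => G₂.inp (.inl x)) =
    (H₁.inp (.inl i)).bind (fun x => H₂.inp (.inl x))
  inp₂ : ∀ i, (G₁.inp (.inr i)).bind (fun x => G₂.inp (.inl x)) = H₂.inp (.inr i)
  inp₃ : ∀ i, G₂.inp (.inr i) = (H₁.inp (.inr i)).bind (fun x => H₂.inp (.inl x))
  edges_ne : ∀ i, G₁.inp (.inl i) = none → H₁.inp (.inl i) ≠ none

/-- The two ways of contracting `1 ← 3 → 2`: first `3 → 2` by `G₁` and then `3 → 1` by `G₂`, or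
first `3 → 1` by `H₁` and then `3 → 2` by `H₂`. -/
structure IsCofork {m n k l k' l' m₁ n₁ m₂ n₂ m₃ n₃ : ℕ}
    (G₁ : TwoVertexGraph k l m₂ n₂ m₃ n₃) (G₂ : TwoVertexGraph m n m₁ n₁ k l)
    (H₁ : TwoVertexGraph k' l' m₁ n₁ m₃ n₃) (H₂ : TwoVertexGraph m n m₂ n₂ k' l') : Prop where
  out₁ : ∀ j, G₂.out (.inl j) = (H₁.out (.inl j)).bind (fun x => H₂.out (.inr x))
  out₂ : ∀ j, (G₁.out (.inl j)).bind (fun x => G₂.out (.inr x)) = H₂.out (.inl j)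
  out₃ : ∀ j, (G₁.out (.inr j)).bind (fun x => G₂.out (.inr x)) =
    (H₁.out (.inr j)).bind (fun x => H₂.out (.inr x))
  inp₁ : ∀ i, G₂.inp (.inl i) = (H₁.inp (.inl i)).bind (fun x => H₂.inp (.inr x))
  inp₂ : ∀ i, (G₁.inp (.inl i)).bind (fun x => G₂.inp (.inr x)) = H₂.inp (.inl i)
  inp₃ : ∀ i, (G₁.inp (.inr i)).bind (fun x => G₂.inp (.inr x)) =
    (H₁.inp (.inr i)).bind (fun x => H₂.inp (.inr x))
  edges_ne : ∀ j, G₁.out (.inr j) = none → H₁.out (.inr j) ≠ none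

/-! ### Dioperads -/

/-- The operations of a (graded) dioperad, without its laws: the two actions, the composition
`μ_G(p ⊗ q)` along every two-vertex graph `G` of genus zero (`p` decorates the lower vertex, `q`
the upper one), and the unit. -/
structure PreDioperad (K : Type u) [Field K] where
  carrier : ℕ → ℕ → ℤ → Type u
  [addCommGroup : ∀ m n d, AddCommGroup (carrier m n d)]
  [module : ∀ m n d, Module K (carrier m n d)]
  act : ∀ {m n : ℕ} {d : ℤ}, Equiv.Perm (Fin m) → Equiv.Perm (Fin n) →
    carrier m n d →ₗ[K] carrier m n d
  comp : ∀ {m n m₁ n₁ m₂ n₂ : ℕ} {d d₁ d₂ : ℤ}, TwoVertexGraph m n m₁ n₁ m₂ n₂ → d₁ + d₂ = d →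
    carrier m₁ n₁ d₁ →ₗ[K] carrier m₂ n₂ d₂ →ₗ[K] carrier m n d
  one : carrier 1 1 0

attribute [instance] PreDioperad.addCommGroup PreDioperad.module

/-- The laws of a dioperad, each as a difference of its two sides: `P.Defect m n d x` says that `x`
is left-hand side minus right-hand side of an instance of a law. The laws are: `act` is a left
action of `S_m` and a commuting right action of `S_n`; compositions are compatible with the local
and global relabelings; the unit laws; and, for each of the three shapes of three-vertex trees,
independence of the order of contraction, with Koszul signs. -/
inductive PreDioperad.Defect {K : Type u} [Field K] (P : PreDioperad K) :
    ∀ m n d, P.carrier m n d → Prop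
  | act_one {m n : ℕ} {d : ℤ} (x : P.carrier m n d) :
      Defect P m n d (P.act 1 1 x - x)
  | act_mul {m n : ℕ} {d : ℤ} (σ σ' : Equiv.Perm (Fin m)) (τ τ' : Equiv.Perm (Fin n))
      (x : P.carrier m n d) :
      Defect P m n d (P.act (σ * σ') (τ' * τ) x - P.act σ τ (P.act σ' τ' x))
  | comp_local {m n m₁ n₁ m₂ n₂ : ℕ} {d d₁ d₂ : ℤ} (G : TwoVertexGraph m n m₁ n₁ m₂ n₂)
      (h : d₁ + d₂ = d) (g : LocalGroup m₁ n₁ m₂ n₂)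
      (p : P.carrier m₁ n₁ d₁) (q : P.carrier m₂ n₂ d₂) :
      Defect P m n d (P.comp (G.relabelLocal g) h p q -
        P.comp G h (P.act g.1 g.2.1⁻¹ p) (P.act g.2.2.1 g.2.2.2⁻¹ q))
  | comp_global {m n m₁ n₁ m₂ n₂ : ℕ} {d d₁ d₂ : ℤ} (G : TwoVertexGraph m n m₁ n₁ m₂ n₂)
      (h : d₁ + d₂ = d) (σ : Equiv.Perm (Fin m)) (τ : Equiv.Perm (Fin n))
      (p : P.carrier m₁ n₁ d₁) (q : P.carrier m₂ n₂ d₂) :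
      Defect P m n d (P.comp (G.relabelGlobal σ τ) h p q - P.act σ τ (P.comp G h p q))
  | one_comp {m n : ℕ} {d : ℤ} (G : TwoVertexGraph m n 1 1 m n) (h : 0 + d = d)
      (σ : Equiv.Perm (Fin m)) (τ : Equiv.Perm (Fin n))
      (hσ : ∀ j, some (σ j) = if G.out (.inr j) = none then G.out (.inl 0) else G.out (.inr j))
      (hτ : ∀ i, some (τ⁻¹ i) = G.inp (.inr i)) (q : P.carrier m n d) :
      Defect P m n d (P.comp G h P.one q - P.act σ τ q)
  | comp_one {m n : ℕ} {d : ℤ} (G : TwoVertexGraph m n m n 1 1) (h : d + 0 = d)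
      (σ : Equiv.Perm (Fin m)) (τ : Equiv.Perm (Fin n))
      (hσ : ∀ j, some (σ j) = G.out (.inl j))
      (hτ : ∀ i, some (τ⁻¹ i) = if G.inp (.inl i) = none then G.inp (.inr 0) else G.inp (.inl i))
      (p : P.carrier m n d) :
      Defect P m n d (P.comp G h p P.one - P.act σ τ p)
  | chain {m n k l k' l' m₁ n₁ m₂ n₂ m₃ n₃ : ℕ} {d e e' d₁ d₂ d₃ : ℤ}
      (G₁ : TwoVertexGraph k l m₁ n₁ m₂ n₂) (G₂ : TwoVertexGraph m n k l m₃ n₃)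
      (H₁ : TwoVertexGraph k' l' m₂ n₂ m₃ n₃) (H₂ : TwoVertexGraph m n m₁ n₁ k' l')
      (hG₁ : d₁ + d₂ = e) (hG₂ : e + d₃ = d) (hH₁ : d₂ + d₃ = e') (hH₂ : d₁ + e' = d)
      (hyp : IsChain G₁ G₂ H₁ H₂)
      (p : P.carrier m₁ n₁ d₁) (q : P.carrier m₂ n₂ d₂) (r : P.carrier m₃ n₃ d₃) :
      Defect P m n d
        (P.comp G₂ hG₂ (P.comp G₁ hG₁ p q) r - P.comp H₂ hH₂ p (P.comp H₁ hH₁ q r))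
  | fork {m n k l k' l' m₁ n₁ m₂ n₂ m₃ n₃ : ℕ} {d e e' d₁ d₂ d₃ : ℤ}
      (G₁ : TwoVertexGraph k l m₁ n₁ m₂ n₂) (G₂ : TwoVertexGraph m n k l m₃ n₃)
      (H₁ : TwoVertexGraph k' l' m₁ n₁ m₃ n₃) (H₂ : TwoVertexGraph m n k' l' m₂ n₂)
      (hG₁ : d₁ + d₂ = e) (hG₂ : e + d₃ = d) (hH₁ : d₁ + d₃ = e') (hH₂ : e' + d₂ = d)
      (hyp : IsFork G₁ G₂ H₁ H₂)
      (p : P.carrier m₁ n₁ d₁) (q : P.carrier m₂ n₂ d₂) (r : P.carrier m₃ n₃ d₃) :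
      Defect P m n d (P.comp G₂ hG₂ (P.comp G₁ hG₁ p q) r -
        (-1 : K) ^ (d₂ * d₃) • P.comp H₂ hH₂ (P.comp H₁ hH₁ p r) q)
  | cofork {m n k l k' l' m₁ n₁ m₂ n₂ m₃ n₃ : ℕ} {d e e' d₁ d₂ d₃ : ℤ}
      (G₁ : TwoVertexGraph k l m₂ n₂ m₃ n₃) (G₂ : TwoVertexGraph m n m₁ n₁ k l)
      (H₁ : TwoVertexGraph k' l' m₁ n₁ m₃ n₃) (H₂ : TwoVertexGraph m n m₂ n₂ k' l')
      (hG₁ : d₂ + d₃ = e) (hG₂ : d₁ + e = d) (hH₁ : d₁ + d₃ = e') (hH₂ : d₂ + e' = d)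
      (hyp : IsCofork G₁ G₂ H₁ H₂)
      (p : P.carrier m₁ n₁ d₁) (q : P.carrier m₂ n₂ d₂) (r : P.carrier m₃ n₃ d₃) :
      Defect P m n d (P.comp G₂ hG₂ p (P.comp G₁ hG₁ q r) -
        (-1 : K) ^ (d₁ * d₂) • P.comp H₂ hH₂ q (P.comp H₁ hH₁ p r))

/-- A (graded) dioperad. -/
structure Dioperad (K : Type u) [Field K] extends PreDioperad K where
  laws : ∀ m n d (x : carrier m n d), toPreDioperad.Defect m n d x → x = 0

/-- Isomorphisms of dioperads. -/
structure Dioperad.Iso {K : Type u} [Field K] (P Q : Dioperad K) where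
  toEquiv : ∀ {m n : ℕ} {d : ℤ}, P.carrier m n d ≃ₗ[K] Q.carrier m n d
  map_act : ∀ {m n : ℕ} {d : ℤ} (σ : Equiv.Perm (Fin m)) (τ : Equiv.Perm (Fin n))
    (x : P.carrier m n d), toEquiv (P.act σ τ x) = Q.act σ τ (toEquiv x)
  map_comp : ∀ {m n m₁ n₁ m₂ n₂ : ℕ} {d d₁ d₂ : ℤ} (G : TwoVertexGraph m n m₁ n₁ m₂ n₂)
    (h : d₁ + d₂ = d) (p : P.carrier m₁ n₁ d₁) (q : P.carrier m₂ n₂ d₂),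
    toEquiv (P.comp G h p q) = Q.comp G h (toEquiv p) (toEquiv q)
  map_one : toEquiv P.one = Q.one

/-! ### Ideals and quotients -/

namespace PreDioperad

variable {K : Type u} [Field K] (P : PreDioperad K)

/-- An ideal: a sub-`S`-bimodule that contains every composite one of whose factors lies in it. -/
structure Ideal where
  carrier : ∀ m n d, Submodule K (P.carrier m n d)
  act_mem : ∀ {m n : ℕ} {d : ℤ} (σ : Equiv.Perm (Fin m)) (τ : Equiv.Perm (Fin n))
    {x : P.carrier m n d}, x ∈ carrier m n d → P.act σ τ x ∈ carrier m n d
  comp_mem_left : ∀ {m n m₁ n₁ m₂ n₂ : ℕ} {d d₁ d₂ : ℤ} (G : TwoVertexGraph m n m₁ n₁ m₂ n₂)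
    (h : d₁ + d₂ = d) {p : P.carrier m₁ n₁ d₁} (q : P.carrier m₂ n₂ d₂),
    p ∈ carrier m₁ n₁ d₁ → P.comp G h p q ∈ carrier m n d
  comp_mem_right : ∀ {m n m₁ n₁ m₂ n₂ : ℕ} {d d₁ d₂ : ℤ} (G : TwoVertexGraph m n m₁ n₁ m₂ n₂)
    (h : d₁ + d₂ = d) (p : P.carrier m₁ n₁ d₁) {q : P.carrier m₂ n₂ d₂},
    q ∈ carrier m₂ n₂ d₂ → P.comp G h p q ∈ carrier m n d

/-- The ideal generated by a family of subsets: the intersection of all ideals containing it. -/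
def Ideal.span (S : ∀ m n d, Set (P.carrier m n d)) : P.Ideal where
  carrier m n d := ⨅ (J : P.Ideal) (_ : ∀ m n d, S m n d ⊆ J.carrier m n d), J.carrier m n d
  act_mem σ τ x hx := by
    simp only [Submodule.mem_iInf] at hx ⊢
    exact fun J hJ => J.act_mem σ τ (hx J hJ)
  comp_mem_left G h p q hp := by
    simp only [Submodule.mem_iInf] at hp ⊢
    exact fun J hJ => J.comp_mem_left G h q (hp J hJ)
  comp_mem_right G h p q hq := by
    simp only [Submodule.mem_iInf] at hq ⊢
    exact fun J hJ => J.comp_mem_right G h p (hq J hJ)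

variable {P}

theorem Ideal.subset_span (S : ∀ m n d, Set (P.carrier m n d)) (m n : ℕ) (d : ℤ)
    {x : P.carrier m n d} (hx : x ∈ S m n d) : x ∈ (Ideal.span P S).carrier m n d := by
  simp only [Ideal.span, Submodule.mem_iInf]
  exact fun J hJ => hJ m n d hx

/-- The quotient `(P/J)(m,n) = P(m,n)/J(m,n)` with the induced operations. -/
noncomputable def quotient (J : P.Ideal) : PreDioperad K where
  carrier m n d := P.carrier m n d ⧸ J.carrier m n d
  act σ τ := (J.carrier _ _ _).mapQ (J.carrier _ _ _) (P.act σ τ) (fun _ hx => J.act_mem σ τ hx)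
  comp {m n m₁ n₁ m₂ n₂ d d₁ d₂} G h :=
    (J.carrier m₁ n₁ d₁).liftQ
      ((J.carrier m₂ n₂ d₂).liftQ
        ((P.comp G h).compr₂ (J.carrier m n d).mkQ).flip (by
          intro q hq
          rw [LinearMap.mem_ker]
          ext p
          simpa using J.comp_mem_right G h p hq)).flip (by
      intro p hp
      rw [LinearMap.mem_ker]
      ext q
      simpa using J.comp_mem_left G h q hp)
  one := (J.carrier 1 1 0).mkQ P.one

/-- The quotient map `P → P/J`. -/
noncomputable def quotientMap (J : P.Ideal) {m n : ℕ} {d : ℤ} :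
    P.carrier m n d →ₗ[K] (quotient J).carrier m n d :=
  (J.carrier m n d).mkQ

theorem quotientMap_surjective (J : P.Ideal) {m n : ℕ} {d : ℤ}
    (x : (quotient J).carrier m n d) : ∃ y, quotientMap J y = x :=
  Submodule.mkQ_surjective _ x

theorem quotientMap_act (J : P.Ideal) {m n : ℕ} {d : ℤ} (σ : Equiv.Perm (Fin m))
    (τ : Equiv.Perm (Fin n)) (x : P.carrier m n d) :
    (quotient J).act σ τ (quotientMap J x) = quotientMap J (P.act σ τ x) := rfl

theorem quotientMap_comp (J : P.Ideal) {m n m₁ n₁ m₂ n₂ : ℕ} {d d₁ d₂ : ℤ}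
    (G : TwoVertexGraph m n m₁ n₁ m₂ n₂) (h : d₁ + d₂ = d)
    (p : P.carrier m₁ n₁ d₁) (q : P.carrier m₂ n₂ d₂) :
    (quotient J).comp G h (quotientMap J p) (quotientMap J q) =
      quotientMap J (P.comp G h p q) := rfl

theorem quotient_laws (J : P.Ideal)
    (hJ : ∀ m n d (x : P.carrier m n d), P.Defect m n d x → x ∈ J.carrier m n d)
    (m n : ℕ) (d : ℤ) (x : (quotient J).carrier m n d) (hx : (quotient J).Defect m n d x) :
    x = 0 := by
  have key : ∀ {m n : ℕ} {d : ℤ} (y : P.carrier m n d), P.Defect m n d y →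
      quotientMap J y = 0 := by
    intro m n d y hy
    exact (Submodule.Quotient.mk_eq_zero _).2 (hJ m n d y hy)
  have hone : (quotient J).one = quotientMap J P.one := rfl
  cases hx with
  | act_one x =>
    obtain ⟨x, rfl⟩ := quotientMap_surjective J x
    rw [quotientMap_act, ← map_sub]
    exact key _ (.act_one x)
  | act_mul σ σ' τ τ' x =>
    obtain ⟨x, rfl⟩ := quotientMap_surjective J x
    simp only [quotientMap_act, ← map_sub]
    exact key _ (.act_mul σ σ' τ τ' x)
  | comp_local G h g p q =>
    obtain ⟨p, rfl⟩ := quotientMap_surjective J p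
    obtain ⟨q, rfl⟩ := quotientMap_surjective J q
    simp only [quotientMap_act, quotientMap_comp, ← map_sub]
    exact key _ (.comp_local G h g p q)
  | comp_global G h σ τ p q =>
    obtain ⟨p, rfl⟩ := quotientMap_surjective J p
    obtain ⟨q, rfl⟩ := quotientMap_surjective J q
    simp only [quotientMap_act, quotientMap_comp, ← map_sub]
    exact key _ (.comp_global G h σ τ p q)
  | one_comp G h σ τ hσ hτ q =>
    obtain ⟨q, rfl⟩ := quotientMap_surjective J q
    simp only [hone, quotientMap_act, quotientMap_comp, ← map_sub]
    exact key _ (.one_comp G h σ τ hσ hτ q)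
  | comp_one G h σ τ hσ hτ p =>
    obtain ⟨p, rfl⟩ := quotientMap_surjective J p
    simp only [hone, quotientMap_act, quotientMap_comp, ← map_sub]
    exact key _ (.comp_one G h σ τ hσ hτ p)
  | chain G₁ G₂ H₁ H₂ hG₁ hG₂ hH₁ hH₂ hyp p q r =>
    obtain ⟨p, rfl⟩ := quotientMap_surjective J p
    obtain ⟨q, rfl⟩ := quotientMap_surjective J q
    obtain ⟨r, rfl⟩ := quotientMap_surjective J r
    simp only [quotientMap_comp, ← map_sub]
    exact key _ (.chain G₁ G₂ H₁ H₂ hG₁ hG₂ hH₁ hH₂ hyp p q r)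
  | fork G₁ G₂ H₁ H₂ hG₁ hG₂ hH₁ hH₂ hyp p q r =>
    obtain ⟨p, rfl⟩ := quotientMap_surjective J p
    obtain ⟨q, rfl⟩ := quotientMap_surjective J q
    obtain ⟨r, rfl⟩ := quotientMap_surjective J r
    rw [quotientMap_comp, quotientMap_comp, quotientMap_comp, quotientMap_comp, ← map_smul,
      ← map_sub]
    exact key _ (.fork G₁ G₂ H₁ H₂ hG₁ hG₂ hH₁ hH₂ hyp p q r)
  | cofork G₁ G₂ H₁ H₂ hG₁ hG₂ hH₁ hH₂ hyp p q r =>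
    obtain ⟨p, rfl⟩ := quotientMap_surjective J p
    obtain ⟨q, rfl⟩ := quotientMap_surjective J q
    obtain ⟨r, rfl⟩ := quotientMap_surjective J r
    rw [quotientMap_comp, quotientMap_comp, quotientMap_comp, quotientMap_comp, ← map_smul,
      ← map_sub]
    exact key _ (.cofork G₁ G₂ H₁ H₂ hG₁ hG₂ hH₁ hH₂ hyp p q r)

end PreDioperad

/-- The quotient dioperad `P/J`. -/
noncomputable def Dioperad.quotient {K : Type u} [Field K] (P : Dioperad K)
    (J : P.toPreDioperad.Ideal) : Dioperad K where
  toPreDioperad := PreDioperad.quotient J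
  laws := PreDioperad.quotient_laws J
    (fun m n d x hx => by rw [P.laws m n d x hx]; exact (J.carrier m n d).zero_mem)

/-! ### Free dioperads -/

section Free

variable {K : Type u} [Field K] (M : SBimodule K)

/-- Formal expressions built from the elements of `M`, a unit, and the operations of a
dioperad. -/
inductive Expr : ℕ → ℕ → ℤ → Type u
  | gen {m n : ℕ} {d : ℤ} (x : M.carrier m n d) : Expr m n d
  | one : Expr 1 1 0
  | act {m n : ℕ} {d : ℤ} (σ : Equiv.Perm (Fin m)) (τ : Equiv.Perm (Fin n)) (a : Expr m n d) :
      Expr m n d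
  | comp {m n m₁ n₁ m₂ n₂ : ℕ} {d d₁ d₂ : ℤ} (G : TwoVertexGraph m n m₁ n₁ m₂ n₂)
      (h : d₁ + d₂ = d) (a : Expr m₁ n₁ d₁) (b : Expr m₂ n₂ d₂) : Expr m n d

/-- Linear combinations of formal expressions. -/
noncomputable def exprPreDioperad : PreDioperad K where
  carrier m n d := Expr M m n d →₀ K
  act σ τ := Finsupp.lmapDomain K K (Expr.act σ τ)
  comp G h := Finsupp.linearCombination K
    (fun a => Finsupp.lmapDomain K K (fun b => Expr.comp G h a b))
  one := Finsupp.single Expr.one 1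

/-- The formal expression `x`, for an element `x` of `M`. -/
noncomputable def exprGen {m n : ℕ} {d : ℤ} (x : M.carrier m n d) :
    (exprPreDioperad M).carrier m n d :=
  (Finsupp.single (Expr.gen x) 1 : Expr M m n d →₀ K)

/-- The relations that turn formal expressions into the free dioperad: the laws of dioperads, and
that the inclusion of `M` is a homomorphism of `S`-bimodules. -/
inductive FreeRelation : ∀ m n d, (exprPreDioperad M).carrier m n d → Prop
  | law {m n : ℕ} {d : ℤ} (x : (exprPreDioperad M).carrier m n d)
      (hx : (exprPreDioperad M).Defect m n d x) : FreeRelation m n d x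
  | gen_add {m n : ℕ} {d : ℤ} (x y : M.carrier m n d) :
      FreeRelation m n d (exprGen M (x + y) - (exprGen M x + exprGen M y))
  | gen_smul {m n : ℕ} {d : ℤ} (c : K) (x : M.carrier m n d) :
      FreeRelation m n d (exprGen M (c • x) - c • exprGen M x)
  | gen_act {m n : ℕ} {d : ℤ} (σ : Equiv.Perm (Fin m)) (τ : Equiv.Perm (Fin n))
      (x : M.carrier m n d) :
      FreeRelation m n d (exprGen M (M.act σ τ x) - (exprPreDioperad M).act σ τ (exprGen M x))

/-- The ideal of formal expressions generated by `FreeRelation`. -/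
noncomputable def freeIdeal : (exprPreDioperad M).Ideal :=
  PreDioperad.Ideal.span _ (fun m n d => {x | FreeRelation M m n d x})

/-- The free dioperad `F(M)` on the `S`-bimodule `M`. -/
noncomputable def free : Dioperad K where
  toPreDioperad := PreDioperad.quotient (freeIdeal M)
  laws := PreDioperad.quotient_laws _
    (fun m n d x hx => PreDioperad.Ideal.subset_span _ m n d (FreeRelation.law x hx))

theorem free_relation {m n : ℕ} {d : ℤ} {x y : (exprPreDioperad M).carrier m n d}
    (h : FreeRelation M m n d (x - y)) :
    PreDioperad.quotientMap (freeIdeal M) x = PreDioperad.quotientMap (freeIdeal M) y :=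
  (Submodule.Quotient.eq _).2 (PreDioperad.Ideal.subset_span _ m n d h)

/-- The inclusion `ι : M → F(M)`. -/
noncomputable def freeGen {m n : ℕ} {d : ℤ} : M.carrier m n d →ₗ[K] (free M).carrier m n d where
  toFun x := PreDioperad.quotientMap (freeIdeal M) (exprGen M x)
  map_add' x y := by
    rw [free_relation M (FreeRelation.gen_add x y), map_add]
    rfl
  map_smul' c x := by
    rw [free_relation M (FreeRelation.gen_smul c x), map_smul]
    rfl

theorem freeGen_act {m n : ℕ} {d : ℤ} (σ : Equiv.Perm (Fin m)) (τ : Equiv.Perm (Fin n))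
    (x : M.carrier m n d) : freeGen M (M.act σ τ x) = (free M).act σ τ (freeGen M x) :=
  free_relation M (FreeRelation.gen_act σ τ x)

end Free

/-! ### Decorated graphs with two vertices -/

/-- The numbers of outputs and inputs of the lower and of the upper vertex of a two-vertex graph,
and the degrees of the decorations of the two vertices, of total degree `d`. -/
structure Arity (d : ℤ) where
  m₁ : ℕ
  n₁ : ℕ
  m₂ : ℕ
  n₂ : ℕ
  d₁ : ℤ
  d₂ : ℤ
  add_eq : d₁ + d₂ = d

/-- The same numbers of outputs and inputs, with the opposite degrees. -/
abbrev Arity.neg {d : ℤ} (a : Arity d) : Arity (-d) where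
  m₁ := a.m₁
  n₁ := a.n₁
  m₂ := a.m₂
  n₂ := a.n₂
  d₁ := -a.d₁
  d₂ := -a.d₂
  add_eq := by have := a.add_eq; omega

section DecoratedGraphs

variable {K : Type u} [Field K] (M : SBimodule K)

/-- Two-vertex graphs with local labelings and with vertices of the given arities. -/
abbrev Arity.Graph {d : ℤ} (a : Arity d) (m n : ℕ) : Type :=
  TwoVertexGraph m n a.m₁ a.n₁ a.m₂ a.n₂

/-- Decorations of the two vertices, in the order (lower vertex) ⊗ (upper vertex). -/
abbrev Decoration {d : ℤ} (a : Arity d) : Type u :=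
  M.carrier a.m₁ a.n₁ a.d₁ ⊗[K] M.carrier a.m₂ a.n₂ a.d₂

/-- The action of permutations of the local labels on decorations. -/
noncomputable def Decoration.act {d : ℤ} (a : Arity d) (g : LocalGroup a.m₁ a.n₁ a.m₂ a.n₂) :
    Decoration M a →ₗ[K] Decoration M a :=
  TensorProduct.map (M.act g.1 g.2.1⁻¹) (M.act g.2.2.1 g.2.2.2⁻¹)

/-- The relations `(G, [fσ ⊗ p ⊗ τ⁻¹g]) = (G, [f ⊗ σpτ⁻¹ ⊗ g])` among decorated graphs, at both
vertices. -/
noncomputable def localRelations {d : ℤ} (a : Arity d) (m n : ℕ) :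
    Submodule K (a.Graph m n →₀ Decoration M a) :=
  Submodule.span K {z | ∃ (G : a.Graph m n) (g : LocalGroup a.m₁ a.n₁ a.m₂ a.n₂)
    (t : Decoration M a),
    z = Finsupp.single (G.relabelLocal g) t - Finsupp.single G (Decoration.act M a g t)}

/-- Graphs with two vertices of the given arities, decorated by `M`. -/
abbrev DecoratedGraphs {d : ℤ} (a : Arity d) (m n : ℕ) : Type u :=
  (a.Graph m n →₀ Decoration M a) ⧸ localRelations M a m n

/-- The part of degree `d` of `F_(2)(M)(m,n)`: the space of all graphs with two vertices decorated
by `M`. -/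
abbrev WeightTwo (m n : ℕ) (d : ℤ) : Type u :=
  ⨁ a : Arity d, DecoratedGraphs M a m n

noncomputable instance WeightTwo.instAddCommGroup (m n : ℕ) (d : ℤ) :
    AddCommGroup (WeightTwo M m n d) :=
  @DirectSum.instAddCommGroup (Arity d) (fun a => DecoratedGraphs M a m n) (fun _ => inferInstance)

open scoped Classical in
/-- The decorated graph `(G, [p ⊗ q])`, where `p` decorates the lower and `q` the upper vertex. -/
noncomputable def decorated {m n m₁ n₁ m₂ n₂ : ℕ} {d d₁ d₂ : ℤ}
    (G : TwoVertexGraph m n m₁ n₁ m₂ n₂) (h : d₁ + d₂ = d)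
    (p : M.carrier m₁ n₁ d₁) (q : M.carrier m₂ n₂ d₂) : WeightTwo M m n d :=
  DirectSum.lof K (Arity d) (fun a => DecoratedGraphs M a m n) ⟨m₁, n₁, m₂, n₂, d₁, d₂, h⟩
    ((localRelations M ⟨m₁, n₁, m₂, n₂, d₁, d₂, h⟩ m n).mkQ (Finsupp.single G (p ⊗ₜ[K] q)))

theorem relabelGlobal_relabelLocal {m n m₁ n₁ m₂ n₂ : ℕ} (G : TwoVertexGraph m n m₁ n₁ m₂ n₂)
    (g : LocalGroup m₁ n₁ m₂ n₂) (σ : Equiv.Perm (Fin m)) (τ : Equiv.Perm (Fin n)) :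
    (G.relabelLocal g).relabelGlobal σ τ = (G.relabelGlobal σ τ).relabelLocal g := rfl

/-- The action `(G, [p ⊗ q]) ↦ (σ G τ, [p ⊗ q])` on decorated graphs of given arities. -/
noncomputable def DecoratedGraphs.act {d : ℤ} (a : Arity d) {m n : ℕ} (σ : Equiv.Perm (Fin m))
    (τ : Equiv.Perm (Fin n)) : DecoratedGraphs M a m n →ₗ[K] DecoratedGraphs M a m n :=
  (localRelations M a m n).mapQ (localRelations M a m n)
    (Finsupp.lmapDomain _ K (fun G => G.relabelGlobal σ τ)) (by
      rw [localRelations, Submodule.span_le]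
      rintro _ ⟨G, g, t, rfl⟩
      refine Submodule.subset_span ⟨G.relabelGlobal σ τ, g, t, ?_⟩
      rw [map_sub, Finsupp.lmapDomain_apply, Finsupp.lmapDomain_apply, Finsupp.mapDomain_single,
        Finsupp.mapDomain_single, relabelGlobal_relabelLocal])

/-- The action of `S_m` and `S_n` on `F_(2)(M)(m,n)`. -/
noncomputable def WeightTwo.act {m n : ℕ} {d : ℤ} (σ : Equiv.Perm (Fin m))
    (τ : Equiv.Perm (Fin n)) : WeightTwo M m n d →ₗ[K] WeightTwo M m n d :=
  DirectSum.lmap (fun a => DecoratedGraphs.act M a σ τ)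

/-- The sub-`S`-bimodule of `F_(2)(M)` generated by a family `R` of subsets of `F_(2)(M)`, that is,
the weight two part `(R)_(2)` of the ideal `(R)`. -/
noncomputable def WeightTwo.generated (R : ∀ m n d, Set (WeightTwo M m n d)) (m n : ℕ) (d : ℤ) :
    Submodule K (WeightTwo M m n d) :=
  Submodule.span K {y | ∃ (σ : Equiv.Perm (Fin m)) (τ : Equiv.Perm (Fin n)), ∃ x ∈ R m n d,
    y = WeightTwo.act M σ τ x}

/-- The inclusion into `F(M)` of the decorated graphs with two vertices of given arities. -/
noncomputable def DecoratedGraphs.toFree {d : ℤ} (a : Arity d) (m n : ℕ) :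
    DecoratedGraphs M a m n →ₗ[K] (free M).carrier m n d :=
  (localRelations M a m n).liftQ
    (Finsupp.lsum K (fun G : a.Graph m n => TensorProduct.lift
      (((free M).comp G a.add_eq).compl₁₂ (freeGen M) (freeGen M)))) (by
      rw [localRelations, Submodule.span_le]
      rintro _ ⟨G, g, t, rfl⟩
      rw [SetLike.mem_coe, LinearMap.mem_ker, map_sub, sub_eq_zero, Finsupp.lsum_single,
        Finsupp.lsum_single]
      induction t using TensorProduct.induction_on with
      | zero => simp only [map_zero]
      | add x y hx hy => simp only [map_add, hx, hy]
      | tmul p q =>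
        simp only [Decoration.act, TensorProduct.map_tmul, TensorProduct.lift.tmul,
          LinearMap.compl₁₂_apply, freeGen_act]
        exact sub_eq_zero.1 ((free M).laws _ _ _ _
          (PreDioperad.Defect.comp_local G a.add_eq g (freeGen M p) (freeGen M q))))

open scoped Classical in
/-- The inclusion of `F_(2)(M)` into `F(M)`: `(G, [p ⊗ q])` is sent to `μ_G(p ⊗ q)`. -/
noncomputable def WeightTwo.toFree (m n : ℕ) (d : ℤ) :
    WeightTwo M m n d →ₗ[K] (free M).carrier m n d :=
  DirectSum.toModule K (Arity d) _ (fun a => DecoratedGraphs.toFree M a m n)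

variable {M} in
/-- The map of decorated graphs of given arities induced by an isomorphism of `S`-bimodules. -/
noncomputable def DecoratedGraphs.map {N : SBimodule K} (θ : M.Iso N) {d : ℤ} (a : Arity d)
    (m n : ℕ) : DecoratedGraphs M a m n →ₗ[K] DecoratedGraphs N a m n :=
  (localRelations M a m n).mapQ (localRelations N a m n)
    (Finsupp.mapRange.linearMap
      (TensorProduct.map θ.toEquiv.toLinearMap θ.toEquiv.toLinearMap)) (by
      rw [localRelations, Submodule.span_le]
      rintro _ ⟨G, g, t, rfl⟩
      refine Submodule.subset_span ⟨G, g,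
        TensorProduct.map θ.toEquiv.toLinearMap θ.toEquiv.toLinearMap t, ?_⟩
      rw [map_sub, Finsupp.mapRange.linearMap_apply, Finsupp.mapRange.linearMap_apply,
        Finsupp.mapRange_single, Finsupp.mapRange_single]
      congr 2
      simp only [Decoration.act, ← LinearMap.comp_apply, ← TensorProduct.map_comp]
      congr 2 <;>
      · ext x
        exact θ.map_act _ _ x)

variable {M} in
/-- The map `F_(2)(M) → F_(2)(N)` induced by an isomorphism `M → N` of `S`-bimodules. -/
noncomputable def WeightTwo.map {N : SBimodule K} (θ : M.Iso N) (m n : ℕ) (d : ℤ) :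
    WeightTwo M m n d →ₗ[K] WeightTwo N m n d :=
  DirectSum.lmap (fun a => DecoratedGraphs.map θ a m n)

end DecoratedGraphs

/-! ### The pairing -/

/-- The sign of a bijection between `Fin a` and `Fin b` (where necessarily `a = b`). -/
def bijSign {a b : ℕ} (e : Fin a ≃ Fin b) : ℤˣ :=
  Equiv.Perm.sign (e.trans (finCongr (Fin.equiv_iff_eq.1 ⟨e.symm⟩)))

theorem bijSign_trans {a b : ℕ} (π : Equiv.Perm (Fin a)) (e : Fin a ≃ Fin b) :
    bijSign (π.trans e) = Equiv.Perm.sign π * bijSign e := by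
  have h : (π.trans e).trans (finCongr (Fin.equiv_iff_eq.1 ⟨(π.trans e).symm⟩)) =
      (e.trans (finCongr (Fin.equiv_iff_eq.1 ⟨e.symm⟩)) : Equiv.Perm (Fin a)) * π := rfl
  rw [bijSign, h, Equiv.Perm.sign_mul, mul_comm]
  rfl

/-- The sign of a bijection `Fin a ⊕ Fin b ≃ Option (Fin m)`: the sequence of its values, first on
`Fin a` and then on `Fin b`, is compared with the sequence `none, 0, …, m-1`. -/
def labelSign {a b m : ℕ} (e : Fin a ⊕ Fin b ≃ Option (Fin m)) : ℤˣ :=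
  bijSign ((finSumFinEquiv.symm.trans e).trans (finSuccEquiv m).symm)

theorem labelSign_trans {a b m : ℕ} (σ : Equiv.Perm (Fin a)) (ρ : Equiv.Perm (Fin b))
    (e : Fin a ⊕ Fin b ≃ Option (Fin m)) :
    labelSign ((Equiv.sumCongr σ ρ).trans e) =
      Equiv.Perm.sign σ * Equiv.Perm.sign ρ * labelSign e := by
  have h : (finSumFinEquiv.symm.trans ((Equiv.sumCongr σ ρ).trans e)).trans (finSuccEquiv m).symm =
      (finSumFinEquiv.permCongr (Equiv.sumCongr σ ρ)).trans
        ((finSumFinEquiv.symm.trans e).trans (finSuccEquiv m).symm) := by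
    ext x
    simp [Equiv.permCongr_apply]
  rw [labelSign, h, bijSign_trans, Equiv.Perm.sign_permCongr, Equiv.Perm.sign_sumCongr]
  rfl

/-- The orientation sign of a two-vertex graph with local labelings. The outputs of the lower
vertex followed by those of the upper vertex are compared with the internal edge followed by the
global outputs, and similarly for the inputs; the factor `(-1)^{m₁}` is the sign of moving the edge,
an output of the upper vertex, past the `m₁` outputs of the lower vertex. For generators with
arities `(1,2)` and `(2,1)` this is the usual Koszul sign; it changes by the sign of the
permutation when a local labeling is changed. -/
def TwoVertexGraph.sign {m n m₁ n₁ m₂ n₂ : ℕ} (G : TwoVertexGraph m n m₁ n₁ m₂ n₂) : ℤˣ :=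
  (-1) ^ m₁ * labelSign G.out * labelSign G.inp

theorem TwoVertexGraph.sign_relabelLocal {m n m₁ n₁ m₂ n₂ : ℕ}
    (G : TwoVertexGraph m n m₁ n₁ m₂ n₂) (g : LocalGroup m₁ n₁ m₂ n₂) :
    (G.relabelLocal g).sign = (Equiv.Perm.sign g.1 * Equiv.Perm.sign g.2.1 *
      (Equiv.Perm.sign g.2.2.1 * Equiv.Perm.sign g.2.2.2)) * G.sign := by
  simp only [TwoVertexGraph.sign, TwoVertexGraph.relabelLocal, labelSign_trans]
  ac_rfl

theorem TwoVertexGraph.relabelLocal_mul {m n m₁ n₁ m₂ n₂ : ℕ}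
    (G : TwoVertexGraph m n m₁ n₁ m₂ n₂) (g h : LocalGroup m₁ n₁ m₂ n₂) :
    (G.relabelLocal g).relabelLocal h = G.relabelLocal (g * h) := by
  ext x <;> rcases x with x | x <;> rfl

theorem TwoVertexGraph.relabelLocal_one {m n m₁ n₁ m₂ n₂ : ℕ}
    (G : TwoVertexGraph m n m₁ n₁ m₂ n₂) : G.relabelLocal 1 = G := by
  ext x <;> rcases x with x | x <;> rfl

section Pairing

variable {K : Type u} [Field K] (M : SBimodule K)

theorem Decoration.act_mul {d : ℤ} (a : Arity d) (g h : LocalGroup a.m₁ a.n₁ a.m₂ a.n₂)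
    (t : Decoration M a) :
    Decoration.act M a (g * h) t = Decoration.act M a g (Decoration.act M a h t) := by
  simp only [Decoration.act, ← LinearMap.comp_apply, ← TensorProduct.map_comp]
  congr 2 <;>
  · ext x
    simp only [LinearMap.comp_apply, ← M.act_mul, Prod.fst_mul, Prod.snd_mul, mul_inv_rev]

/-- The evaluation `(φ ⊗ ψ)(p ⊗ q) = φ(p) ψ(q)` of decorations by `M^∨` on decorations by `M`. -/
noncomputable def Decoration.eval {d : ℤ} (a : Arity d) :
    Decoration M.czechDual a →ₗ[K] Decoration M a.neg →ₗ[K] K :=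
  TensorProduct.dualDistrib K (M.carrier a.m₁ a.n₁ (-a.d₁)) (M.carrier a.m₂ a.n₂ (-a.d₂))

/-- The pairing of a decoration `t` by `M^∨` of the graph `G` with (formal sums of) decorated
graphs: the decorated graph `(G', s)` is paired to zero unless `G'` is isomorphic to `G`, in which
case it is rewritten as a decoration of `G`, evaluated on `t`, and the result is multiplied by the
sign of `G`. -/
noncomputable def prePairing {d : ℤ} (a : Arity d) {m n : ℕ} (G : a.Graph m n) :
    Decoration M.czechDual a →ₗ[K] (a.neg.Graph m n →₀ Decoration M a.neg) →ₗ[K] K :=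
  (G.sign : ℤ) • (Decoration.eval M a).compl₂
    (∑ g : LocalGroup a.m₁ a.n₁ a.m₂ a.n₂,
      (Decoration.act M a.neg g).comp (Finsupp.lapply (G.relabelLocal g)))

theorem prePairing_apply {d : ℤ} (a : Arity d) {m n : ℕ} (G : a.Graph m n)
    (t : Decoration M.czechDual a) (x : a.neg.Graph m n →₀ Decoration M a.neg) :
    prePairing M a G t x = (G.sign : ℤ) • ∑ g : LocalGroup a.m₁ a.n₁ a.m₂ a.n₂,
      Decoration.eval M a t (Decoration.act M a.neg g (x (G.relabelLocal g))) := by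
  rw [prePairing, LinearMap.smul_apply, LinearMap.smul_apply, LinearMap.compl₂_apply,
    LinearMap.sum_apply, map_sum]
  simp only [LinearMap.comp_apply, Finsupp.lapply_apply]

theorem Decoration.eval_act {d : ℤ} (a : Arity d) (g : LocalGroup a.m₁ a.n₁ a.m₂ a.n₂)
    (t : Decoration M.czechDual a) (s : Decoration M a.neg) :
    Decoration.eval M a (Decoration.act M.czechDual a g t) s =
      ((Equiv.Perm.sign g.1 * Equiv.Perm.sign g.2.1 *
        (Equiv.Perm.sign g.2.2.1 * Equiv.Perm.sign g.2.2.2) : ℤˣ) : ℤ) •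
        Decoration.eval M a t (Decoration.act M a.neg g⁻¹ s) := by
  induction t using TensorProduct.induction_on with
  | zero => simp only [map_zero, LinearMap.zero_apply, smul_zero]
  | add x y hx hy => simp only [map_add, LinearMap.add_apply, hx, hy, smul_add]
  | tmul φ ψ =>
    induction s using TensorProduct.induction_on with
    | zero => simp only [map_zero, smul_zero]
    | add x y hx hy => simp only [map_add, hx, hy, smul_add]
    | tmul p q =>
      have h₁ : (show Module.Dual K _ from M.czechDual.act g.1 g.2.1⁻¹ φ) p =
          ((Equiv.Perm.sign g.1 * Equiv.Perm.sign g.2.1 : ℤˣ) : ℤ) •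
            (show Module.Dual K _ from φ) (M.act g.1⁻¹ g.2.1 p) := by
        simp [SBimodule.czechDual, Units.smul_def]
      have h₂ : (show Module.Dual K _ from M.czechDual.act g.2.2.1 g.2.2.2⁻¹ ψ) q =
          ((Equiv.Perm.sign g.2.2.1 * Equiv.Perm.sign g.2.2.2 : ℤˣ) : ℤ) •
            (show Module.Dual K _ from ψ) (M.act g.2.2.1⁻¹ g.2.2.2 q) := by
        simp [SBimodule.czechDual, Units.smul_def]
      have e₁ : Decoration.eval M a (Decoration.act M.czechDual a g (φ ⊗ₜ ψ)) (p ⊗ₜ q) =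
          (show Module.Dual K _ from M.czechDual.act g.1 g.2.1⁻¹ φ) p *
            (show Module.Dual K _ from M.czechDual.act g.2.2.1 g.2.2.2⁻¹ ψ) q := rfl
      have e₂ : Decoration.eval M a (φ ⊗ₜ ψ) (Decoration.act M a.neg g⁻¹ (p ⊗ₜ q)) =
          (show Module.Dual K _ from φ) (M.act g.1⁻¹ (g.2.1⁻¹)⁻¹ p) *
            (show Module.Dual K _ from ψ) (M.act g.2.2.1⁻¹ (g.2.2.2⁻¹)⁻¹ q) := rfl
      rw [e₁, e₂, h₁, h₂, inv_inv, inv_inv, smul_mul_smul_comm, ← Units.val_mul]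

theorem prePairing_left {d : ℤ} (a : Arity d) {m n : ℕ} (G : a.Graph m n)
    (h : LocalGroup a.m₁ a.n₁ a.m₂ a.n₂) (t : Decoration M.czechDual a)
    (x : a.neg.Graph m n →₀ Decoration M a.neg) :
    prePairing M a (G.relabelLocal h) t x =
      prePairing M a G (Decoration.act M.czechDual a h t) x := by
  rw [prePairing_apply, prePairing_apply, TwoVertexGraph.sign_relabelLocal]
  simp only [Decoration.eval_act, TwoVertexGraph.relabelLocal_mul]
  rw [← Finset.smul_sum, smul_smul, ← Units.val_mul, mul_comm (TwoVertexGraph.sign G)]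
  congr 1
  refine Fintype.sum_equiv (Equiv.mulLeft h) _ _ fun g => ?_
  rw [Equiv.coe_mulLeft]
  refine congrArg _ ?_
  exact (congrArg (fun k => Decoration.act M a.neg k (x (G.relabelLocal (h * g))))
    (inv_mul_cancel_left h g).symm).trans (Decoration.act_mul M a.neg h⁻¹ (h * g) _)

theorem prePairing_right {d : ℤ} (a : Arity d) {m n : ℕ} (G : a.Graph m n)
    (t : Decoration M.czechDual a) (x : a.neg.Graph m n →₀ Decoration M a.neg)
    (hx : x ∈ localRelations M a.neg m n) : prePairing M a G t x = 0 := by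
  classical
  rw [← LinearMap.mem_ker]
  revert x
  change localRelations M a.neg m n ≤ _
  rw [localRelations, Submodule.span_le]
  rintro _ ⟨G', h, s, rfl⟩
  rw [SetLike.mem_coe, LinearMap.mem_ker, map_sub, sub_eq_zero, prePairing_apply, prePairing_apply]
  congr 1
  symm
  refine Fintype.sum_equiv (Equiv.mulRight h) _ _ fun g => ?_
  rw [Equiv.coe_mulRight]
  refine congrArg _ ?_
  have hinj : ∀ A B : a.Graph m n, A.relabelLocal h = B.relabelLocal h → A = B := by
    intro A B hAB
    have := congrArg (fun C => TwoVertexGraph.relabelLocal C h⁻¹) hAB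
    simp only [TwoVertexGraph.relabelLocal_mul, mul_inv_cancel] at this
    rwa [TwoVertexGraph.relabelLocal_one, TwoVertexGraph.relabelLocal_one] at this
  have hmul : G.relabelLocal (g * h) = (G.relabelLocal g).relabelLocal h :=
    (TwoVertexGraph.relabelLocal_mul G g h).symm
  by_cases hG : G' = G.relabelLocal g
  · subst hG
    rw [hmul]
    refine (congrArg (Decoration.act M a.neg g) (Finsupp.single_eq_same)).trans ?_
    refine (Decoration.act_mul M a.neg g h s).symm.trans ?_
    exact congrArg (Decoration.act M a.neg (g * h)) (Finsupp.single_eq_same).symm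
  · rw [hmul]
    have h₁ : (Finsupp.single G' (Decoration.act M a.neg h s)) (G.relabelLocal g) = 0 :=
      Finsupp.single_eq_of_ne (Ne.symm hG)
    have h₂ : (Finsupp.single (TwoVertexGraph.relabelLocal G' h) s :
        a.neg.Graph m n →₀ Decoration M a.neg) ((G.relabelLocal g).relabelLocal h) = 0 :=
      Finsupp.single_eq_of_ne (fun e => hG (hinj _ _ e.symm))
    rw [h₁, h₂, map_zero, map_zero]

/-- The pairing between the graphs of given arities decorated by `M^∨` and by `M`. -/
noncomputable def DecoratedGraphs.pairing {d : ℤ} (a : Arity d) (m n : ℕ) :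
    DecoratedGraphs M.czechDual a m n →ₗ[K] DecoratedGraphs M a.neg m n →ₗ[K] K :=
  (localRelations M.czechDual a m n).liftQ
    ((localRelations M a.neg m n).liftQ
      (Finsupp.lsum K (prePairing M a (m := m) (n := n))).flip (by
        intro x hx
        rw [LinearMap.mem_ker]
        refine Finsupp.lhom_ext fun G t => ?_
        simpa using prePairing_right M a G t x hx)).flip (by
    rw [localRelations, Submodule.span_le]
    rintro _ ⟨G, g, t, rfl⟩
    rw [SetLike.mem_coe, LinearMap.mem_ker]
    refine LinearMap.ext fun x => ?_
    obtain ⟨x, rfl⟩ := Submodule.mkQ_surjective _ x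
    simpa [sub_eq_zero] using prePairing_left M a G g t x)

open scoped Classical in
/-- The natural pairing `F_(2)(M^∨)(m,n) ⊗ F_(2)(M)(m,n) → K`, which pairs degree `d` with degree
`-d`. -/
noncomputable def WeightTwo.pairing (m n : ℕ) (d : ℤ) :
    WeightTwo M.czechDual m n d →ₗ[K] WeightTwo M m n (-d) →ₗ[K] K :=
  DirectSum.toModule K (Arity d) _ (fun a => (DecoratedGraphs.pairing M a m n).compl₂
    (DirectSum.component K (Arity (-d)) (fun b => DecoratedGraphs M b m n) a.neg))

/-- The orthogonal complement in `F_(2)(M^∨)(m,n)^d` of a subspace of `F_(2)(M)(m,n)^{-d}`. -/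
noncomputable def WeightTwo.orthogonal {m n : ℕ} {d : ℤ}
    (U : Submodule K (WeightTwo M m n (-d))) : Submodule K (WeightTwo M.czechDual m n d) where
  carrier := {y | ∀ x ∈ U, WeightTwo.pairing M m n d y x = 0}
  zero_mem' x _ := by simp
  add_mem' hy hz x hx := by simp [hy x hx, hz x hx]
  smul_mem' c y hy x hx := by simp [hy x hx]

end Pairing

/-! ### Quadratic dioperads and Koszul duals -/

/-- A quadratic presentation: an `S`-bimodule `M` of generators and a family of relations
`R ⊆ F_(2)(M)`. -/
structure QuadraticData (K : Type u) [Field K] where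
  generators : SBimodule K
  relations : ∀ m n d, Set (WeightTwo generators m n d)

namespace QuadraticData

variable {K : Type u} [Field K] (Q : QuadraticData K)

/-- The ideal `(R)` of `F(M)`. -/
noncomputable def ideal : (free Q.generators).toPreDioperad.Ideal :=
  PreDioperad.Ideal.span _
    (fun m n d => WeightTwo.toFree Q.generators m n d '' Q.relations m n d)

/-- The quadratic dioperad `F(M)/(R)`. -/
noncomputable def dioperad : Dioperad K :=
  (free Q.generators).quotient Q.ideal

/-- The class in `F(M)/(R)` of a generator. -/
noncomputable def gen {m n : ℕ} {d : ℤ} (x : Q.generators.carrier m n d) :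
    Q.dioperad.carrier m n d :=
  PreDioperad.quotientMap Q.ideal (freeGen Q.generators x)

/-- The quadratic presentation of the Koszul dual dioperad `F(M^∨)/(R^⊥)`, where `R^⊥` is the
orthogonal complement of the weight two part `(R)_(2)` of the ideal `(R)`. -/
noncomputable def koszulDual : QuadraticData K where
  generators := Q.generators.czechDual
  relations m n d := WeightTwo.orthogonal Q.generators
    (WeightTwo.generated Q.generators Q.relations m n (-d))

end QuadraticData

/-! ### The dioperad of Lie₂ 1-bialgebras and the presentation of its Koszul dual -/

/-- The dimensions of a graded `S`-bimodule with one generator of arity `(1,2)` in degree `e`, and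
two generators of arity `(2,1)` in degree `0`. -/
def generatorRank (e : ℤ) (m n : ℕ) (d : ℤ) : ℕ :=
  if m = 1 ∧ n = 2 ∧ d = e then 1 else if m = 2 ∧ n = 1 ∧ d = 0 then 2 else 0

/-- The generators of the dioperad of Lie₂ 1-bialgebras: `M(1,2) = 1_1 ⊗ 1_2[-1]`, which sits in
degree `1`, and `M(2,1) = (sgn_2 ⊕ sgn_2) ⊗ 1_1`. -/
noncomputable def lieGenerators (K : Type u) [Field K] : SBimodule K where
  carrier m n d := Fin (generatorRank 1 m n d) → K
  act σ _ := Equiv.Perm.sign σ • LinearMap.id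
  act_one x := by simp
  act_mul σ σ' τ τ' x := by simp [smul_smul, mul_comm]

/-- The generators of the Koszul dual: `N(1,2) = 1_1 ⊗ sgn_2[1]`, which sits in degree `-1`, and
`N(2,1) = (1_2 ⊕ 1_2) ⊗ 1_1`. -/
noncomputable def dualGenerators (K : Type u) [Field K] : SBimodule K where
  carrier m n d := Fin (generatorRank (-1) m n d) → K
  act _ τ := Equiv.Perm.sign τ • LinearMap.id
  act_one x := by simp
  act_mul σ σ' τ τ' x := by simp [smul_smul, mul_comm]

section Pictures

/-- The graph with two vertices of arity `(1,2)`: the upper vertex has inputs `a, b`, and the lower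
one has inputs the internal edge and `c`. -/
noncomputable def graphYY (a b c : Fin 3)
    (h : Function.Bijective (Sum.elim ![none, some c] ![some a, some b]) := by decide) :
    TwoVertexGraph 1 3 1 2 1 2 :=
  .ofLabels ![some 0] ![none, some c] ![none] ![some a, some b] (by decide) h
    ⟨0, rfl⟩ ⟨0, rfl⟩

/-- The graph with two vertices of arity `(2,1)`: the lower vertex has outputs `a, b`, and the
upper one has outputs the internal edge and `c`. -/
noncomputable def graphCC (a b c : Fin 3)
    (h : Function.Bijective (Sum.elim ![some a, some b] ![none, some c]) := by decide) :
    TwoVertexGraph 3 1 2 1 2 1 :=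
  .ofLabels ![some a, some b] ![none] ![none, some c] ![some 0] h (by decide)
    ⟨0, rfl⟩ ⟨0, rfl⟩

/-- The graph whose upper vertex has arity `(1,2)` and inputs `1, 2`, and whose lower vertex has
arity `(2,1)` and outputs `1, 2`. -/
noncomputable def graphYC : TwoVertexGraph 2 2 2 1 1 2 :=
  .ofLabels ![some 0, some 1] ![none] ![none] ![some 0, some 1]
    (by decide) (by decide) (by decide) (by decide)

/-- The graph whose upper vertex has arity `(2,1)`, with input `i` and outputs `a` and the internal
edge, and whose lower vertex has arity `(1,2)`, with inputs the internal edge and `j`, and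
output `b`. -/
noncomputable def graphCY (a b i j : Fin 2)
    (ho : Function.Bijective (Sum.elim ![some b] ![some a, none]) := by decide)
    (hi : Function.Bijective (Sum.elim ![none, some j] ![some i]) := by decide) :
    TwoVertexGraph 2 2 1 2 2 1 :=
  .ofLabels ![some b] ![none, some j] ![some a, none] ![some i] ho hi ⟨1, rfl⟩ ⟨0, rfl⟩

end Pictures

section Relations

variable (K : Type u) [Field K]

/-- The natural basis element `Y` of `M(1,2)`. -/
noncomputable def lieBracket : (lieGenerators K).carrier 1 2 1 := fun _ => 1

/-- The natural basis elements of `M(2,1)`: white for `c = 0`, black for `c = 1`. -/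
noncomputable def lieCobracket (c : Fin 2) : (lieGenerators K).carrier 2 1 0 :=
  fun k => if (k : ℕ) = (c : ℕ) then 1 else 0

/-- The natural basis element `Y` of `N(1,2)`. -/
noncomputable def dualProduct : (dualGenerators K).carrier 1 2 (-1) := fun _ => 1

/-- The natural basis elements of `N(2,1)`: white for `c = 0`, black for `c = 1`. -/
noncomputable def dualCoproduct (c : Fin 2) : (dualGenerators K).carrier 2 1 0 :=
  fun k => if (k : ℕ) = (c : ℕ) then 1 else 0

/-- Bracket above bracket. -/
noncomputable def lieYY (G : TwoVertexGraph 1 3 1 2 1 2) : WeightTwo (lieGenerators K) 1 3 2 :=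
  decorated _ G (by norm_num) (lieBracket K) (lieBracket K)

/-- The cobracket `u` above the cobracket `l`. -/
noncomputable def lieCC (u l : Fin 2) (G : TwoVertexGraph 3 1 2 1 2 1) :
    WeightTwo (lieGenerators K) 3 1 0 :=
  decorated _ G (by norm_num) (lieCobracket K l) (lieCobracket K u)

/-- Bracket above the cobracket `c`. -/
noncomputable def lieYC (c : Fin 2) (G : TwoVertexGraph 2 2 2 1 1 2) :
    WeightTwo (lieGenerators K) 2 2 1 :=
  decorated _ G (by norm_num) (lieCobracket K c) (lieBracket K)

/-- The cobracket `c` above the bracket. -/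
noncomputable def lieCY (c : Fin 2) (G : TwoVertexGraph 2 2 1 2 2 1) :
    WeightTwo (lieGenerators K) 2 2 1 :=
  decorated _ G (by norm_num) (lieBracket K) (lieCobracket K c)

/-- Product above product. -/
noncomputable def dualYY (G : TwoVertexGraph 1 3 1 2 1 2) :
    WeightTwo (dualGenerators K) 1 3 (-2) :=
  decorated _ G (by norm_num) (dualProduct K) (dualProduct K)

/-- The coproduct `u` above the coproduct `l`. -/
noncomputable def dualCC (u l : Fin 2) (G : TwoVertexGraph 3 1 2 1 2 1) :
    WeightTwo (dualGenerators K) 3 1 0 :=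
  decorated _ G (by norm_num) (dualCoproduct K l) (dualCoproduct K u)

/-- Product above the coproduct `c`. -/
noncomputable def dualYC (c : Fin 2) (G : TwoVertexGraph 2 2 2 1 1 2) :
    WeightTwo (dualGenerators K) 2 2 (-1) :=
  decorated _ G (by norm_num) (dualCoproduct K c) (dualProduct K)

/-- The coproduct `c` above the product. -/
noncomputable def dualCY (c : Fin 2) (G : TwoVertexGraph 2 2 1 2 2 1) :
    WeightTwo (dualGenerators K) 2 2 (-1) :=
  decorated _ G (by norm_num) (dualProduct K) (dualCoproduct K c)

/-- The relations `R` of the dioperad of Lie₂ 1-bialgebras: the Jacobi identity, the co-Jacobi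
identities of the two cobrackets, their compatibility, and the compatibility of each cobracket
with the bracket. -/
inductive LieRelation : ∀ m n d, WeightTwo (lieGenerators K) m n d → Prop
  | jacobi : LieRelation 1 3 2
      (lieYY K (graphYY 0 1 2) + lieYY K (graphYY 1 2 0) + lieYY K (graphYY 2 0 1))
  | coJacobi (c : Fin 2) : LieRelation 3 1 0
      (lieCC K c c (graphCC 0 1 2) + lieCC K c c (graphCC 1 2 0) + lieCC K c c (graphCC 2 0 1))
  | coCompatible : LieRelation 3 1 0
      (lieCC K 0 1 (graphCC 0 1 2) + lieCC K 0 1 (graphCC 1 2 0) + lieCC K 0 1 (graphCC 2 0 1) +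
        lieCC K 1 0 (graphCC 0 1 2) + lieCC K 1 0 (graphCC 1 2 0) + lieCC K 1 0 (graphCC 2 0 1))
  | bialgebra (c : Fin 2) : LieRelation 2 2 1
      (lieYC K c graphYC - lieCY K c (graphCY 0 1 0 1) + lieCY K c (graphCY 1 0 0 1)
        - lieCY K c (graphCY 0 1 1 0) + lieCY K c (graphCY 1 0 1 0))

/-- The relations `S`: associativity of the product, cocommutative coassociativity of each
coproduct, total compatibility of the two coproducts, and the Frobenius-type compatibility of
each coproduct with the product. -/
inductive DualRelation : ∀ m n d, WeightTwo (dualGenerators K) m n d → Prop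
  | assoc₁ : DualRelation 1 3 (-2) (dualYY K (graphYY 0 1 2) - dualYY K (graphYY 1 2 0))
  | assoc₂ : DualRelation 1 3 (-2) (dualYY K (graphYY 0 1 2) - dualYY K (graphYY 2 0 1))
  | coassoc₁ (c : Fin 2) : DualRelation 3 1 0
      (dualCC K c c (graphCC 0 1 2) - dualCC K c c (graphCC 1 2 0))
  | coassoc₂ (c : Fin 2) : DualRelation 3 1 0
      (dualCC K c c (graphCC 0 1 2) - dualCC K c c (graphCC 2 0 1))
  | mixed₁ : DualRelation 3 1 0 (dualCC K 0 1 (graphCC 0 1 2) - dualCC K 0 1 (graphCC 1 2 0))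
  | mixed₂ : DualRelation 3 1 0 (dualCC K 0 1 (graphCC 0 1 2) - dualCC K 0 1 (graphCC 2 0 1))
  | total₁ : DualRelation 3 1 0 (dualCC K 0 1 (graphCC 0 1 2) - dualCC K 1 0 (graphCC 0 1 2))
  | total₂ : DualRelation 3 1 0 (dualCC K 0 1 (graphCC 1 2 0) - dualCC K 1 0 (graphCC 1 2 0))
  | total₃ : DualRelation 3 1 0 (dualCC K 0 1 (graphCC 2 0 1) - dualCC K 1 0 (graphCC 2 0 1))
  | frobenius₁ (c : Fin 2) : DualRelation 2 2 (-1)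
      (dualYC K c graphYC - dualCY K c (graphCY 0 1 0 1))
  | frobenius₂ (c : Fin 2) : DualRelation 2 2 (-1)
      (dualYC K c graphYC - dualCY K c (graphCY 1 0 0 1))
  | frobenius₃ (c : Fin 2) : DualRelation 2 2 (-1)
      (dualYC K c graphYC + dualCY K c (graphCY 0 1 1 0))
  | frobenius₄ (c : Fin 2) : DualRelation 2 2 (-1)
      (dualYC K c graphYC + dualCY K c (graphCY 1 0 1 0))

/-- The quadratic presentation `F(M)/(R)` of the dioperad of Lie₂ 1-bialgebras. -/
noncomputable def lieTwoOneBi : QuadraticData K where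
  generators := lieGenerators K
  relations m n d := {x | LieRelation K m n d x}

/-- The quadratic presentation `F(N)/(S)`. -/
noncomputable def totallyCompatibleFrobenius : QuadraticData K where
  generators := dualGenerators K
  relations m n d := {x | DualRelation K m n d x}

end Relations

end Dioperads

/-! The symmetric groups act on `M` through the sign of the output permutation and on `N` through
the sign of the input permutation. Hence, for fixed decorations p, q from `M`, the product of
ε_out(G) with the decorated graph (G, [p ⊗ q]) does not depend on the local labelling. Its sum over
all labelled graphs, `graphSum`, is a canonical element on which (σ, τ) acts by sgn σ
(`act_graphSum`).

Every relation in R is, after multiplication by 4 (the order of the local group) and up to one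
global sign, such a sum or a sum of two of them. This has two consequences. First, the linear span
of R is already stable under the symmetric groups (`LieRelation.act_eq`), so orthogonality to
(R)_(2) need only be tested on R itself. Second, in the pairing of a decorated graph G with a
relation all output signs cancel, and what remains is (-1)^{m₁} ε_in(G) times the evaluation of the
decorations (`pairing_graphSum`). These values show at once that S and its translates are orthogonal
to R (`weightTwoForm_dualRelation`); the factor (-1)^{m₁} and the input signs are the origin of the
signs in the Frobenius relations.

For the converse, modulo (S)_(2) every graph decorated by basis elements is, up to sign, one of a
few normal forms: one in arity (1,3), three in (3,1), two in (2,2) (`dualIdealTwo_sup_normalForm`).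
The matrix of the pairing of the normal forms with the relations in R is the identity, so a
combination of normal forms orthogonal to R is zero. This gives (S)_(2) = R^⊥
(`mem_dualIdealTwo_iff`, `map_dualIdealTwo`) without computing the dimension of F_(2)(N).

The statement about dioperads is then formal: by the universal properties of free dioperads and of
quotients, an isomorphism of generators matching the weight two parts induces mutually inverse
homomorphisms (`QuadraticData.exists_iso`). Characteristic zero is used only to divide by 4. -/

namespace Dioperads

universe v

/-! ### Homomorphisms of dioperads and universal properties -/

section Universal

variable {K : Type v} [Field K]

/-- Homomorphisms of (pre)dioperads. -/
structure PreDioperad.Hom (P Q : PreDioperad K) where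
  toLin : ∀ {m n : ℕ} {d : ℤ}, P.carrier m n d →ₗ[K] Q.carrier m n d
  map_act : ∀ {m n : ℕ} {d : ℤ} (σ : Equiv.Perm (Fin m)) (τ : Equiv.Perm (Fin n))
    (x : P.carrier m n d), toLin (P.act σ τ x) = Q.act σ τ (toLin x)
  map_comp : ∀ {m n m₁ n₁ m₂ n₂ : ℕ} {d d₁ d₂ : ℤ} (G : TwoVertexGraph m n m₁ n₁ m₂ n₂)
    (h : d₁ + d₂ = d) (p : P.carrier m₁ n₁ d₁) (q : P.carrier m₂ n₂ d₂),
    toLin (P.comp G h p q) = Q.comp G h (toLin p) (toLin q)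
  map_one : toLin P.one = Q.one

namespace PreDioperad.Hom

variable {P Q R : PreDioperad K}

/-- The composite of two homomorphisms. -/
def comp (g : Q.Hom R) (f : P.Hom Q) : P.Hom R where
  toLin := g.toLin ∘ₗ f.toLin
  map_act σ τ x := by simp only [LinearMap.comp_apply, f.map_act, g.map_act]
  map_comp G h p q := by simp only [LinearMap.comp_apply, f.map_comp, g.map_comp]
  map_one := by simp only [LinearMap.comp_apply, f.map_one, g.map_one]

/-- The kernel of a homomorphism. -/
def ker (f : P.Hom Q) : P.Ideal where
  carrier m n d := LinearMap.ker (f.toLin (m := m) (n := n) (d := d))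
  act_mem σ τ x hx := by
    rw [LinearMap.mem_ker] at hx ⊢
    rw [f.map_act, hx, map_zero]
  comp_mem_left G h p q hp := by
    rw [LinearMap.mem_ker] at hp ⊢
    rw [f.map_comp, hp, map_zero, LinearMap.zero_apply]
  comp_mem_right G h p q hq := by
    rw [LinearMap.mem_ker] at hq ⊢
    rw [f.map_comp, hq, map_zero]

/-- The kernel is itself an ideal containing `S`, hence one of those intersected in `Ideal.span`. -/
theorem toLin_eq_zero_of_mem_span (f : P.Hom Q) (S : ∀ m n d, Set (P.carrier m n d))
    (hS : ∀ m n d x, x ∈ S m n d → f.toLin x = 0) {m n : ℕ} {d : ℤ} {x : P.carrier m n d}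
    (hx : x ∈ (Ideal.span P S).carrier m n d) : f.toLin x = 0 := by
  simp only [Ideal.span, Submodule.mem_iInf] at hx
  exact hx f.ker (fun m n d y hy => hS m n d y hy)

/-- Both sides of each law are built from the operations, which `f` preserves. If the target is a
dioperad, the image therefore vanishes, although the source (formal expressions) satisfies none of
the laws by assumption. -/
theorem defect_toLin (f : P.Hom Q) {m n : ℕ} {d : ℤ} {x : P.carrier m n d}
    (hx : P.Defect m n d x) : Q.Defect m n d (f.toLin x) := by
  cases hx with
  | act_one x =>
    simp only [map_sub, f.map_act]
    exact .act_one _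
  | act_mul σ σ' τ τ' x =>
    simp only [map_sub, f.map_act]
    exact .act_mul σ σ' τ τ' _
  | comp_local G h g p q =>
    simp only [map_sub, f.map_comp, f.map_act]
    exact .comp_local G h g _ _
  | comp_global G h σ τ p q =>
    simp only [map_sub, f.map_comp, f.map_act]
    exact .comp_global G h σ τ _ _
  | one_comp G h σ τ hσ hτ q =>
    simp only [map_sub, f.map_comp, f.map_act, f.map_one]
    exact .one_comp G h σ τ hσ hτ _
  | comp_one G h σ τ hσ hτ p =>
    simp only [map_sub, f.map_comp, f.map_act, f.map_one]
    exact .comp_one G h σ τ hσ hτ _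
  | chain G₁ G₂ H₁ H₂ hG₁ hG₂ hH₁ hH₂ hyp p q r =>
    simp only [map_sub, f.map_comp]
    exact .chain G₁ G₂ H₁ H₂ hG₁ hG₂ hH₁ hH₂ hyp _ _ _
  | fork G₁ G₂ H₁ H₂ hG₁ hG₂ hH₁ hH₂ hyp p q r =>
    simp only [map_sub, map_smul, f.map_comp]
    exact .fork G₁ G₂ H₁ H₂ hG₁ hG₂ hH₁ hH₂ hyp _ _ _
  | cofork G₁ G₂ H₁ H₂ hG₁ hG₂ hH₁ hH₂ hyp p q r =>
    simp only [map_sub, map_smul, f.map_comp]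
    exact .cofork G₁ G₂ H₁ H₂ hG₁ hG₂ hH₁ hH₂ hyp _ _ _

/-- The homomorphism `P/J → Q` induced by a homomorphism `P → Q` that vanishes on `J`. -/
noncomputable def quotientLift (f : P.Hom Q) (J : P.Ideal)
    (hJ : ∀ m n d x, x ∈ J.carrier m n d → f.toLin x = 0) : (quotient J).Hom Q where
  toLin {m n d} := (J.carrier m n d).liftQ f.toLin (fun x hx => hJ m n d x hx)
  map_act σ τ x := by
    obtain ⟨x, rfl⟩ := quotientMap_surjective J x
    exact f.map_act σ τ x
  map_comp G h p q := by
    obtain ⟨p, rfl⟩ := quotientMap_surjective J p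
    obtain ⟨q, rfl⟩ := quotientMap_surjective J q
    exact f.map_comp G h p q
  map_one := f.map_one

/-- The quotient map as a homomorphism. -/
noncomputable def ofQuotient (J : P.Ideal) : P.Hom (quotient J) where
  toLin := quotientMap J
  map_act _ _ _ := rfl
  map_comp _ _ _ _ := rfl
  map_one := rfl

end PreDioperad.Hom

/-! ### The universal property of the free dioperad -/

/-- The value of a formal expression in a predioperad. -/
noncomputable def Expr.eval {M : SBimodule K} (P : PreDioperad K)
    (f : ∀ m n d, M.carrier m n d →ₗ[K] P.carrier m n d) :
    ∀ {m n : ℕ} {d : ℤ}, Expr M m n d → P.carrier m n d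
  | _, _, _, .gen x => f _ _ _ x
  | _, _, _, .one => P.one
  | _, _, _, .act σ τ a => P.act σ τ (a.eval P f)
  | _, _, _, .comp G h a b => P.comp G h (a.eval P f) (b.eval P f)

/-- The evaluation of linear combinations of formal expressions. -/
noncomputable def exprHom {M : SBimodule K} (P : PreDioperad K)
    (f : ∀ m n d, M.carrier m n d →ₗ[K] P.carrier m n d) : (exprPreDioperad M).Hom P where
  toLin := Finsupp.linearCombination K (Expr.eval P f)
  map_act {m n d} σ τ x := by
    have : Finsupp.linearCombination K (Expr.eval P f) ∘ₗ
        Finsupp.lmapDomain K K (Expr.act σ τ) =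
        P.act σ τ ∘ₗ Finsupp.linearCombination K (Expr.eval P f (m := m) (n := n) (d := d)) :=
      Finsupp.lhom_ext fun a c => by
        simp only [LinearMap.comp_apply, Finsupp.lmapDomain_apply, Finsupp.mapDomain_single,
          Finsupp.linearCombination_single, map_smul, Expr.eval]
    exact LinearMap.congr_fun this x
  map_comp {m n m₁ n₁ m₂ n₂ d d₁ d₂} G h p q := by
    have : (Finsupp.linearCombination K
        (fun a => Finsupp.lmapDomain K K (fun b => Expr.comp G h a b))).compr₂
          (Finsupp.linearCombination K (Expr.eval P f)) =
        (P.comp G h).compl₁₂ (Finsupp.linearCombination K (Expr.eval P f))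
          (Finsupp.linearCombination K (Expr.eval P f)) :=
      Finsupp.lhom_ext fun a c => Finsupp.lhom_ext fun b e => by
        simp only [LinearMap.compr₂_apply, LinearMap.compl₁₂_apply, LinearMap.smul_apply,
          Finsupp.lmapDomain_apply, Finsupp.mapDomain_single,
          Finsupp.linearCombination_single, map_smul, Expr.eval, smul_comm c e]
    exact LinearMap.congr_fun (LinearMap.congr_fun this p) q
  map_one := by
    change Finsupp.linearCombination K (Expr.eval P f) (Finsupp.single Expr.one 1) = _
    rw [Finsupp.linearCombination_single, one_smul]
    rfl

theorem exprHom_exprGen {M : SBimodule K} (P : PreDioperad K)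
    (f : ∀ m n d, M.carrier m n d →ₗ[K] P.carrier m n d) {m n : ℕ} {d : ℤ}
    (x : M.carrier m n d) : (exprHom P f).toLin (exprGen M x) = f m n d x := by
  change Finsupp.linearCombination K (Expr.eval P f) (Finsupp.single (Expr.gen x) 1) = _
  rw [Finsupp.linearCombination_single, one_smul]
  rfl

/-- The homomorphism `F(M) → P` induced by a map `M → P` of `S`-bimodules. -/
noncomputable def freeLift {M : SBimodule K} (P : Dioperad K)
    (f : ∀ m n d, M.carrier m n d →ₗ[K] P.carrier m n d)
    (hf : ∀ (m n : ℕ) (d : ℤ) (σ : Equiv.Perm (Fin m)) (τ : Equiv.Perm (Fin n))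
      (x : M.carrier m n d), f m n d (M.act σ τ x) = P.act σ τ (f m n d x)) :
    (free M).toPreDioperad.Hom P.toPreDioperad :=
  (exprHom P.toPreDioperad f).quotientLift (freeIdeal M) (fun m n d x hx => by
    refine PreDioperad.Hom.toLin_eq_zero_of_mem_span _ _ ?_ hx
    -- Laws die because `P` satisfies them; the other three kinds of relation express that `f` is
    -- additive, homogeneous and equivariant.
    rintro m n d _ (⟨x, hx⟩ | ⟨x, y⟩ | ⟨c, x⟩ | ⟨σ, τ, x⟩)
    · exact P.laws _ _ _ _ (PreDioperad.Hom.defect_toLin _ hx)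
    · simp only [map_sub, map_add, exprHom_exprGen, sub_self]
    · simp only [map_sub, map_smul, exprHom_exprGen, sub_self]
    · simp only [map_sub, PreDioperad.Hom.map_act, exprHom_exprGen, hf, sub_self])

theorem freeLift_freeGen {M : SBimodule K} (P : Dioperad K)
    (f : ∀ m n d, M.carrier m n d →ₗ[K] P.carrier m n d)
    (hf : ∀ (m n : ℕ) (d : ℤ) (σ : Equiv.Perm (Fin m)) (τ : Equiv.Perm (Fin n))
      (x : M.carrier m n d), f m n d (M.act σ τ x) = P.act σ τ (f m n d x))
    {m n : ℕ} {d : ℤ} (x : M.carrier m n d) :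
    (freeLift P f hf).toLin (freeGen M x) = f m n d x :=
  exprHom_exprGen P.toPreDioperad f x

/-- The class in `F(M)` of a formal expression. -/
noncomputable def freeMk {M : SBimodule K} {m n : ℕ} {d : ℤ} (a : Expr M m n d) :
    (free M).carrier m n d :=
  PreDioperad.quotientMap (freeIdeal M) (Finsupp.single a (1 : K) : Expr M m n d →₀ K)

theorem freeMk_act {M : SBimodule K} {m n : ℕ} {d : ℤ} (σ : Equiv.Perm (Fin m))
    (τ : Equiv.Perm (Fin n)) (a : Expr M m n d) :
    freeMk (.act σ τ a) = (free M).act σ τ (freeMk a) := by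
  refine congrArg (PreDioperad.quotientMap (freeIdeal M)) ?_
  exact (Finsupp.mapDomain_single (f := Expr.act σ τ) (a := a) (b := (1 : K))).symm

theorem freeMk_comp {M : SBimodule K} {m n m₁ n₁ m₂ n₂ : ℕ} {d d₁ d₂ : ℤ}
    (G : TwoVertexGraph m n m₁ n₁ m₂ n₂) (h : d₁ + d₂ = d) (a : Expr M m₁ n₁ d₁)
    (b : Expr M m₂ n₂ d₂) :
    freeMk (.comp G h a b) = (free M).comp G h (freeMk a) (freeMk b) := by
  refine congrArg (PreDioperad.quotientMap (freeIdeal M)) ?_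
  change _ = Finsupp.linearCombination K
    (fun a => Finsupp.lmapDomain K K (fun b => Expr.comp G h a b)) (Finsupp.single a (1 : K))
    (Finsupp.single b (1 : K))
  rw [Finsupp.linearCombination_single, one_smul, Finsupp.lmapDomain_apply,
    Finsupp.mapDomain_single]

/-- Homomorphisms out of a free dioperad are determined by their values on the generators. -/
theorem free_hom_ext {M : SBimodule K} {P : PreDioperad K}
    (f g : (free M).toPreDioperad.Hom P)
    (h : ∀ (m n : ℕ) (d : ℤ) (x : M.carrier m n d), f.toLin (freeGen M x) = g.toLin (freeGen M x))
    {m n : ℕ} {d : ℤ} (x : (free M).carrier m n d) : f.toLin x = g.toLin x := by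
  have key : ∀ {m n : ℕ} {d : ℤ} (a : Expr M m n d), f.toLin (freeMk a) = g.toLin (freeMk a) := by
    intro m n d a
    induction a with
    | gen x => exact h _ _ _ x
    | one => exact f.map_one.trans g.map_one.symm
    | act σ τ a ih => rw [freeMk_act, f.map_act, g.map_act, ih]
    | comp G hd a b iha ihb => rw [freeMk_comp, f.map_comp, g.map_comp, iha, ihb]
  obtain ⟨x, rfl⟩ := PreDioperad.quotientMap_surjective (freeIdeal M) x
  -- Classes of single expressions span F(M), so the agreement on them extends by linearity.
  have hmap : (f.toLin ∘ₗ PreDioperad.quotientMap (freeIdeal M) : (Expr M m n d →₀ K) →ₗ[K] _) =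
      g.toLin ∘ₗ PreDioperad.quotientMap (freeIdeal M) :=
    Finsupp.lhom_ext' fun a => LinearMap.ext_ring (key a)
  exact LinearMap.congr_fun hmap x

/-! ### Structure maps of F_(2)(M), computed on decorated graphs -/

/-- Linear maps out of `F_(2)(M)` are determined by their values on decorated graphs. -/
theorem WeightTwo.hom_ext {M : SBimodule K} {m n : ℕ} {d : ℤ} {V : Type*} [AddCommGroup V]
    [Module K V] {f g : WeightTwo M m n d →ₗ[K] V}
    (h : ∀ (m₁ n₁ m₂ n₂ : ℕ) (d₁ d₂ : ℤ) (hd : d₁ + d₂ = d) (G : TwoVertexGraph m n m₁ n₁ m₂ n₂)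
      (p : M.carrier m₁ n₁ d₁) (q : M.carrier m₂ n₂ d₂),
      f (decorated M G hd p q) = g (decorated M G hd p q)) : f = g := by
  classical
  refine DirectSum.linearMap_ext K fun a => ?_
  refine Submodule.linearMap_qext _ ?_
  refine Finsupp.lhom_ext' fun G => ?_
  refine TensorProduct.ext' fun p q => ?_
  simpa [decorated] using h a.m₁ a.n₁ a.m₂ a.n₂ a.d₁ a.d₂ a.add_eq G p q

theorem WeightTwo.toFree_decorated {M : SBimodule K} {m n m₁ n₁ m₂ n₂ : ℕ} {d d₁ d₂ : ℤ}
    (G : TwoVertexGraph m n m₁ n₁ m₂ n₂) (h : d₁ + d₂ = d)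
    (p : M.carrier m₁ n₁ d₁) (q : M.carrier m₂ n₂ d₂) :
    WeightTwo.toFree M m n d (decorated M G h p q) =
      (free M).comp G h (freeGen M p) (freeGen M q) := by
  classical
  rw [decorated, WeightTwo.toFree, DirectSum.toModule_lof, DecoratedGraphs.toFree]
  simp [LinearMap.compl₁₂_apply]

theorem WeightTwo.act_decorated {M : SBimodule K} {m n m₁ n₁ m₂ n₂ : ℕ} {d d₁ d₂ : ℤ}
    (G : TwoVertexGraph m n m₁ n₁ m₂ n₂) (h : d₁ + d₂ = d)
    (p : M.carrier m₁ n₁ d₁) (q : M.carrier m₂ n₂ d₂) (σ : Equiv.Perm (Fin m))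
    (τ : Equiv.Perm (Fin n)) :
    WeightTwo.act M σ τ (decorated M G h p q) = decorated M (G.relabelGlobal σ τ) h p q := by
  classical
  rw [decorated, WeightTwo.act, DirectSum.lmap_lof, DecoratedGraphs.act, Submodule.mkQ_apply,
    Submodule.mapQ_apply, Finsupp.lmapDomain_apply, Finsupp.mapDomain_single]
  rfl

theorem WeightTwo.map_decorated {M N : SBimodule K} (θ : M.Iso N) {m n m₁ n₁ m₂ n₂ : ℕ}
    {d d₁ d₂ : ℤ} (G : TwoVertexGraph m n m₁ n₁ m₂ n₂) (h : d₁ + d₂ = d)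
    (p : M.carrier m₁ n₁ d₁) (q : M.carrier m₂ n₂ d₂) :
    WeightTwo.map θ m n d (decorated M G h p q) = decorated N G h (θ.toEquiv p) (θ.toEquiv q) := by
  classical
  rw [decorated, WeightTwo.map, DirectSum.lmap_lof, DecoratedGraphs.map, Submodule.mkQ_apply,
    Submodule.mapQ_apply, Finsupp.mapRange.linearMap_apply, Finsupp.mapRange_single]
  rfl

theorem WeightTwo.toFree_act {M : SBimodule K} {m n : ℕ} {d : ℤ} (σ : Equiv.Perm (Fin m))
    (τ : Equiv.Perm (Fin n)) (x : WeightTwo M m n d) :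
    WeightTwo.toFree M m n d (WeightTwo.act M σ τ x) =
      (free M).act σ τ (WeightTwo.toFree M m n d x) := by
  have : WeightTwo.toFree M m n d ∘ₗ WeightTwo.act M σ τ =
      (free M).act σ τ ∘ₗ WeightTwo.toFree M m n d := by
    refine WeightTwo.hom_ext fun m₁ n₁ m₂ n₂ d₁ d₂ hd G p q => ?_
    simp only [LinearMap.comp_apply, WeightTwo.act_decorated, WeightTwo.toFree_decorated]
    exact sub_eq_zero.1 ((free M).laws _ _ _ _ (.comp_global G hd σ τ _ _))
  exact LinearMap.congr_fun this x

theorem SBimodule.Iso.map_act_symm {M N : SBimodule K} (θ : M.Iso N) {m n : ℕ} {d : ℤ}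
    (σ : Equiv.Perm (Fin m)) (τ : Equiv.Perm (Fin n)) (x : N.carrier m n d) :
    θ.toEquiv.symm (N.act σ τ x) = M.act σ τ (θ.toEquiv.symm x) := by
  rw [LinearEquiv.symm_apply_eq, θ.map_act, LinearEquiv.apply_symm_apply]

/-- The inverse of an isomorphism of `S`-bimodules. -/
def SBimodule.Iso.symm {M N : SBimodule K} (θ : M.Iso N) : N.Iso M where
  toEquiv := θ.toEquiv.symm
  map_act := θ.map_act_symm

theorem WeightTwo.map_map_symm {M N : SBimodule K} (θ : M.Iso N) {m n : ℕ} {d : ℤ}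
    (y : WeightTwo N m n d) : WeightTwo.map θ m n d (WeightTwo.map θ.symm m n d y) = y := by
  have : WeightTwo.map θ m n d ∘ₗ WeightTwo.map θ.symm m n d = LinearMap.id := by
    refine WeightTwo.hom_ext fun m₁ n₁ m₂ n₂ d₁ d₂ hd G p q => ?_
    simp only [LinearMap.comp_apply, WeightTwo.map_decorated, LinearMap.id_apply]
    simp only [SBimodule.Iso.symm, LinearEquiv.apply_symm_apply]
  exact LinearMap.congr_fun this y

theorem WeightTwo.map_surjective {M N : SBimodule K} (θ : M.Iso N) (m n : ℕ) (d : ℤ) :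
    Function.Surjective (WeightTwo.map θ m n d) :=
  fun y => ⟨_, WeightTwo.map_map_symm θ y⟩

/-! ### Homomorphisms between quadratic dioperads -/

namespace QuadraticData

variable (Q : QuadraticData K)

/-- The projection `F(M) → F(M)/(R)`. -/
noncomputable def proj : (free Q.generators).toPreDioperad.Hom Q.dioperad.toPreDioperad :=
  .ofQuotient Q.ideal

/-- An ideal is stable under the symmetric groups, so it contains all translates of the relations.
Only this inclusion is needed for the comparison of quotients. -/
theorem toFree_mem_ideal {m n : ℕ} {d : ℤ} {x : WeightTwo Q.generators m n d}
    (hx : x ∈ WeightTwo.generated Q.generators Q.relations m n d) :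
    WeightTwo.toFree Q.generators m n d x ∈ Q.ideal.carrier m n d := by
  have hle : WeightTwo.generated Q.generators Q.relations m n d ≤
      (Q.ideal.carrier m n d).comap (WeightTwo.toFree Q.generators m n d) := by
    rw [WeightTwo.generated, Submodule.span_le]
    rintro _ ⟨σ, τ, x, hx, rfl⟩
    rw [SetLike.mem_coe, Submodule.mem_comap, WeightTwo.toFree_act]
    exact Q.ideal.act_mem σ τ (PreDioperad.Ideal.subset_span _ m n d ⟨x, hx, rfl⟩)
  exact hle hx

theorem gen_act {m n : ℕ} {d : ℤ} (σ : Equiv.Perm (Fin m)) (τ : Equiv.Perm (Fin n))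
    (x : Q.generators.carrier m n d) :
    Q.gen (Q.generators.act σ τ x) = Q.dioperad.act σ τ (Q.gen x) := by
  rw [gen, freeGen_act]
  rfl

/-- Homomorphisms out of `F(M)/(R)` are determined by their values on the generators. -/
theorem hom_ext {P : PreDioperad K} (f g : Q.dioperad.toPreDioperad.Hom P)
    (h : ∀ (m n : ℕ) (d : ℤ) (x : Q.generators.carrier m n d),
      f.toLin (Q.gen x) = g.toLin (Q.gen x)) {m n : ℕ} {d : ℤ}
    (x : Q.dioperad.carrier m n d) : f.toLin x = g.toLin x := by
  obtain ⟨x, rfl⟩ := PreDioperad.quotientMap_surjective Q.ideal x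
  exact free_hom_ext (f.comp Q.proj) (g.comp Q.proj) h x

variable {Q} {Q' : QuadraticData K}

/-- An isomorphism `θ` of the generators sends `gen` to a map of `S`-bimodules into `F(M')/(R')`. -/
noncomputable def genMap (θ : Q.generators.Iso Q'.generators) (m n : ℕ) (d : ℤ) :
    Q.generators.carrier m n d →ₗ[K] Q'.dioperad.carrier m n d :=
  (Q'.proj.toLin ∘ₗ freeGen Q'.generators) ∘ₗ θ.toEquiv.toLinearMap

/-- The homomorphism `F(M) → F(M')/(R')` induced by an isomorphism `M → M'`. -/
noncomputable def mapFree (θ : Q.generators.Iso Q'.generators) :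
    (free Q.generators).toPreDioperad.Hom Q'.dioperad.toPreDioperad :=
  freeLift Q'.dioperad (genMap θ) (fun m n d σ τ x => by
    change Q'.gen (θ.toEquiv _) = _
    rw [θ.map_act, gen_act]
    rfl)

theorem mapFree_freeGen (θ : Q.generators.Iso Q'.generators) {m n : ℕ} {d : ℤ}
    (x : Q.generators.carrier m n d) :
    (mapFree θ).toLin (freeGen Q.generators x) = Q'.gen (θ.toEquiv x) :=
  freeLift_freeGen _ _ _ x

/-- The extension of `θ` acts on a two-vertex graph through its decorations alone. Thus a
computation inside F_(2) suffices to show that relations are sent to zero in the quotient. -/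
theorem mapFree_toFree (θ : Q.generators.Iso Q'.generators) {m n : ℕ} {d : ℤ}
    (x : WeightTwo Q.generators m n d) :
    (mapFree θ).toLin (WeightTwo.toFree Q.generators m n d x) =
      Q'.proj.toLin
        (WeightTwo.toFree Q'.generators m n d (WeightTwo.map θ m n d x)) := by
  have : (mapFree θ).toLin ∘ₗ WeightTwo.toFree Q.generators m n d =
      (Q'.proj.toLin ∘ₗ WeightTwo.toFree Q'.generators m n d) ∘ₗ
        WeightTwo.map θ m n d := by
    refine WeightTwo.hom_ext fun m₁ n₁ m₂ n₂ d₁ d₂ hd G p q => ?_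
    rw [LinearMap.comp_apply, LinearMap.comp_apply, LinearMap.comp_apply,
      WeightTwo.map_decorated, WeightTwo.toFree_decorated, WeightTwo.toFree_decorated,
      PreDioperad.Hom.map_comp, mapFree_freeGen, mapFree_freeGen]
    rfl
  exact LinearMap.congr_fun this x

/-- The homomorphism `F(M)/(R) → F(M')/(R')` induced by an isomorphism `M → M'` that maps `R`
into the weight two part of `(R')`. -/
noncomputable def mapHom (θ : Q.generators.Iso Q'.generators)
    (hθ : ∀ (m n : ℕ) (d : ℤ), ∀ x ∈ Q.relations m n d, WeightTwo.map θ m n d x ∈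
      WeightTwo.generated Q'.generators Q'.relations m n d) :
    Q.dioperad.toPreDioperad.Hom Q'.dioperad.toPreDioperad :=
  (mapFree θ).quotientLift Q.ideal (fun m n d x hx => by
    refine PreDioperad.Hom.toLin_eq_zero_of_mem_span _ _ ?_ hx
    rintro m n d _ ⟨x, hx, rfl⟩
    rw [mapFree_toFree]
    exact (Submodule.Quotient.mk_eq_zero _).2 (Q'.toFree_mem_ideal (hθ m n d x hx)))

theorem mapHom_gen (θ : Q.generators.Iso Q'.generators)
    (hθ : ∀ (m n : ℕ) (d : ℤ), ∀ x ∈ Q.relations m n d, WeightTwo.map θ m n d x ∈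
      WeightTwo.generated Q'.generators Q'.relations m n d) {m n : ℕ} {d : ℤ}
    (x : Q.generators.carrier m n d) :
    (mapHom θ hθ).toLin (Q.gen x) = Q'.gen (θ.toEquiv x) :=
  mapFree_freeGen θ x

/-- An isomorphism `M → M'` that matches the weight two parts of `(R)` and `(R')` induces an
isomorphism `F(M)/(R) → F(M')/(R')`. -/
theorem exists_iso (θ : Q.generators.Iso Q'.generators)
    (h₁ : ∀ (m n : ℕ) (d : ℤ), ∀ x ∈ Q.relations m n d, WeightTwo.map θ m n d x ∈
      WeightTwo.generated Q'.generators Q'.relations m n d)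
    (h₂ : ∀ (m n : ℕ) (d : ℤ), ∀ x ∈ Q'.relations m n d, WeightTwo.map θ.symm m n d x ∈
      WeightTwo.generated Q.generators Q.relations m n d) :
    ∃ Φ : Q.dioperad.Iso Q'.dioperad, ∀ (m n : ℕ) (d : ℤ) (x : Q.generators.carrier m n d),
      Φ.toEquiv (Q.gen x) = Q'.gen (θ.toEquiv x) := by
  -- Both composites fix the generators, and a homomorphism out of F(M)/(R) is determined by those.
  have hl : ∀ {m n : ℕ} {d : ℤ} (x : Q.dioperad.carrier m n d),
      (mapHom θ.symm h₂).toLin ((mapHom θ h₁).toLin x) = x := fun x =>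
    hom_ext Q ((mapHom θ.symm h₂).comp (mapHom θ h₁))
      ⟨LinearMap.id, fun _ _ _ => rfl, fun _ _ _ _ => rfl, rfl⟩ (fun m n d x => by
        change (mapHom θ.symm h₂).toLin ((mapHom θ h₁).toLin (Q.gen x)) = Q.gen x
        rw [mapHom_gen, mapHom_gen]
        exact congrArg _ (θ.toEquiv.symm_apply_apply x)) x
  have hr : ∀ {m n : ℕ} {d : ℤ} (x : Q'.dioperad.carrier m n d),
      (mapHom θ h₁).toLin ((mapHom θ.symm h₂).toLin x) = x := fun x =>
    hom_ext Q' ((mapHom θ h₁).comp (mapHom θ.symm h₂))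
      ⟨LinearMap.id, fun _ _ _ => rfl, fun _ _ _ _ => rfl, rfl⟩ (fun m n d x => by
        change (mapHom θ h₁).toLin ((mapHom θ.symm h₂).toLin (Q'.gen x)) = Q'.gen x
        rw [mapHom_gen, mapHom_gen]
        exact congrArg _ (θ.toEquiv.apply_symm_apply x)) x
  exact ⟨⟨LinearEquiv.ofLinearMap (mapHom θ h₁).toLin (mapHom θ.symm h₂).toLin
      (LinearMap.ext hr) (LinearMap.ext hl), (mapHom θ h₁).map_act, (mapHom θ h₁).map_comp,
      (mapHom θ h₁).map_one⟩, fun m n d x => mapHom_gen θ h₁ x⟩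

end QuadraticData

end Universal

/-! ### Signs and finiteness of graphs -/

theorem bijSign_trans_perm {a b : ℕ} (e : Fin a ≃ Fin b) (π : Equiv.Perm (Fin b)) :
    bijSign (e.trans π) = Equiv.Perm.sign π * bijSign e := by
  obtain rfl : a = b := Fin.equiv_iff_eq.1 ⟨e⟩
  exact Equiv.Perm.sign_mul π e

/-- Relabelling fixes `none`, the slot of the internal edge, so it permutes the reference sequence
(edge, 0, …, m-1) with the sign of `σ`. -/
theorem labelSign_trans_optionCongr {a b m : ℕ} (e : Fin a ⊕ Fin b ≃ Option (Fin m))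
    (σ : Equiv.Perm (Fin m)) :
    labelSign (e.trans (Equiv.optionCongr σ)) = Equiv.Perm.sign σ * labelSign e := by
  have h : (finSumFinEquiv.symm.trans (e.trans (Equiv.optionCongr σ))).trans
      (finSuccEquiv m).symm = ((finSumFinEquiv.symm.trans e).trans (finSuccEquiv m).symm).trans
        ((finSuccEquiv m).symm.permCongr (Equiv.optionCongr σ)) := by
    ext x
    simp [Equiv.permCongr_apply]
  rw [labelSign, h, bijSign_trans_perm, Equiv.Perm.sign_permCongr, Equiv.optionCongr_sign]
  rfl

namespace TwoVertexGraph

variable {m n m₁ n₁ m₂ n₂ : ℕ}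

instance : Finite (TwoVertexGraph m n m₁ n₁ m₂ n₂) :=
  Finite.of_injective (fun G => (G.out, G.inp)) fun G H h => by
    cases G
    cases H
    simpa using h

noncomputable instance : Fintype (TwoVertexGraph m n m₁ n₁ m₂ n₂) := Fintype.ofFinite _

theorem labelSign_out_relabelLocal (G : TwoVertexGraph m n m₁ n₁ m₂ n₂)
    (g : LocalGroup m₁ n₁ m₂ n₂) : labelSign (G.relabelLocal g).out =
      Equiv.Perm.sign g.1 * Equiv.Perm.sign g.2.2.1 * labelSign G.out :=
  labelSign_trans _ _ _

theorem labelSign_out_relabelGlobal (G : TwoVertexGraph m n m₁ n₁ m₂ n₂)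
    (σ : Equiv.Perm (Fin m)) (τ : Equiv.Perm (Fin n)) :
    labelSign (G.relabelGlobal σ τ).out = Equiv.Perm.sign σ * labelSign G.out :=
  labelSign_trans_optionCongr _ _

theorem labelSign_inp_relabelGlobal (G : TwoVertexGraph m n m₁ n₁ m₂ n₂)
    (σ : Equiv.Perm (Fin m)) (τ : Equiv.Perm (Fin n)) :
    labelSign (G.relabelGlobal σ τ).inp = Equiv.Perm.sign τ * labelSign G.inp := by
  -- The right action enters the graph through τ⁻¹, which has the same sign.
  rw [← Equiv.Perm.sign_inv τ]
  exact labelSign_trans_optionCongr _ _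

/-- The local group acts freely, because distinct half-edges carry distinct labels. Every
isomorphism class thus has as many labelled representatives as the local group has elements. -/
theorem relabelLocal_injective (G : TwoVertexGraph m n m₁ n₁ m₂ n₂) :
    Function.Injective G.relabelLocal := by
  rintro ⟨g₁, g₂, g₃, g₄⟩ ⟨h₁, h₂, h₃, h₄⟩ h
  have ho := fun x => congrArg (fun e => e x) (congrArg TwoVertexGraph.out h)
  have hi := fun x => congrArg (fun e => e x) (congrArg TwoVertexGraph.inp h)
  simp only [relabelLocal, Equiv.trans_apply, EmbeddingLike.apply_eq_iff_eq] at ho hi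
  simp only [Prod.mk.injEq]
  refine ⟨?_, ?_, ?_, ?_⟩ <;> ext x
  · simpa [Fin.ext_iff] using ho (.inl x)
  · simpa [Fin.ext_iff] using hi (.inl x)
  · simpa [Fin.ext_iff] using ho (.inr x)
  · simpa [Fin.ext_iff] using hi (.inr x)

theorem relabelGlobal_bijective (σ : Equiv.Perm (Fin m)) (τ : Equiv.Perm (Fin n)) :
    Function.Bijective (fun G : TwoVertexGraph m n m₁ n₁ m₂ n₂ => G.relabelGlobal σ τ) := by
  refine Finite.injective_iff_bijective.1 fun G H h => ?_
  have ho := fun x => congrArg (fun e => e x) (congrArg TwoVertexGraph.out h)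
  have hi := fun x => congrArg (fun e => e x) (congrArg TwoVertexGraph.inp h)
  simp only [relabelGlobal, Equiv.trans_apply, EmbeddingLike.apply_eq_iff_eq] at ho hi
  exact TwoVertexGraph.ext (Equiv.ext ho) (Equiv.ext hi)

end TwoVertexGraph

/-! ### Decorated graphs -/

section Decorated

variable {K : Type v} [Field K] {M : SBimodule K} {m n m₁ n₁ m₂ n₂ : ℕ} {d d₁ d₂ : ℤ}

theorem decorated_relabelLocal (G : TwoVertexGraph m n m₁ n₁ m₂ n₂) (h : d₁ + d₂ = d)
    (g : LocalGroup m₁ n₁ m₂ n₂) (p : M.carrier m₁ n₁ d₁) (q : M.carrier m₂ n₂ d₂) :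
    decorated M (G.relabelLocal g) h p q =
      decorated M G h (M.act g.1 g.2.1⁻¹ p) (M.act g.2.2.1 g.2.2.2⁻¹ q) := by
  classical
  refine congrArg (DirectSum.lof K (Arity d) (fun a => DecoratedGraphs M a m n)
    ⟨m₁, n₁, m₂, n₂, d₁, d₂, h⟩) ?_
  exact (Submodule.Quotient.eq _).2 (Submodule.subset_span ⟨G, g, p ⊗ₜ[K] q, rfl⟩)

/-- The decorations of a graph as a bilinear map. -/
noncomputable def decoratedHom (M : SBimodule K) (G : TwoVertexGraph m n m₁ n₁ m₂ n₂)
    (h : d₁ + d₂ = d) :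
    M.carrier m₁ n₁ d₁ →ₗ[K] M.carrier m₂ n₂ d₂ →ₗ[K] WeightTwo M m n d :=
  open scoped Classical in
  (TensorProduct.mk K _ _).compr₂ (DirectSum.lof K (Arity d)
    (fun a => DecoratedGraphs M a m n) ⟨m₁, n₁, m₂, n₂, d₁, d₂, h⟩ ∘ₗ
      (localRelations M ⟨m₁, n₁, m₂, n₂, d₁, d₂, h⟩ m n).mkQ ∘ₗ Finsupp.lsingle G)

theorem decoratedHom_apply (G : TwoVertexGraph m n m₁ n₁ m₂ n₂) (h : d₁ + d₂ = d)
    (p : M.carrier m₁ n₁ d₁) (q : M.carrier m₂ n₂ d₂) :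
    decoratedHom M G h p q = decorated M G h p q := rfl

theorem decorated_smul_smul (G : TwoVertexGraph m n m₁ n₁ m₂ n₂) (h : d₁ + d₂ = d) (a b : ℤˣ)
    (p : M.carrier m₁ n₁ d₁) (q : M.carrier m₂ n₂ d₂) :
    decorated M G h (a • p) (b • q) = (a * b) • decorated M G h p q := by
  simp only [← decoratedHom_apply, Units.smul_def, map_zsmul, LinearMap.smul_apply, smul_smul,
    Units.val_mul, mul_comm]

/-- The pairing of two decorated graphs. -/
theorem WeightTwo.pairing_decorated (G G' : TwoVertexGraph m n m₁ n₁ m₂ n₂) (h : d₁ + d₂ = d)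
    (h' : -d₁ + -d₂ = -d) (φ : M.czechDual.carrier m₁ n₁ d₁) (ψ : M.czechDual.carrier m₂ n₂ d₂)
    (p : M.carrier m₁ n₁ (-d₁)) (q : M.carrier m₂ n₂ (-d₂)) :
    WeightTwo.pairing M m n d (decorated M.czechDual G h φ ψ) (decorated M G' h' p q) =
      prePairing M ⟨m₁, n₁, m₂, n₂, d₁, d₂, h⟩ G (φ ⊗ₜ ψ) (Finsupp.single G' (p ⊗ₜ q)) := by
  classical
  rw [decorated, WeightTwo.pairing, DirectSum.toModule_lof, LinearMap.compl₂_apply]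
  refine (congrArg _ (DirectSum.component.lof_self K _ _)).trans ?_
  simp [DecoratedGraphs.pairing]

/-- The pairing sees only the summand of matching arity. The number of outputs of the lower vertex
already separates a bracket above a cobracket from a cobracket above a bracket. -/
theorem WeightTwo.pairing_decorated_of_ne {m₁' n₁' m₂' n₂' : ℕ} {d₁' d₂' : ℤ}
    (G : TwoVertexGraph m n m₁ n₁ m₂ n₂) (G' : TwoVertexGraph m n m₁' n₁' m₂' n₂')
    (h : d₁ + d₂ = d) (h' : d₁' + d₂' = -d) (φ : M.czechDual.carrier m₁ n₁ d₁)
    (ψ : M.czechDual.carrier m₂ n₂ d₂) (p : M.carrier m₁' n₁' d₁') (q : M.carrier m₂' n₂' d₂')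
    (hne : m₁' ≠ m₁) :
    WeightTwo.pairing M m n d (decorated M.czechDual G h φ ψ) (decorated M G' h' p q) = 0 := by
  classical
  rw [decorated, WeightTwo.pairing, DirectSum.toModule_lof, LinearMap.compl₂_apply]
  refine (congrArg _ ?_).trans (map_zero _)
  rw [decorated, DirectSum.component.of, dif_neg]
  intro e
  exact hne (congrArg Arity.m₁ e)

/-! ### Signed sums over all labelled graphs -/

/-- The sum of all two-vertex graphs of given arities, with the signs of their outputs. -/
noncomputable def graphSum (M : SBimodule K) (m n : ℕ) (h : d₁ + d₂ = d) (p : M.carrier m₁ n₁ d₁)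
    (q : M.carrier m₂ n₂ d₂) : WeightTwo M m n d :=
  ∑ G : TwoVertexGraph m n m₁ n₁ m₂ n₂, labelSign G.out • decorated M G h p q

/-- Global relabelling permutes the index set of the sum and changes each output sign by sgn σ; `τ`
does not touch the outputs. -/
theorem act_graphSum (h : d₁ + d₂ = d) (p : M.carrier m₁ n₁ d₁) (q : M.carrier m₂ n₂ d₂)
    (σ : Equiv.Perm (Fin m)) (τ : Equiv.Perm (Fin n)) :
    WeightTwo.act M σ τ (graphSum M m n h p q) =
      Equiv.Perm.sign σ • graphSum M m n h p q := by
  rw [graphSum, map_sum, Finset.smul_sum]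
  refine Fintype.sum_bijective _ (TwoVertexGraph.relabelGlobal_bijective σ τ) _ _ fun G => ?_
  rw [TwoVertexGraph.labelSign_out_relabelGlobal, smul_smul, ← mul_assoc,
    Int.units_mul_self, one_mul, ← WeightTwo.act_decorated]
  simp only [Units.smul_def, map_zsmul]

/-- Each `g` in the local group contributes one term, coming from `G` relabelled by `g`. These terms
are all equal: the output signs of the sum cancel both the output part of ε(G) and the sign by which
`g` acts on p ⊗ q. -/
theorem pairing_graphSum (hM : ∀ {m n : ℕ} {d : ℤ} (σ : Equiv.Perm (Fin m))
      (τ : Equiv.Perm (Fin n)) (x : M.carrier m n d), M.act σ τ x = Equiv.Perm.sign σ • x)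
    (G : TwoVertexGraph m n m₁ n₁ m₂ n₂) (h : d₁ + d₂ = d) (h' : -d₁ + -d₂ = -d)
    (φ : M.czechDual.carrier m₁ n₁ d₁) (ψ : M.czechDual.carrier m₂ n₂ d₂)
    (p : M.carrier m₁ n₁ (-d₁)) (q : M.carrier m₂ n₂ (-d₂)) :
    WeightTwo.pairing M m n d (decorated M.czechDual G h φ ψ) (graphSum M m n h' p q) =
      ((-1) ^ m₁ * labelSign G.inp : ℤˣ) • (Fintype.card (LocalGroup m₁ n₁ m₂ n₂) •
        (M.czechEval φ p * M.czechEval ψ q)) := by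
  classical
  have hsum : ∀ G' : TwoVertexGraph m n m₁ n₁ m₂ n₂,
      WeightTwo.pairing M m n d (decorated M.czechDual G h φ ψ)
        (labelSign G'.out • decorated M G' h' p q) =
      ∑ g : LocalGroup m₁ n₁ m₂ n₂, if G.relabelLocal g = G' then
        ((-1) ^ m₁ * labelSign G.inp : ℤˣ) • (M.czechEval φ p * M.czechEval ψ q) else 0 := by
    intro G'
    rw [Units.smul_def, map_zsmul, WeightTwo.pairing_decorated, prePairing_apply, Finset.smul_sum,
      Finset.smul_sum]
    refine Finset.sum_congr rfl fun g _ => ?_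
    split_ifs with hg
    · subst hg
      rw [Finsupp.single_eq_same]
      have e : Decoration.act M (Arity.neg ⟨m₁, n₁, m₂, n₂, d₁, d₂, h⟩) g (p ⊗ₜ q) =
          (Equiv.Perm.sign g.1 * Equiv.Perm.sign g.2.2.1) • (p ⊗ₜ q) := by
        rw [Decoration.act, TensorProduct.map_tmul, hM, hM]
        simp only [Units.smul_def, ← TensorProduct.smul_tmul', TensorProduct.tmul_smul, smul_smul,
          Units.val_mul]
        rw [mul_comm]
      have e' : Decoration.eval M ⟨m₁, n₁, m₂, n₂, d₁, d₂, h⟩ (φ ⊗ₜ ψ) (p ⊗ₜ q) =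
          M.czechEval φ p * M.czechEval ψ q := rfl
      rw [e, Units.smul_def, map_zsmul, e', smul_smul, smul_smul, Units.smul_def,
        TwoVertexGraph.labelSign_out_relabelLocal, TwoVertexGraph.sign, ← Units.val_mul,
        ← Units.val_mul]
      congr 2
      -- Both signs occur twice: `a` in the output sign of the relabelled graph and in the action on
      -- p ⊗ q, `b` in that same output sign and in ε(G).
      generalize Equiv.Perm.sign g.1 * Equiv.Perm.sign g.2.2.1 = a
      generalize labelSign G.out = b
      calc a * b * ((-1) ^ m₁ * b * labelSign G.inp) * a
          = (a * a) * (b * b) * ((-1) ^ m₁ * labelSign G.inp) := by ac_rfl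
        _ = _ := by rw [Int.units_mul_self, Int.units_mul_self, one_mul, one_mul]
    · rw [Finsupp.single_eq_of_ne hg, map_zero, map_zero, smul_zero, smul_zero]
  -- With the sums exchanged, each `g` selects exactly one graph, so the inner sum is constant in
  -- `g`.
  rw [graphSum, map_sum, Finset.sum_congr rfl fun G' _ => hsum G', Finset.sum_comm]
  simp only [Finset.sum_ite_eq, Finset.mem_univ, if_true, Finset.sum_const, Finset.card_univ]
  rw [smul_comm]

/-- The sum of all graphs as a sum over representatives of the isomorphism classes. -/
theorem graphSum_eq (hM : ∀ {m n : ℕ} {d : ℤ} (σ : Equiv.Perm (Fin m))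
      (τ : Equiv.Perm (Fin n)) (x : M.carrier m n d), M.act σ τ x = Equiv.Perm.sign σ • x)
    {ι : Type*} [Fintype ι] (r : ι → TwoVertexGraph m n m₁ n₁ m₂ n₂)
    (hr : Function.Bijective fun k : ι × LocalGroup m₁ n₁ m₂ n₂ => (r k.1).relabelLocal k.2)
    (h : d₁ + d₂ = d) (p : M.carrier m₁ n₁ d₁) (q : M.carrier m₂ n₂ d₂) :
    graphSum M m n h p q = Fintype.card (LocalGroup m₁ n₁ m₂ n₂) •
      ∑ k, labelSign (r k).out • decorated M (r k) h p q := by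
  rw [graphSum, ← Fintype.sum_bijective _ hr _ _ fun _ => rfl, Fintype.sum_prod_type,
    Finset.smul_sum]
  refine Finset.sum_congr rfl fun k _ => ?_
  rw [← Finset.card_univ, ← Finset.sum_const]
  refine Finset.sum_congr rfl fun g _ => ?_
  -- The sign by which `g` acts on the decorations equals the change of the output sign, so all
  -- members of an isomorphism class contribute equally.
  rw [decorated_relabelLocal, hM, hM, decorated_smul_smul,
    TwoVertexGraph.labelSign_out_relabelLocal, smul_smul]
  congr 1
  rw [mul_right_comm, Int.units_mul_self, one_mul]

end Decorated

/-! ### Isomorphism classes of the graphs built from the generators -/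

namespace TwoVertexGraph

/-- Representatives of the orbits of a free action, together with the group, parametrise the whole
set. -/
theorem bijective_relabelLocal {m n m₁ n₁ m₂ n₂ : ℕ} {ι : Type*}
    {r : ι → TwoVertexGraph m n m₁ n₁ m₂ n₂}
    (hsurj : ∀ G, ∃ k g, (r k).relabelLocal g = G)
    (hinj : ∀ k k' g, r k = (r k').relabelLocal g → k = k') :
    Function.Bijective fun k : ι × LocalGroup m₁ n₁ m₂ n₂ => (r k.1).relabelLocal k.2 := by
  refine ⟨?_, fun G => ?_⟩
  · rintro ⟨k, g⟩ ⟨k', g'⟩ h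
    obtain rfl : k = k' := by
      refine hinj k k' (g' * g⁻¹) ?_
      rw [← relabelLocal_mul, ← show (r k).relabelLocal g = (r k').relabelLocal g' from h,
        relabelLocal_mul, mul_inv_cancel, relabelLocal_one]
    exact Prod.ext rfl ((r k).relabelLocal_injective h)
  · obtain ⟨k, g, h⟩ := hsurj G
    exact ⟨(k, g), h⟩

theorem ext_of_forall {m n m₁ n₁ m₂ n₂ : ℕ} {G H : TwoVertexGraph m n m₁ n₁ m₂ n₂}
    (h₁ : ∀ j, G.out (.inl j) = H.out (.inl j)) (h₂ : ∀ j, G.out (.inr j) = H.out (.inr j))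
    (h₃ : ∀ i, G.inp (.inl i) = H.inp (.inl i)) (h₄ : ∀ i, G.inp (.inr i) = H.inp (.inr i)) :
    G = H := by
  ext1 <;> ext1 x <;> rcases x with x | x
  exacts [h₁ x, h₂ x, h₃ x, h₄ x]

end TwoVertexGraph

/-- The three cyclic permutations of `graphYY 0 1 2`. -/
noncomputable def repYY : Fin 3 → TwoVertexGraph 1 3 1 2 1 2 :=
  ![graphYY 0 1 2, graphYY 1 2 0, graphYY 2 0 1]

/-- The three cyclic permutations of `graphCC 0 1 2`. -/
noncomputable def repCC : Fin 3 → TwoVertexGraph 3 1 2 1 2 1 :=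
  ![graphCC 0 1 2, graphCC 1 2 0, graphCC 2 0 1]

/-- The four graphs with a coproduct above a product. -/
noncomputable def repCY : Fin 2 × Fin 2 → TwoVertexGraph 2 2 1 2 2 1 := fun k =>
  ![![graphCY 0 1 0 1, graphCY 0 1 1 0], ![graphCY 1 0 0 1, graphCY 1 0 1 0]] k.1 k.2

theorem repYY_inp_inl (k : Fin 3) (i : Fin 2) :
    (repYY k).inp (.inl i) = ![none, some (k + 2)] i := by
  fin_cases k <;> rfl

theorem repYY_inp_inr (k : Fin 3) (i : Fin 2) :
    (repYY k).inp (.inr i) = ![some k, some (k + 1)] i := by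
  fin_cases k <;> rfl

theorem repCC_out_inl (k : Fin 3) (i : Fin 2) :
    (repCC k).out (.inl i) = ![some k, some (k + 1)] i := by
  fin_cases k <;> rfl

theorem repCC_out_inr (k : Fin 3) (i : Fin 2) :
    (repCC k).out (.inr i) = ![none, some (k + 2)] i := by
  fin_cases k <;> rfl

theorem repCY_out_inl (k : Fin 2 × Fin 2) (i : Fin 1) :
    (repCY k).out (.inl i) = some (k.1 + 1) := by
  obtain ⟨k, l⟩ := k
  fin_cases k <;> fin_cases l <;> fin_cases i <;> rfl

theorem repCY_out_inr (k : Fin 2 × Fin 2) (i : Fin 2) :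
    (repCY k).out (.inr i) = ![some k.1, none] i := by
  obtain ⟨k, l⟩ := k
  fin_cases k <;> fin_cases l <;> rfl

theorem repCY_inp_inl (k : Fin 2 × Fin 2) (i : Fin 2) :
    (repCY k).inp (.inl i) = ![none, some (k.2 + 1)] i := by
  obtain ⟨k, l⟩ := k
  fin_cases k <;> fin_cases l <;> rfl

theorem repCY_inp_inr (k : Fin 2 × Fin 2) (i : Fin 1) :
    (repCY k).inp (.inr i) = some k.2 := by
  obtain ⟨k, l⟩ := k
  fin_cases k <;> fin_cases l <;> fin_cases i <;> rfl

/-- The x's label the two half-edges at the vertex where the internal edge `none` has a neighbour,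
the y's those at the other vertex. It serves the inputs in shape YY (x at the lower vertex) and the
outputs in shape CC (x at the upper vertex). -/
theorem exists_perm_three : ∀ x₀ x₁ y₀ y₁ : Option (Fin 3),
    (x₀ ≠ x₁ ∧ x₀ ≠ y₀ ∧ x₀ ≠ y₁ ∧ x₁ ≠ y₀ ∧ x₁ ≠ y₁ ∧ y₀ ≠ y₁ ∧ (x₀ = none ∨ x₁ = none)) →
    ∃ (k : Fin 3) (s t : Equiv.Perm (Fin 2)),
      (![none, some (k + 2)] (s 0) = x₀ ∧ ![none, some (k + 2)] (s 1) = x₁) ∧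
      (![some k, some (k + 1)] (t 0) = y₀ ∧ ![some k, some (k + 1)] (t 1) = y₁) := by
  decide +kernel

theorem eq_some_zero_of_ne : ∀ x y : Option (Fin 1), x ≠ y → x = none → y = some 0 := by
  decide

theorem exists_perm_two : ∀ x y₀ y₁ : Option (Fin 2), x ≠ y₀ → x ≠ y₁ → y₀ ≠ y₁ → x = none →
    ∃ t : Equiv.Perm (Fin 2), ![some 0, some 1] (t 0) = y₀ ∧ ![some 0, some 1] (t 1) = y₁ := by
  decide +kernel

/-- Two orderings are produced because in `graphCY` the edge comes first among the inputs of the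
lower vertex but second among the outputs of the upper one. -/
theorem exists_perm_edge : ∀ x y₀ y₁ : Option (Fin 2), x ≠ y₀ → x ≠ y₁ → y₀ ≠ y₁ →
    (y₀ = none ∨ y₁ = none) → ∃ (k : Fin 2) (s t : Equiv.Perm (Fin 2)),
      (some k = x ∧ ![none, some (k + 1)] (s 0) = y₀ ∧ ![none, some (k + 1)] (s 1) = y₁) ∧
      ![some (k + 1), none] (t 0) = y₀ ∧ ![some (k + 1), none] (t 1) = y₁ := by
  decide +kernel

/-- Up to isomorphism such a graph is determined by the global input that sits beside the edge at
the lower vertex; the outputs leave no freedom. -/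
theorem repYY_bijective : Function.Bijective
    fun k : Fin 3 × LocalGroup 1 2 1 2 => (repYY k.1).relabelLocal k.2 := by
  refine TwoVertexGraph.bijective_relabelLocal (fun G => ?_) (fun k k' g h => ?_)
  · obtain ⟨j, hj⟩ := G.edge_out
    obtain ⟨i, hi⟩ := G.edge_inp
    have ne : ∀ {x y}, x ≠ y → G.inp x ≠ G.inp y := fun h => G.inp.injective.ne h
    obtain ⟨k, s, t, ⟨h₀, h₁⟩, h₂, h₃⟩ := exists_perm_three (G.inp (.inl 0)) (G.inp (.inl 1))
      (G.inp (.inr 0)) (G.inp (.inr 1)) ⟨ne (by decide), ne (by decide), ne (by decide),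
        ne (by decide), ne (by decide), ne (by decide), by fin_cases i <;> simp_all⟩
    rw [Subsingleton.elim j 0] at hj
    have hl := eq_some_zero_of_ne _ _ (G.out.injective.ne (a₁ := .inr 0) (a₂ := .inl 0)
      (by decide)) hj
    refine ⟨k, (1, s, 1, t), TwoVertexGraph.ext_of_forall (fun j => ?_) (fun j => ?_)
      (fun i => ?_) (fun i => ?_)⟩
    · rw [Subsingleton.elim j 0, hl]
      fin_cases k <;> rfl
    · rw [Subsingleton.elim j 0, hj]
      fin_cases k <;> rfl
    · refine (repYY_inp_inl k (s i)).trans ?_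
      fin_cases i
      exacts [h₀, h₁]
    · refine (repYY_inp_inr k (t i)).trans ?_
      fin_cases i
      exacts [h₂, h₃]
  · have key : ∀ (k k' : Fin 3) (s : Equiv.Perm (Fin 2)),
        (∀ i, (![none, some (k + 2)] i : Option (Fin 3)) = ![none, some (k' + 2)] (s i)) →
          k = k' := by decide +kernel
    refine key k k' g.2.1 fun i => ?_
    rw [← repYY_inp_inl, ← repYY_inp_inl, h]
    rfl

/-- The mirror image of the YY case: the class is determined by the global output beside the edge at
the upper vertex. -/
theorem repCC_bijective : Function.Bijective
    fun k : Fin 3 × LocalGroup 2 1 2 1 => (repCC k.1).relabelLocal k.2 := by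
  refine TwoVertexGraph.bijective_relabelLocal (fun G => ?_) (fun k k' g h => ?_)
  · obtain ⟨j, hj⟩ := G.edge_out
    obtain ⟨i, hi⟩ := G.edge_inp
    have ne : ∀ {x y}, x ≠ y → G.out x ≠ G.out y := fun h => G.out.injective.ne h
    obtain ⟨k, s, t, ⟨h₀, h₁⟩, h₂, h₃⟩ := exists_perm_three (G.out (.inr 0)) (G.out (.inr 1))
      (G.out (.inl 0)) (G.out (.inl 1)) ⟨ne (by decide), ne (by decide), ne (by decide),
        ne (by decide), ne (by decide), ne (by decide), by fin_cases j <;> simp_all⟩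
    rw [Subsingleton.elim i 0] at hi
    have hl := eq_some_zero_of_ne _ _ (G.inp.injective.ne (a₁ := .inl 0) (a₂ := .inr 0)
      (by decide)) hi
    refine ⟨k, (t, 1, s, 1), TwoVertexGraph.ext_of_forall (fun j => ?_) (fun j => ?_)
      (fun i => ?_) (fun i => ?_)⟩
    · refine (repCC_out_inl k (t j)).trans ?_
      fin_cases j
      exacts [h₂, h₃]
    · refine (repCC_out_inr k (s j)).trans ?_
      fin_cases j
      exacts [h₀, h₁]
    · rw [Subsingleton.elim i 0, hi]
      fin_cases k <;> rfl
    · rw [Subsingleton.elim i 0, hl]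
      fin_cases k <;> rfl
  · have key : ∀ (k k' : Fin 3) (s : Equiv.Perm (Fin 2)),
        (∀ i, (![none, some (k + 2)] i : Option (Fin 3)) = ![none, some (k' + 2)] (s i)) →
          k = k' := by decide +kernel
    refine key k k' g.2.2.1 fun i => ?_
    rw [← repCC_out_inr, ← repCC_out_inr, h]
    rfl

/-- The edge uses up the only output of the upper vertex and the only input of the lower one, so
there is a single isomorphism class. -/
theorem graphYC_bijective : Function.Bijective
    fun k : Unit × LocalGroup 2 1 1 2 => graphYC.relabelLocal k.2 := by
  refine TwoVertexGraph.bijective_relabelLocal (r := fun _ : Unit => graphYC) (fun G => ?_)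
    (fun _ _ _ _ => rfl)
  obtain ⟨j, hj⟩ := G.edge_out
  obtain ⟨i, hi⟩ := G.edge_inp
  rw [Subsingleton.elim j 0] at hj
  rw [Subsingleton.elim i 0] at hi
  obtain ⟨s, h₀, h₁⟩ := exists_perm_two (G.out (.inr 0)) (G.out (.inl 0)) (G.out (.inl 1))
    (G.out.injective.ne (by decide)) (G.out.injective.ne (by decide))
    (G.out.injective.ne (by decide)) hj
  obtain ⟨t, h₂, h₃⟩ := exists_perm_two (G.inp (.inl 0)) (G.inp (.inr 0)) (G.inp (.inr 1))
    (G.inp.injective.ne (by decide)) (G.inp.injective.ne (by decide))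
    (G.inp.injective.ne (by decide)) hi
  refine ⟨(), (s, 1, 1, t), TwoVertexGraph.ext_of_forall (fun j => ?_) (fun j => ?_)
    (fun i => ?_) (fun i => ?_)⟩
  · fin_cases j
    exacts [h₀, h₁]
  · rw [Subsingleton.elim j 0, hj]
    rfl
  · rw [Subsingleton.elim i 0, hi]
    rfl
  · fin_cases i
    exacts [h₂, h₃]

/-- The class is given by two independent choices: the global output and the global input attached
to the upper vertex. -/
theorem repCY_bijective : Function.Bijective
    fun k : (Fin 2 × Fin 2) × LocalGroup 1 2 2 1 => (repCY k.1).relabelLocal k.2 := by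
  refine TwoVertexGraph.bijective_relabelLocal (fun G => ?_) (fun k k' g h => ?_)
  · obtain ⟨j, hj⟩ := G.edge_out
    obtain ⟨i, hi⟩ := G.edge_inp
    obtain ⟨k, -, s, ⟨h₀, -, -⟩, h₁, h₂⟩ := exists_perm_edge (G.out (.inl 0)) (G.out (.inr 0))
      (G.out (.inr 1)) (G.out.injective.ne (by decide)) (G.out.injective.ne (by decide))
      (G.out.injective.ne (by decide)) (by fin_cases j <;> simp_all)
    obtain ⟨l, t, -, ⟨h₃, h₄, h₅⟩, -, -⟩ := exists_perm_edge (G.inp (.inr 0)) (G.inp (.inl 0))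
      (G.inp (.inl 1)) (G.inp.injective.ne (by decide)) (G.inp.injective.ne (by decide))
      (G.inp.injective.ne (by decide)) (by fin_cases i <;> simp_all)
    -- Here `k` is the output label at the lower vertex, whereas `repCY` is indexed by the one at
    -- the upper vertex, which is `k + 1` in `Fin 2`.
    refine ⟨(k + 1, l), (1, t, s, 1), TwoVertexGraph.ext_of_forall (fun j => ?_) (fun j => ?_)
      (fun i => ?_) (fun i => ?_)⟩
    · refine (repCY_out_inl _ _).trans ?_
      rw [Subsingleton.elim j 0, ← h₀, add_assoc]
      exact congrArg some (add_zero k)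
    · refine (repCY_out_inr _ (s j)).trans ?_
      fin_cases j
      exacts [h₁, h₂]
    · refine (repCY_inp_inl _ (t i)).trans ?_
      fin_cases i
      exacts [h₄, h₅]
    · refine (repCY_inp_inr _ _).trans ?_
      rw [Subsingleton.elim i 0]
      exact h₃
  · refine Prod.ext ?_ ?_
    · have := (repCY_out_inl k 0).symm.trans ((congrArg (fun H => H.out (.inl 0)) h).trans
        (repCY_out_inl k' _))
      simpa using this
    · have := (repCY_inp_inr k 0).symm.trans ((congrArg (fun H => H.inp (.inr 0)) h).trans
        (repCY_inp_inr k' _))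
      simpa using this

/-! ### The isomorphism of generators and the induced pairing -/

section Form

variable (K : Type v) [Field K]

theorem lieGenerators_act {m n : ℕ} {d : ℤ} (σ : Equiv.Perm (Fin m)) (τ : Equiv.Perm (Fin n))
    (x : (lieGenerators K).carrier m n d) :
    (lieGenerators K).act σ τ x = Equiv.Perm.sign σ • x := rfl

theorem dualGenerators_act {m n : ℕ} {d : ℤ} (σ : Equiv.Perm (Fin m)) (τ : Equiv.Perm (Fin n))
    (x : (dualGenerators K).carrier m n d) :
    (dualGenerators K).act σ τ x = Equiv.Perm.sign τ • x := rfl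

theorem generatorRank_neg (m n : ℕ) {d e : ℤ} (h : e = -d) :
    generatorRank 1 m n e = generatorRank (-1) m n d := by
  subst h
  simp only [generatorRank, neg_eq_iff_eq_neg, neg_zero]

/-- The evaluation of the generators `N` on the generators `M`. -/
noncomputable def generatorForm {m n : ℕ} {d e : ℤ} (h : e = -d)
    (x : (dualGenerators K).carrier m n d) (y : (lieGenerators K).carrier m n e) : K :=
  ∑ i : Fin (generatorRank 1 m n e), x (Fin.cast (generatorRank_neg m n h) i) * y i

variable {K} in
/-- The identification of `K ^ r` with its dual space. -/
noncomputable def finDualEquiv {r r' : ℕ} (h : r' = r) :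
    (Fin r → K) ≃ₗ[K] Module.Dual K (Fin r' → K) :=
  (LinearEquiv.funCongrLeft K K (finCongr h)).trans (Pi.basisFun K (Fin r')).toDualEquiv

variable {K} in
theorem finDualEquiv_apply {r r' : ℕ} (h : r' = r) (x : Fin r → K) (y : Fin r' → K) :
    finDualEquiv h x y = ∑ i, x (Fin.cast h i) * y i := by
  subst h
  change (Pi.basisFun K (Fin r')).toDual x y = _
  conv_lhs => rw [← (Pi.basisFun K (Fin r')).sum_repr y, map_sum]
  refine Finset.sum_congr rfl fun i _ => ?_
  rw [map_smul, Module.Basis.toDual_apply_left]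
  simp [mul_comm]

variable {K} in
-- With s = sgn σ and t = sgn τ this is the equivariance of the identification: the Czech twist sgn
-- σ · sgn τ meets the sign sgn σ by which `M` transforms, and only the sign sgn τ of `N` survives.
theorem finDualEquiv_units_smul {r r' : ℕ} (h : r' = r) (s t : ℤˣ) (x : Fin r → K) :
    finDualEquiv h (t • x) =
      (s * t) • (finDualEquiv h x ∘ₗ (s • (LinearMap.id : (Fin r' → K) →ₗ[K] _))) := by
  refine LinearMap.ext fun y => ?_
  simp only [Units.smul_def, map_zsmul, LinearMap.smul_apply, LinearMap.comp_apply,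
    LinearMap.id_apply, smul_smul, ← Units.val_mul]
  rw [mul_right_comm, Int.units_mul_self, one_mul]

/-- The isomorphism `N → M^∨` which sends the natural basis to the dual basis. -/
noncomputable def dualIso : (dualGenerators K).Iso (lieGenerators K).czechDual where
  toEquiv {m n d} := finDualEquiv (generatorRank_neg m n (d := d) rfl)
  map_act {m n d} σ τ x := by
    refine (finDualEquiv_units_smul _ (Equiv.Perm.sign σ) (Equiv.Perm.sign τ) x).trans ?_
    rw [← Equiv.Perm.sign_inv σ]
    nth_rw 1 [Equiv.Perm.sign_inv σ]
    rfl

theorem czechEval_dualIso {m n : ℕ} {d : ℤ} (x : (dualGenerators K).carrier m n d)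
    (y : (lieGenerators K).carrier m n (-d)) :
    (lieGenerators K).czechEval ((dualIso K).toEquiv x) y = generatorForm K rfl x y :=
  finDualEquiv_apply _ x y

theorem generatorForm_product : ∀ h, generatorForm K h (dualProduct K) (lieBracket K) = 1 := by
  intro h
  refine (Fin.sum_univ_one _).trans ?_
  exact one_mul 1

theorem generatorForm_coproduct (c c' : Fin 2) : ∀ h,
    generatorForm K h (dualCoproduct K c) (lieCobracket K c') = if c = c' then 1 else 0 := by
  intro h
  refine (Fin.sum_univ_two _).trans ?_
  change (if 0 = (c : ℕ) then (1 : K) else 0) * (if 0 = (c' : ℕ) then (1 : K) else 0) +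
    (if 1 = (c : ℕ) then (1 : K) else 0) * (if 1 = (c' : ℕ) then (1 : K) else 0) = _
  fin_cases c <;> fin_cases c' <;> simp

variable {K} in
/-- The pairing of `F_(2)(N)` with `F_(2)(M)` induced by the isomorphism `N → M^∨`. -/
noncomputable def weightTwoForm {m n : ℕ} {d e : ℤ} (h : e = -d) :
    WeightTwo (dualGenerators K) m n d →ₗ[K] WeightTwo (lieGenerators K) m n e →ₗ[K] K := by
  -- Keeping the degree `e` separate from `-d` allows relations of degrees 2, 0 and 1 to be paired
  -- with degrees -2, 0 and -1 without transport between indices.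
  subst h
  exact WeightTwo.pairing (lieGenerators K) m n d ∘ₗ WeightTwo.map (dualIso K) m n d

theorem weightTwoForm_rfl {m n : ℕ} {d : ℤ} (z : WeightTwo (dualGenerators K) m n d)
    (y : WeightTwo (lieGenerators K) m n (-d)) : weightTwoForm rfl z y =
      WeightTwo.pairing (lieGenerators K) m n d (WeightTwo.map (dualIso K) m n d z) y := rfl

variable {K} {m n m₁ n₁ m₂ n₂ : ℕ} {d d₁ d₂ e e₁ e₂ : ℤ}

theorem weightTwoForm_graphSum (h : e = -d) (h₁ : e₁ = -d₁) (h₂ : e₂ = -d₂)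
    (G : TwoVertexGraph m n m₁ n₁ m₂ n₂) (hd : d₁ + d₂ = d) (he : e₁ + e₂ = e)
    (x : (dualGenerators K).carrier m₁ n₁ d₁) (y : (dualGenerators K).carrier m₂ n₂ d₂)
    (p : (lieGenerators K).carrier m₁ n₁ e₁) (q : (lieGenerators K).carrier m₂ n₂ e₂) :
    weightTwoForm h (decorated (dualGenerators K) G hd x y)
        (graphSum (lieGenerators K) m n he p q) =
      ((-1) ^ m₁ * labelSign G.inp : ℤˣ) • (Fintype.card (LocalGroup m₁ n₁ m₂ n₂) •
        (generatorForm K h₁ x p * generatorForm K h₂ y q)) := by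
  subst h h₁ h₂
  rw [weightTwoForm_rfl, WeightTwo.map_decorated,
    pairing_graphSum (lieGenerators_act K), czechEval_dualIso, czechEval_dualIso]

theorem weightTwoForm_graphSum_of_ne {m₁' n₁' m₂' n₂' : ℕ} (h : e = -d)
    (G : TwoVertexGraph m n m₁ n₁ m₂ n₂) (hd : d₁ + d₂ = d) (he : e₁ + e₂ = e)
    (x : (dualGenerators K).carrier m₁ n₁ d₁) (y : (dualGenerators K).carrier m₂ n₂ d₂)
    (p : (lieGenerators K).carrier m₁' n₁' e₁) (q : (lieGenerators K).carrier m₂' n₂' e₂)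
    (hne : m₁' ≠ m₁) :
    weightTwoForm h (decorated (dualGenerators K) G hd x y)
        (graphSum (lieGenerators K) m n he p q) = 0 := by
  subst h
  rw [weightTwoForm_rfl, WeightTwo.map_decorated, graphSum, map_sum]
  refine Finset.sum_eq_zero fun G' _ => ?_
  rw [Units.smul_def, map_zsmul, WeightTwo.pairing_decorated_of_ne _ _ _ _ _ _ _ _ hne, smul_zero]

end Form

/-! ### The relations of Lie₂ 1-bialgebras -/

section LieRelations

variable (K : Type v) [Field K]

variable {K} in
theorem WeightTwo.smul_add {M : SBimodule K} {m n : ℕ} {d : ℤ} (c : K)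
    (x y : WeightTwo M m n d) : c • (x + y) = c • x + c • y :=
  (LinearMap.lsmul K (WeightTwo M m n d) c).map_add x y

/-- The Jacobi relation. -/
noncomputable def jacobiRelation : WeightTwo (lieGenerators K) 1 3 2 :=
  lieYY K (graphYY 0 1 2) + lieYY K (graphYY 1 2 0) + lieYY K (graphYY 2 0 1)

/-- The co-Jacobi relation of the cobracket `c`. -/
noncomputable def coJacobiRelation (c : Fin 2) : WeightTwo (lieGenerators K) 3 1 0 :=
  lieCC K c c (graphCC 0 1 2) + lieCC K c c (graphCC 1 2 0) + lieCC K c c (graphCC 2 0 1)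

/-- The compatibility of the two cobrackets. -/
noncomputable def compatibilityRelation : WeightTwo (lieGenerators K) 3 1 0 :=
  lieCC K 0 1 (graphCC 0 1 2) + lieCC K 0 1 (graphCC 1 2 0) + lieCC K 0 1 (graphCC 2 0 1) +
    lieCC K 1 0 (graphCC 0 1 2) + lieCC K 1 0 (graphCC 1 2 0) + lieCC K 1 0 (graphCC 2 0 1)

/-- The compatibility of the cobracket `c` with the bracket. -/
noncomputable def bialgebraRelation (c : Fin 2) : WeightTwo (lieGenerators K) 2 2 1 :=
  lieYC K c graphYC - lieCY K c (graphCY 0 1 0 1) + lieCY K c (graphCY 1 0 0 1)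
    - lieCY K c (graphCY 0 1 1 0) + lieCY K c (graphCY 1 0 1 0)

/-! ### The relations in R as signed graph sums -/

theorem labelSign_repYY (k : Fin 3) :
    labelSign (repYY k).out = -1 ∧ labelSign (repYY k).inp = 1 := by
  fin_cases k <;> decide +kernel

theorem labelSign_repCC (k : Fin 3) :
    labelSign (repCC k).out = 1 ∧ labelSign (repCC k).inp = 1 := by
  fin_cases k <;> decide +kernel

theorem labelSign_graphYC : labelSign graphYC.out = 1 ∧ labelSign graphYC.inp = 1 := by
  decide +kernel

/-- For k = (a, i) with complementary labels b and j, the outputs read (b, a, edge) and the inputs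
(edge, j, i). -/
theorem labelSign_repCY (k : Fin 2 × Fin 2) :
    labelSign (repCY k).out = ![-1, 1] k.1 ∧ labelSign (repCY k).inp = ![-1, 1] k.2 := by
  obtain ⟨k, l⟩ := k
  fin_cases k <;> fin_cases l <;> decide +kernel

/-- The minus sign is the common output sign of the three graphs: their outputs read (0, edge), a
transposition of (edge, 0). -/
theorem four_smul_jacobiRelation : (4 : K) • jacobiRelation K =
    -graphSum (lieGenerators K) 1 3 (by norm_num) (lieBracket K) (lieBracket K) := by
  rw [graphSum_eq (lieGenerators_act K) repYY repYY_bijective, Fin.sum_univ_three]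
  simp only [labelSign_repYY]
  have h : Fintype.card (LocalGroup 1 2 1 2) = 4 := by decide
  rw [h, ← Nat.cast_smul_eq_nsmul K, ← smul_add, ← smul_add, Units.neg_smul, one_smul, smul_neg,
    neg_neg]
  rfl

theorem graphSum_cobrackets (u l : Fin 2) :
    graphSum (lieGenerators K) 3 1 (by norm_num) (lieCobracket K l) (lieCobracket K u) =
      (4 : K) • (lieCC K u l (graphCC 0 1 2) + lieCC K u l (graphCC 1 2 0) +
        lieCC K u l (graphCC 2 0 1)) := by
  rw [graphSum_eq (lieGenerators_act K) repCC repCC_bijective, Fin.sum_univ_three]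
  simp only [labelSign_repCC]
  have h : Fintype.card (LocalGroup 2 1 2 1) = 4 := by decide
  rw [h, ← Nat.cast_smul_eq_nsmul K, one_smul, one_smul, one_smul]
  rfl

theorem four_smul_coJacobiRelation (c : Fin 2) : (4 : K) • coJacobiRelation K c =
    graphSum (lieGenerators K) 3 1 (by norm_num) (lieCobracket K c) (lieCobracket K c) :=
  (graphSum_cobrackets K c c).symm

theorem four_smul_compatibilityRelation : (4 : K) • compatibilityRelation K =
    graphSum (lieGenerators K) 3 1 (by norm_num) (lieCobracket K 1) (lieCobracket K 0) +
      graphSum (lieGenerators K) 3 1 (by norm_num) (lieCobracket K 0) (lieCobracket K 1) := by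
  rw [graphSum_cobrackets, graphSum_cobrackets]
  refine Eq.trans ?_ (WeightTwo.smul_add (4 : K) _ _)
  refine congrArg _ ?_
  rw [compatibilityRelation]
  abel

/-- The coefficients of this relation are exactly the output signs of the five representatives. -/
theorem four_smul_bialgebraRelation (c : Fin 2) : (4 : K) • bialgebraRelation K c =
    graphSum (lieGenerators K) 2 2 (by norm_num) (lieCobracket K c) (lieBracket K) +
      graphSum (lieGenerators K) 2 2 (by norm_num) (lieBracket K) (lieCobracket K c) := by
  rw [graphSum_eq (lieGenerators_act K) (fun _ => graphYC) graphYC_bijective,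
    graphSum_eq (lieGenerators_act K) _ repCY_bijective, Fintype.sum_prod_type,
    Fin.sum_univ_two, Fin.sum_univ_two, Fin.sum_univ_two]
  simp only [labelSign_repCY, labelSign_graphYC, Finset.univ_unique, Finset.sum_singleton]
  have h : Fintype.card (LocalGroup 2 1 1 2) = 4 := by decide
  have h' : Fintype.card (LocalGroup 1 2 2 1) = 4 := by decide
  rw [h, h', ← smul_add, ← Nat.cast_smul_eq_nsmul K]
  refine congrArg _ ?_
  change bialgebraRelation K c = (1 : ℤˣ) • lieYC K c graphYC +
    ((-1 : ℤˣ) • lieCY K c (graphCY 0 1 0 1) + (-1 : ℤˣ) • lieCY K c (graphCY 0 1 1 0) +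
      ((1 : ℤˣ) • lieCY K c (graphCY 1 0 0 1) + (1 : ℤˣ) • lieCY K c (graphCY 1 0 1 0)))
  rw [bialgebraRelation, one_smul, one_smul, one_smul, Units.neg_smul, Units.neg_smul, one_smul,
    one_smul]
  abel

variable {K}

theorem weightTwoForm_cobrackets (h : (0 : ℤ) = -0) (u l u' l' : Fin 2)
    (G : TwoVertexGraph 3 1 2 1 2 1) :
    weightTwoForm h (dualCC K u l G)
        (graphSum (lieGenerators K) 3 1 (by norm_num) (lieCobracket K l') (lieCobracket K u')) =
      labelSign G.inp • (4 : ℕ) • (if u = u' ∧ l = l' then (1 : K) else 0) := by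
  rw [dualCC, weightTwoForm_graphSum h (by norm_num) (by norm_num), generatorForm_coproduct,
    generatorForm_coproduct, neg_one_sq, one_mul]
  have h' : Fintype.card (LocalGroup 2 1 2 1) = 4 := by decide
  rw [h']
  congr 2
  by_cases hu : u = u' <;> by_cases hl : l = l' <;> simp [hu, hl]

variable [CharZero K]

theorem act_eq_of_four_smul {m n : ℕ} {d : ℤ} {σ : Equiv.Perm (Fin m)} {τ : Equiv.Perm (Fin n)}
    {y : WeightTwo (lieGenerators K) m n d}
    (h : WeightTwo.act _ σ τ ((4 : K) • y) = Equiv.Perm.sign σ • (4 : K) • y) :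
    WeightTwo.act _ σ τ y = Equiv.Perm.sign σ • y := by
  rw [map_smul, smul_comm] at h
  exact smul_right_injective _ (show (4 : K) ≠ 0 by norm_num) h

/-- The symmetric groups act on the relations by the sign of the permutation of the outputs. -/
theorem LieRelation.act_eq {m n : ℕ} {d : ℤ} {y : WeightTwo (lieGenerators K) m n d}
    (hy : LieRelation K m n d y) (σ : Equiv.Perm (Fin m)) (τ : Equiv.Perm (Fin n)) :
    WeightTwo.act _ σ τ y = Equiv.Perm.sign σ • y := by
  refine act_eq_of_four_smul ?_
  cases hy with
  | jacobi =>
    change WeightTwo.act _ σ τ ((4 : K) • jacobiRelation K) = _ • (4 : K) • jacobiRelation K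
    rw [four_smul_jacobiRelation, map_neg, act_graphSum, smul_neg]
  | coJacobi c =>
    change WeightTwo.act _ σ τ ((4 : K) • coJacobiRelation K c) =
      _ • (4 : K) • coJacobiRelation K c
    rw [four_smul_coJacobiRelation, act_graphSum]
  | coCompatible =>
    change WeightTwo.act _ σ τ ((4 : K) • compatibilityRelation K) =
      _ • (4 : K) • compatibilityRelation K
    rw [four_smul_compatibilityRelation, map_add, act_graphSum, act_graphSum, smul_add]
  | bialgebra c =>
    change WeightTwo.act _ σ τ ((4 : K) • bialgebraRelation K c) =
      _ • (4 : K) • bialgebraRelation K c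
    rw [four_smul_bialgebraRelation, map_add, act_graphSum, act_graphSum, smul_add]

theorem weightTwoForm_eq_of_four_smul {m n : ℕ} {d e : ℤ} {h : e = -d}
    {z : WeightTwo (dualGenerators K) m n d} {y : WeightTwo (lieGenerators K) m n e} {s : ℤˣ}
    {a : K} (hzy : weightTwoForm h z ((4 : K) • y) = s • (4 : ℕ) • a) :
    weightTwoForm h z y = s • a := by
  rw [map_smul, ← Nat.cast_smul_eq_nsmul K, smul_comm] at hzy
  exact smul_right_injective K (show (4 : K) ≠ 0 by norm_num) hzy

/-- The minus sign relating the Jacobi relation to its graph sum cancels (-1)^{m₁} with m₁ = 1. -/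
theorem weightTwoForm_jacobi (h : (2 : ℤ) = -(-2)) (G : TwoVertexGraph 1 3 1 2 1 2) :
    weightTwoForm h (dualYY K G) (jacobiRelation K) = labelSign G.inp • (1 : K) := by
  refine weightTwoForm_eq_of_four_smul ?_
  rw [four_smul_jacobiRelation, map_neg, dualYY,
    weightTwoForm_graphSum h (by norm_num) (by norm_num), generatorForm_product, mul_one,
    pow_one, neg_one_mul, Units.neg_smul, neg_neg]
  rfl

theorem weightTwoForm_coJacobi (h : (0 : ℤ) = -0) (u l c : Fin 2)
    (G : TwoVertexGraph 3 1 2 1 2 1) :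
    weightTwoForm h (dualCC K u l G) (coJacobiRelation K c) =
      labelSign G.inp • (if u = c ∧ l = c then (1 : K) else 0) := by
  refine weightTwoForm_eq_of_four_smul ?_
  rw [four_smul_coJacobiRelation, weightTwoForm_cobrackets]

theorem weightTwoForm_compatibility (h : (0 : ℤ) = -0) (u l : Fin 2)
    (G : TwoVertexGraph 3 1 2 1 2 1) :
    weightTwoForm h (dualCC K u l G) (compatibilityRelation K) =
      labelSign G.inp • (if u = l then (0 : K) else 1) := by
  refine weightTwoForm_eq_of_four_smul ?_
  rw [four_smul_compatibilityRelation, map_add, weightTwoForm_cobrackets,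
    weightTwoForm_cobrackets, ← smul_add, ← smul_add]
  congr 2
  fin_cases u <;> fin_cases l <;> simp

theorem weightTwoForm_bialgebra_dualYC (h : (1 : ℤ) = -(-1)) (c c' : Fin 2)
    (G : TwoVertexGraph 2 2 2 1 1 2) :
    weightTwoForm h (dualYC K c G) (bialgebraRelation K c') =
      labelSign G.inp • (if c = c' then (1 : K) else 0) := by
  refine weightTwoForm_eq_of_four_smul ?_
  rw [four_smul_bialgebraRelation, map_add, dualYC,
    weightTwoForm_graphSum h (by norm_num) (by norm_num),
    weightTwoForm_graphSum_of_ne _ _ _ _ _ _ _ _ (by norm_num), generatorForm_coproduct,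
    generatorForm_product, neg_one_sq, one_mul, mul_one, add_zero]
  rfl

/-- The lower vertex has one output here and two in the YC case, so (-1)^{m₁} makes the two values
opposite for equal input signs. -/
theorem weightTwoForm_bialgebra_dualCY (h : (1 : ℤ) = -(-1)) (c c' : Fin 2)
    (G : TwoVertexGraph 2 2 1 2 2 1) :
    weightTwoForm h (dualCY K c G) (bialgebraRelation K c') =
      -labelSign G.inp • (if c = c' then (1 : K) else 0) := by
  refine weightTwoForm_eq_of_four_smul ?_
  rw [four_smul_bialgebraRelation, map_add, dualCY,
    weightTwoForm_graphSum_of_ne _ _ _ _ _ _ _ _ (by norm_num),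
    weightTwoForm_graphSum h (by norm_num) (by norm_num), generatorForm_coproduct,
    generatorForm_product, pow_one, neg_one_mul, one_mul, zero_add]
  rfl

end LieRelations

/-! ### The weight two part of the ideal generated by `S` -/

section DualRelations

variable {K : Type v} [Field K]

theorem WeightTwo.act_one_one {M : SBimodule K} {m n : ℕ} {d : ℤ} (x : WeightTwo M m n d) :
    WeightTwo.act M 1 1 x = x := by
  have : WeightTwo.act M 1 1 = (LinearMap.id : WeightTwo M m n d →ₗ[K] _) := by
    refine WeightTwo.hom_ext fun m₁ n₁ m₂ n₂ d₁ d₂ hd G p q => ?_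
    rw [WeightTwo.act_decorated, LinearMap.id_apply]
    congr 1
    ext x <;> simp [TwoVertexGraph.relabelGlobal]
  exact LinearMap.congr_fun this x

theorem WeightTwo.mem_generated {M : SBimodule K} {R : ∀ m n d, Set (WeightTwo M m n d)}
    {m n : ℕ} {d : ℤ} {x : WeightTwo M m n d} (hx : x ∈ R m n d) :
    x ∈ WeightTwo.generated M R m n d :=
  Submodule.subset_span ⟨1, 1, x, hx, (WeightTwo.act_one_one x).symm⟩

theorem dualGenerators_decorated_relabelLocal {m n m₁ n₁ m₂ n₂ : ℕ} {d d₁ d₂ : ℤ}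
    (G : TwoVertexGraph m n m₁ n₁ m₂ n₂) (h : d₁ + d₂ = d) (g : LocalGroup m₁ n₁ m₂ n₂)
    (p : (dualGenerators K).carrier m₁ n₁ d₁) (q : (dualGenerators K).carrier m₂ n₂ d₂) :
    decorated _ (G.relabelLocal g) h p q =
      (Equiv.Perm.sign g.2.1 * Equiv.Perm.sign g.2.2.2) • decorated _ G h p q := by
  rw [decorated_relabelLocal, dualGenerators_act, dualGenerators_act, decorated_smul_smul,
    Equiv.Perm.sign_inv, Equiv.Perm.sign_inv]

theorem generatorRank_pos {m n : ℕ} {d : ℤ} (h : generatorRank (-1) m n d ≠ 0) :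
    (m = 1 ∧ n = 2 ∧ d = -1) ∨ (m = 2 ∧ n = 1 ∧ d = 0) := by
  unfold generatorRank at h
  split_ifs at h with h₁ h₂
  exacts [.inl h₁, .inr h₂, absurd rfl h]

theorem eq_smul_dualProduct (p : (dualGenerators K).carrier 1 2 (-1)) :
    ∃ a : K, p = a • dualProduct K := by
  change Fin 1 → K at p
  refine ⟨p 0, funext fun i : Fin 1 => ?_⟩
  rw [Subsingleton.elim i 0]
  exact (mul_one _).symm

theorem eq_smul_dualCoproduct (p : (dualGenerators K).carrier 2 1 0) :
    ∃ a b : K, p = a • dualCoproduct K 0 + b • dualCoproduct K 1 := by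
  change Fin 2 → K at p
  refine ⟨p 0, p 1, funext fun i : Fin 2 => ?_⟩
  change p i = p 0 * (if (i : ℕ) = 0 then 1 else 0) + p 1 * (if (i : ℕ) = 1 then 1 else 0)
  fin_cases i <;> simp

/-- `F_(2)(N)` is spanned by the graphs decorated by the natural basis of `N`. -/
theorem weightTwo_dualGenerators_eq_top
    (U : ∀ m n d, Submodule K (WeightTwo (dualGenerators K) m n d))
    (hYY : ∀ G, dualYY K G ∈ U 1 3 (-2)) (hCC : ∀ u l G, dualCC K u l G ∈ U 3 1 0)
    (hYC : ∀ c G, dualYC K c G ∈ U 2 2 (-1)) (hCY : ∀ c G, dualCY K c G ∈ U 2 2 (-1))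
    (m n : ℕ) (d : ℤ) : U m n d = ⊤ := by
  have hmem : ∀ (m₁ n₁ m₂ n₂ : ℕ) (d₁ d₂ : ℤ) (hd : d₁ + d₂ = d)
      (G : TwoVertexGraph m n m₁ n₁ m₂ n₂) (p : (dualGenerators K).carrier m₁ n₁ d₁)
      (q : (dualGenerators K).carrier m₂ n₂ d₂), decorated _ G hd p q ∈ U m n d := by
    intro m₁ n₁ m₂ n₂ d₁ d₂ hd G p q
    -- Counting half-edges: the local outputs are the global ones and the internal edge. With the
    -- arities of the generators this determines m, and likewise n.
    have hm : m₁ + m₂ = m + 1 := by simpa using Fintype.card_congr G.out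
    have hn : n₁ + n₂ = n + 1 := by simpa using Fintype.card_congr G.inp
    rw [← decoratedHom_apply]
    by_cases h₁ : generatorRank (-1) m₁ n₁ d₁ = 0
    · have : IsEmpty (Fin (generatorRank (-1) m₁ n₁ d₁)) := by rw [h₁]; infer_instance
      rw [show p = 0 from funext fun i => isEmptyElim i, map_zero, LinearMap.zero_apply]
      exact zero_mem _
    by_cases h₂ : generatorRank (-1) m₂ n₂ d₂ = 0
    · have : IsEmpty (Fin (generatorRank (-1) m₂ n₂ d₂)) := by rw [h₂]; infer_instance
      rw [show q = 0 from funext fun i => isEmptyElim i, map_zero]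
      exact zero_mem _
    obtain ⟨rfl, rfl, rfl⟩ | ⟨rfl, rfl, rfl⟩ := generatorRank_pos h₁ <;>
      obtain ⟨rfl, rfl, rfl⟩ | ⟨rfl, rfl, rfl⟩ := generatorRank_pos h₂
    · obtain ⟨rfl, rfl, rfl⟩ : m = 1 ∧ n = 3 ∧ d = -2 := by omega
      obtain ⟨a, rfl⟩ := eq_smul_dualProduct p
      obtain ⟨b, rfl⟩ := eq_smul_dualProduct q
      simp only [map_smul, LinearMap.smul_apply]
      exact Submodule.smul_mem _ _ (Submodule.smul_mem _ _ (hYY G))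
    · obtain ⟨rfl, rfl, rfl⟩ : m = 2 ∧ n = 2 ∧ d = -1 := by omega
      obtain ⟨a, rfl⟩ := eq_smul_dualProduct p
      obtain ⟨b, b', rfl⟩ := eq_smul_dualCoproduct q
      simp only [map_smul, map_add, LinearMap.smul_apply]
      exact add_mem (Submodule.smul_mem _ _ (Submodule.smul_mem _ _ (hCY 0 G)))
        (Submodule.smul_mem _ _ (Submodule.smul_mem _ _ (hCY 1 G)))
    · obtain ⟨rfl, rfl, rfl⟩ : m = 2 ∧ n = 2 ∧ d = -1 := by omega
      obtain ⟨a, a', rfl⟩ := eq_smul_dualCoproduct p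
      obtain ⟨b, rfl⟩ := eq_smul_dualProduct q
      simp only [map_smul, map_add, LinearMap.smul_apply, LinearMap.add_apply]
      exact Submodule.smul_mem _ _ (add_mem (Submodule.smul_mem _ _ (hYC 0 G))
        (Submodule.smul_mem _ _ (hYC 1 G)))
    · obtain ⟨rfl, rfl, rfl⟩ : m = 3 ∧ n = 1 ∧ d = 0 := by omega
      obtain ⟨a, a', rfl⟩ := eq_smul_dualCoproduct p
      obtain ⟨b, b', rfl⟩ := eq_smul_dualCoproduct q
      simp only [map_smul, map_add, LinearMap.smul_apply, LinearMap.add_apply]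
      refine add_mem (Submodule.smul_mem _ _ (add_mem ?_ ?_))
        (Submodule.smul_mem _ _ (add_mem ?_ ?_)) <;> refine Submodule.smul_mem _ _ ?_
      exacts [hCC 0 0 G, hCC 0 1 G, hCC 1 0 G, hCC 1 1 G]
  have hzero : (U m n d).mkQ = 0 := by
    refine WeightTwo.hom_ext fun m₁ n₁ m₂ n₂ d₁ d₂ hd G p q => ?_
    rw [LinearMap.zero_apply, Submodule.mkQ_apply, Submodule.Quotient.mk_eq_zero]
    exact hmem m₁ n₁ m₂ n₂ d₁ d₂ hd G p q
  rw [← (U m n d).ker_mkQ, hzero, LinearMap.ker_zero]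

/-! ### Normal forms modulo S -/

variable (K) in
/-- Representatives of a basis of `F_(2)(N)/(S)_(2)`. -/
inductive NormalForm : ∀ m n d, WeightTwo (dualGenerators K) m n d → Prop
  | product : NormalForm 1 3 (-2) (dualYY K (graphYY 0 1 2))
  | coproduct (c : Fin 2) : NormalForm 3 1 0 (dualCC K c c (graphCC 0 1 2))
  | mixed : NormalForm 3 1 0 (dualCC K 0 1 (graphCC 0 1 2))
  | bialgebra (c : Fin 2) : NormalForm 2 2 (-1) (dualYC K c graphYC)

variable (K) in
/-- The weight two part of the ideal generated by `S`. -/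
noncomputable abbrev dualIdealTwo (m n : ℕ) (d : ℤ) :
    Submodule K (WeightTwo (dualGenerators K) m n d) :=
  WeightTwo.generated (dualGenerators K) (totallyCompatibleFrobenius K).relations m n d

theorem dualRelation_mem {m n : ℕ} {d : ℤ} {x : WeightTwo (dualGenerators K) m n d}
    (hx : DualRelation K m n d x) : x ∈ dualIdealTwo K m n d :=
  WeightTwo.mem_generated hx

theorem mem_of_sub_mem {V : Type*} [AddCommGroup V] [Module K V] {U : Submodule K V} {x y : V}
    (hx : x ∈ U) (hxy : x - y ∈ U) : y ∈ U := by
  simpa using sub_mem hx hxy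

theorem mem_of_add_mem {V : Type*} [AddCommGroup V] [Module K V] {U : Submodule K V} {x y : V}
    (hx : x ∈ U) (hxy : x + y ∈ U) : y ∈ U := by
  simpa using sub_mem hxy hx

theorem dualYY_relabelLocal (G : TwoVertexGraph 1 3 1 2 1 2) (g : LocalGroup 1 2 1 2) :
    dualYY K (G.relabelLocal g) =
      (Equiv.Perm.sign g.2.1 * Equiv.Perm.sign g.2.2.2) • dualYY K G :=
  dualGenerators_decorated_relabelLocal _ _ _ _ _

theorem dualCC_relabelLocal (u l : Fin 2) (G : TwoVertexGraph 3 1 2 1 2 1)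
    (g : LocalGroup 2 1 2 1) : dualCC K u l (G.relabelLocal g) =
      (Equiv.Perm.sign g.2.1 * Equiv.Perm.sign g.2.2.2) • dualCC K u l G :=
  dualGenerators_decorated_relabelLocal _ _ _ _ _

theorem dualYC_relabelLocal (c : Fin 2) (G : TwoVertexGraph 2 2 2 1 1 2)
    (g : LocalGroup 2 1 1 2) : dualYC K c (G.relabelLocal g) =
      (Equiv.Perm.sign g.2.1 * Equiv.Perm.sign g.2.2.2) • dualYC K c G :=
  dualGenerators_decorated_relabelLocal _ _ _ _ _

theorem dualCY_relabelLocal (c : Fin 2) (G : TwoVertexGraph 2 2 1 2 2 1)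
    (g : LocalGroup 1 2 2 1) : dualCY K c (G.relabelLocal g) =
      (Equiv.Perm.sign g.2.1 * Equiv.Perm.sign g.2.2.2) • dualCY K c G :=
  dualGenerators_decorated_relabelLocal _ _ _ _ _

/-- Modulo `(S)_(2)`, the space `F_(2)(N)` is spanned by the normal forms. -/
theorem dualIdealTwo_sup_normalForm (m n : ℕ) (d : ℤ) :
    dualIdealTwo K m n d ⊔ Submodule.span K {x | NormalForm K m n d x} = ⊤ := by
  have rel : ∀ {m n : ℕ} {d : ℤ} {x : WeightTwo (dualGenerators K) m n d},
      DualRelation K m n d x →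
        x ∈ dualIdealTwo K m n d ⊔ Submodule.span K {x | NormalForm K m n d x} :=
    fun hx => Submodule.mem_sup_left (dualRelation_mem hx)
  have nf : ∀ {m n : ℕ} {d : ℤ} {x : WeightTwo (dualGenerators K) m n d},
      NormalForm K m n d x →
        x ∈ dualIdealTwo K m n d ⊔ Submodule.span K {x | NormalForm K m n d x} :=
    fun hx => Submodule.mem_sup_right (Submodule.subset_span hx)
  have unit : ∀ {m n : ℕ} {d : ℤ} {x : WeightTwo (dualGenerators K) m n d} (s : ℤˣ),
      x ∈ dualIdealTwo K m n d ⊔ Submodule.span K {x | NormalForm K m n d x} →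
        s • x ∈ dualIdealTwo K m n d ⊔ Submodule.span K {x | NormalForm K m n d x} :=
    fun s hx => zsmul_mem hx (s : ℤ)
  refine weightTwo_dualGenerators_eq_top
    (fun m n d => dualIdealTwo K m n d ⊔ Submodule.span K {x | NormalForm K m n d x})
    (fun G => ?_) (fun u l G => ?_) (fun c G => ?_) (fun c G => ?_) m n d
  -- Each graph is a relabelled representative; the relabelling costs a sign, and a relation in S
  -- links the representative to the normal form.
  · obtain ⟨⟨k, g⟩, rfl⟩ := repYY_bijective.2 G
    change dualYY K ((repYY k).relabelLocal g) ∈ _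
    rw [dualYY_relabelLocal]
    refine unit _ ?_
    fin_cases k
    exacts [nf .product, mem_of_sub_mem (nf .product) (rel .assoc₁),
      mem_of_sub_mem (nf .product) (rel .assoc₂)]
  · obtain ⟨⟨k, g⟩, rfl⟩ := repCC_bijective.2 G
    change dualCC K u l ((repCC k).relabelLocal g) ∈ _
    rw [dualCC_relabelLocal]
    refine unit _ ?_
    have diag : ∀ c, dualCC K c c (repCC k) ∈ dualIdealTwo K 3 1 0 ⊔
        Submodule.span K {x | NormalForm K 3 1 0 x} := by
      intro c
      fin_cases k
      exacts [nf (.coproduct c), mem_of_sub_mem (nf (.coproduct c)) (rel (.coassoc₁ c)),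
        mem_of_sub_mem (nf (.coproduct c)) (rel (.coassoc₂ c))]
    have mix : dualCC K 0 1 (repCC k) ∈ dualIdealTwo K 3 1 0 ⊔
        Submodule.span K {x | NormalForm K 3 1 0 x} := by
      fin_cases k
      exacts [nf .mixed, mem_of_sub_mem (nf .mixed) (rel .mixed₁),
        mem_of_sub_mem (nf .mixed) (rel .mixed₂)]
    -- Total compatibility exchanges the colours of the two vertices and so reduces to the previous
    -- mixed case.
    have mix' : dualCC K 1 0 (repCC k) ∈ dualIdealTwo K 3 1 0 ⊔
        Submodule.span K {x | NormalForm K 3 1 0 x} := by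
      refine mem_of_sub_mem mix ?_
      fin_cases k
      exacts [rel .total₁, rel .total₂, rel .total₃]
    fin_cases u <;> fin_cases l
    exacts [diag 0, mix, mix', diag 1]
  · obtain ⟨⟨k, g⟩, rfl⟩ := graphYC_bijective.2 G
    change dualYC K c (graphYC.relabelLocal g) ∈ _
    rw [dualYC_relabelLocal]
    refine unit _ ?_
    exact nf (.bialgebra c)
  · obtain ⟨⟨⟨k, l⟩, g⟩, rfl⟩ := repCY_bijective.2 G
    change dualCY K c ((repCY (k, l)).relabelLocal g) ∈ _
    rw [dualCY_relabelLocal]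
    refine unit _ ?_
    fin_cases k <;> fin_cases l
    exacts [mem_of_sub_mem (nf (.bialgebra c)) (rel (.frobenius₁ c)),
      mem_of_add_mem (nf (.bialgebra c)) (rel (.frobenius₃ c)),
      mem_of_sub_mem (nf (.bialgebra c)) (rel (.frobenius₂ c)),
      mem_of_add_mem (nf (.bialgebra c)) (rel (.frobenius₄ c))]

/-! ### Orthogonality of S and R -/

theorem act_dualYY (σ : Equiv.Perm (Fin 1)) (τ : Equiv.Perm (Fin 3))
    (G : TwoVertexGraph 1 3 1 2 1 2) :
    WeightTwo.act _ σ τ (dualYY K G) = dualYY K (G.relabelGlobal σ τ) :=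
  WeightTwo.act_decorated _ _ _ _ _ _

theorem act_dualCC (u l : Fin 2) (σ : Equiv.Perm (Fin 3)) (τ : Equiv.Perm (Fin 1))
    (G : TwoVertexGraph 3 1 2 1 2 1) :
    WeightTwo.act _ σ τ (dualCC K u l G) = dualCC K u l (G.relabelGlobal σ τ) :=
  WeightTwo.act_decorated _ _ _ _ _ _

theorem act_dualYC (c : Fin 2) (σ : Equiv.Perm (Fin 2)) (τ : Equiv.Perm (Fin 2))
    (G : TwoVertexGraph 2 2 2 1 1 2) :
    WeightTwo.act _ σ τ (dualYC K c G) = dualYC K c (G.relabelGlobal σ τ) :=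
  WeightTwo.act_decorated _ _ _ _ _ _

theorem act_dualCY (c : Fin 2) (σ : Equiv.Perm (Fin 2)) (τ : Equiv.Perm (Fin 2))
    (G : TwoVertexGraph 2 2 1 2 2 1) :
    WeightTwo.act _ σ τ (dualCY K c G) = dualCY K c (G.relabelGlobal σ τ) :=
  WeightTwo.act_decorated _ _ _ _ _ _

/-- Each coefficient of a linear combination of elements of `B` is detected by a functional in `F`
that vanishes on all the other elements. -/
theorem eq_zero_of_mem_span {V : Type*} [AddCommGroup V] [Module K V] {B : Set V}
    {F : Set (V →ₗ[K] K)} (hB : ∀ b ∈ B, ∃ f ∈ F, f b ≠ 0 ∧ ∀ b' ∈ B, b' ≠ b → f b' = 0)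
    {v : V} (hv : v ∈ Submodule.span K B) (hF : ∀ f ∈ F, f v = 0) : v = 0 := by
  obtain ⟨c, rfl⟩ := (Finsupp.mem_span_iff_linearCombination K B v).1 hv
  have hc : c = 0 := by
    ext b
    obtain ⟨f, hf, hb, hb'⟩ := hB b b.2
    have h := hF f hf
    rw [Finsupp.linearCombination_apply, map_finsuppSum, Finsupp.sum,
      Finset.sum_eq_single b] at h
    · simpa [hb] using h
    · intro b₁ _ hne
      rw [map_smul, hb' b₁ b₁.2 (fun h => hne (Subtype.ext h)), smul_zero]
    · intro hb₁
      rw [Finsupp.notMem_support_iff.1 hb₁, zero_smul, map_zero]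
  rw [hc, map_zero]

variable [CharZero K]

theorem weightTwoForm_act_dualYY {e : ℤ} (h : e = -(-2)) {y : WeightTwo (lieGenerators K) 1 3 e}
    (hy : LieRelation K 1 3 e y) (σ : Equiv.Perm (Fin 1)) (τ : Equiv.Perm (Fin 3))
    (G : TwoVertexGraph 1 3 1 2 1 2) :
    weightTwoForm h (WeightTwo.act _ σ τ (dualYY K G)) y =
      (Equiv.Perm.sign τ * labelSign G.inp) • (1 : K) := by
  cases hy
  rw [act_dualYY, ← TwoVertexGraph.labelSign_inp_relabelGlobal G σ τ]
  exact weightTwoForm_jacobi h _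

/-- This treats the co-Jacobi and compatibility relations alike. Apart from the input sign, only the
unordered pair of colours matters, which is what coassociativity and total compatibility require. -/
theorem exists_weightTwoForm_act_dualCC {e : ℤ} (h : e = -0)
    {y : WeightTwo (lieGenerators K) 3 1 e} (hy : LieRelation K 3 1 e y) :
    ∃ κ : Fin 2 → Fin 2 → K, (∀ u l, κ u l = κ l u) ∧
      ∀ (u l : Fin 2) (σ : Equiv.Perm (Fin 3)) (τ : Equiv.Perm (Fin 1))
        (G : TwoVertexGraph 3 1 2 1 2 1),
        weightTwoForm h (WeightTwo.act _ σ τ (dualCC K u l G)) y =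
          (Equiv.Perm.sign τ * labelSign G.inp) • κ u l := by
  cases hy with
  | coJacobi c =>
    refine ⟨fun u l => if u = c ∧ l = c then 1 else 0, fun u l => by simp only [and_comm],
      fun u l σ τ G => ?_⟩
    rw [act_dualCC, ← TwoVertexGraph.labelSign_inp_relabelGlobal G σ τ]
    exact weightTwoForm_coJacobi h u l c _
  | coCompatible =>
    refine ⟨fun u l => if u = l then 0 else 1, fun u l => by simp only [eq_comm],
      fun u l σ τ G => ?_⟩
    rw [act_dualCC, ← TwoVertexGraph.labelSign_inp_relabelGlobal G σ τ]
    exact weightTwoForm_compatibility h u l _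

/-- The same κ serves both shapes, so their values are comparable graph by graph. -/
theorem exists_weightTwoForm_act_dualYC {e : ℤ} (h : e = -(-1))
    {y : WeightTwo (lieGenerators K) 2 2 e} (hy : LieRelation K 2 2 e y) :
    ∃ κ : Fin 2 → K, ∀ (c : Fin 2) (σ τ : Equiv.Perm (Fin 2)),
      (∀ G, weightTwoForm h (WeightTwo.act _ σ τ (dualYC K c G)) y =
        (Equiv.Perm.sign τ * labelSign G.inp) • κ c) ∧
      ∀ G, weightTwoForm h (WeightTwo.act _ σ τ (dualCY K c G)) y =
        -(Equiv.Perm.sign τ * labelSign G.inp) • κ c := by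
  cases hy with
  | bialgebra c' =>
    refine ⟨fun c => if c = c' then 1 else 0, fun c σ τ => ⟨fun G => ?_, fun G => ?_⟩⟩
    · rw [act_dualYC, ← TwoVertexGraph.labelSign_inp_relabelGlobal G σ τ]
      exact weightTwoForm_bialgebra_dualYC h c c' _
    · rw [act_dualCY, ← TwoVertexGraph.labelSign_inp_relabelGlobal G σ τ]
      exact weightTwoForm_bialgebra_dualCY h c c' _

/-- The relations `S`, and their images under permutations, are orthogonal to the relations `R`. -/
theorem weightTwoForm_dualRelation {m n : ℕ} {d e : ℤ} (h : e = -d)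
    {x : WeightTwo (dualGenerators K) m n d} (hx : DualRelation K m n d x)
    {y : WeightTwo (lieGenerators K) m n e} (hy : LieRelation K m n e y)
    (σ : Equiv.Perm (Fin m)) (τ : Equiv.Perm (Fin n)) :
    weightTwoForm h (WeightTwo.act _ σ τ x) y = 0 := by
  have hYY : ∀ {σ τ} k (h : e = -(-2)) {y} (_ : LieRelation K 1 3 e y),
      weightTwoForm h (WeightTwo.act _ σ τ (dualYY K (repYY k))) y =
        Equiv.Perm.sign τ • (1 : K) := by
    intro σ τ k h y hy
    rw [weightTwoForm_act_dualYY h hy, (labelSign_repYY k).2, mul_one]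
  have hCC : ∀ {σ τ} k k' (u l u' l' : Fin 2) (h : e = -0) {y} (_ : LieRelation K 3 1 e y),
      (u = u' ∧ l = l') ∨ (u = l' ∧ l = u') →
      weightTwoForm h (WeightTwo.act _ σ τ (dualCC K u l (repCC k))) y =
        weightTwoForm h (WeightTwo.act _ σ τ (dualCC K u' l' (repCC k'))) y := by
    intro σ τ k k' u l u' l' h y hy hul
    obtain ⟨κ, hκ, hy⟩ := exists_weightTwoForm_act_dualCC h hy
    rw [hy, hy, (labelSign_repCC k).2, (labelSign_repCC k').2]
    obtain ⟨rfl, rfl⟩ | ⟨rfl, rfl⟩ := hul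
    exacts [rfl, congrArg _ (hκ _ _)]
  -- The factor is minus the input sign of `repCY k`: it is 1 if the upper vertex carries the first
  -- input and -1 if it carries the second, whence the two signs in the Frobenius relations.
  have hCY : ∀ {σ τ} k c (h : e = -(-1)) {y} (_ : LieRelation K 2 2 e y),
      weightTwoForm h (WeightTwo.act _ σ τ (dualCY K c (repCY k))) y =
        (![1, -1] k.2 : ℤˣ) •
          weightTwoForm h (WeightTwo.act _ σ τ (dualYC K c graphYC)) y := by
    intro σ τ k c h y hy
    obtain ⟨κ, hy⟩ := exists_weightTwoForm_act_dualYC h hy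
    rw [(hy c σ τ).1, (hy c σ τ).2, (labelSign_repCY k).2, labelSign_graphYC.2, smul_smul]
    congr 1
    obtain ⟨k, l⟩ := k
    fin_cases l <;> simp
  cases hx with
  | assoc₁ =>
    rw [map_sub, map_sub, LinearMap.sub_apply]
    exact sub_eq_zero.2 ((hYY 0 h hy).trans (hYY 1 h hy).symm)
  | assoc₂ =>
    rw [map_sub, map_sub, LinearMap.sub_apply]
    exact sub_eq_zero.2 ((hYY 0 h hy).trans (hYY 2 h hy).symm)
  | coassoc₁ c =>
    rw [map_sub, map_sub, LinearMap.sub_apply]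
    exact sub_eq_zero.2 (hCC 0 1 _ _ _ _ h hy (.inl ⟨rfl, rfl⟩))
  | coassoc₂ c =>
    rw [map_sub, map_sub, LinearMap.sub_apply]
    exact sub_eq_zero.2 (hCC 0 2 _ _ _ _ h hy (.inl ⟨rfl, rfl⟩))
  | mixed₁ =>
    rw [map_sub, map_sub, LinearMap.sub_apply]
    exact sub_eq_zero.2 (hCC 0 1 _ _ _ _ h hy (.inl ⟨rfl, rfl⟩))
  | mixed₂ =>
    rw [map_sub, map_sub, LinearMap.sub_apply]
    exact sub_eq_zero.2 (hCC 0 2 _ _ _ _ h hy (.inl ⟨rfl, rfl⟩))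
  | total₁ =>
    rw [map_sub, map_sub, LinearMap.sub_apply]
    exact sub_eq_zero.2 (hCC 0 0 _ _ _ _ h hy (.inr ⟨rfl, rfl⟩))
  | total₂ =>
    rw [map_sub, map_sub, LinearMap.sub_apply]
    exact sub_eq_zero.2 (hCC 1 1 _ _ _ _ h hy (.inr ⟨rfl, rfl⟩))
  | total₃ =>
    rw [map_sub, map_sub, LinearMap.sub_apply]
    exact sub_eq_zero.2 (hCC 2 2 _ _ _ _ h hy (.inr ⟨rfl, rfl⟩))
  | frobenius₁ c =>
    rw [map_sub, map_sub, LinearMap.sub_apply]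
    exact sub_eq_zero.2 ((hCY (0, 0) c h hy).trans (one_smul _ _)).symm
  | frobenius₂ c =>
    rw [map_sub, map_sub, LinearMap.sub_apply]
    exact sub_eq_zero.2 ((hCY (1, 0) c h hy).trans (one_smul _ _)).symm
  | frobenius₃ c =>
    rw [map_add, map_add, LinearMap.add_apply]
    refine (congrArg _ ((hCY (0, 1) c h hy).trans ?_)).trans (add_neg_cancel _)
    exact (Units.neg_smul _ _).trans (congrArg _ (one_smul _ _))
  | frobenius₄ c =>
    rw [map_add, map_add, LinearMap.add_apply]
    refine (congrArg _ ((hCY (1, 1) c h hy).trans ?_)).trans (add_neg_cancel _)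
    exact (Units.neg_smul _ _).trans (congrArg _ (one_smul _ _))

/-- The normal forms are linearly independent modulo the orthogonal complement of `R`. -/
theorem NormalForm.exists_lieRelation {m n : ℕ} {d : ℤ} {x : WeightTwo (dualGenerators K) m n d}
    (hx : NormalForm K m n d x) (e : ℤ) (h : e = -d) :
    ∃ y, LieRelation K m n e y ∧ weightTwoForm h x y ≠ 0 ∧
      ∀ x', NormalForm K m n d x' → x' ≠ x → weightTwoForm h x' y = 0 := by
  have hCC : labelSign (graphCC 0 1 2).inp = 1 := (labelSign_repCC 0).2
  cases hx with
  | product =>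
    obtain rfl : e = 2 := h
    refine ⟨_, .jacobi, ?_, ?_⟩
    · refine ne_of_eq_of_ne (weightTwoForm_jacobi _ _) ?_
      rw [show labelSign (graphYY 0 1 2).inp = 1 from (labelSign_repYY 0).2, one_smul]
      exact one_ne_zero
    · intro x' hx' hne
      cases hx'
      exact absurd rfl hne
  | coproduct c =>
    obtain rfl : e = 0 := h
    refine ⟨_, .coJacobi c, ?_, ?_⟩
    · refine ne_of_eq_of_ne (weightTwoForm_coJacobi _ c c c _) ?_
      rw [hCC, one_smul, if_pos ⟨rfl, rfl⟩]
      exact one_ne_zero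
    · intro x' hx' hne
      cases hx' with
      | coproduct c' =>
        refine (weightTwoForm_coJacobi _ c' c' c _).trans ?_
        rw [if_neg, smul_zero]
        rintro ⟨rfl, -⟩
        exact hne rfl
      | mixed =>
        refine (weightTwoForm_coJacobi _ 0 1 c _).trans ?_
        rw [if_neg, smul_zero]
        rintro ⟨rfl, h⟩
        exact absurd h (by decide)
  | mixed =>
    obtain rfl : e = 0 := h
    refine ⟨_, .coCompatible, ?_, ?_⟩
    · refine ne_of_eq_of_ne (weightTwoForm_compatibility _ 0 1 _) ?_
      rw [hCC, one_smul, if_neg (by decide)]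
      exact one_ne_zero
    · intro x' hx' hne
      cases hx' with
      | coproduct c' =>
        refine (weightTwoForm_compatibility _ c' c' _).trans ?_
        rw [if_pos rfl, smul_zero]
      | mixed => exact absurd rfl hne
  | bialgebra c =>
    obtain rfl : e = 1 := h
    refine ⟨_, .bialgebra c, ?_, ?_⟩
    · refine ne_of_eq_of_ne (weightTwoForm_bialgebra_dualYC _ c c _) ?_
      rw [labelSign_graphYC.2, one_smul, if_pos rfl]
      exact one_ne_zero
    · intro x' hx' hne
      cases hx' with
      | bialgebra c' =>
        refine (weightTwoForm_bialgebra_dualYC _ c' c _).trans ?_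
        rw [if_neg, smul_zero]
        rintro rfl
        exact hne rfl

/-- `(S)_(2)` is the orthogonal complement of `R` in `F_(2)(N)`. -/
theorem mem_dualIdealTwo_iff {m n : ℕ} {d e : ℤ} (h : e = -d)
    (z : WeightTwo (dualGenerators K) m n d) :
    z ∈ dualIdealTwo K m n d ↔ ∀ y, LieRelation K m n e y → weightTwoForm h z y = 0 := by
  have hle : ∀ z ∈ dualIdealTwo K m n d, ∀ y, LieRelation K m n e y →
      weightTwoForm h z y = 0 := by
    intro z hz y hy
    have : dualIdealTwo K m n d ≤ LinearMap.ker ((weightTwoForm h).flip y) := by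
      refine Submodule.span_le.2 ?_
      rintro _ ⟨σ, τ, x, hx, rfl⟩
      exact weightTwoForm_dualRelation h hx hy σ τ
    exact this hz
  refine ⟨fun hz => hle z hz, fun hz => ?_⟩
  have htop : z ∈ dualIdealTwo K m n d ⊔ Submodule.span K {x | NormalForm K m n d x} := by
    rw [dualIdealTwo_sup_normalForm]
    trivial
  -- The part `s` lies in (S)_(2) and is orthogonal to R, so the combination `b` of normal forms is
  -- orthogonal to R too; since the relations separate the normal forms, it vanishes.
  obtain ⟨s, hs, b, hb, rfl⟩ := Submodule.mem_sup.1 htop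
  have hb0 : b = 0 := by
    refine eq_zero_of_mem_span
      (F := {f | ∃ y, LieRelation K m n e y ∧ f = (weightTwoForm h).flip y}) ?_ hb ?_
    · intro x hx
      obtain ⟨y, hy, h₁, h₂⟩ := NormalForm.exists_lieRelation hx e h
      exact ⟨_, ⟨y, hy, rfl⟩, h₁, h₂⟩
    · rintro _ ⟨y, hy, rfl⟩
      have := hz y hy
      rw [map_add, LinearMap.add_apply, hle s hs y hy, zero_add] at this
      exact this
  rw [hb0, add_zero]
  exact hs

theorem map_dualIdealTwo (m n : ℕ) (d : ℤ) :
    (dualIdealTwo K m n d).map (WeightTwo.map (dualIso K) m n d) =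
      WeightTwo.orthogonal (lieGenerators K)
        (WeightTwo.generated (lieGenerators K) (lieTwoOneBi K).relations m n (-d)) := by
  have key : ∀ z, z ∈ dualIdealTwo K m n d ↔ WeightTwo.map (dualIso K) m n d z ∈
      WeightTwo.orthogonal (lieGenerators K)
        (WeightTwo.generated (lieGenerators K) (lieTwoOneBi K).relations m n (-d)) := by
    intro z
    rw [mem_dualIdealTwo_iff rfl]
    refine ⟨fun hz => ?_, fun hz y hy => hz y (WeightTwo.mem_generated hy)⟩
    -- Translates of a relation are ± that relation, so orthogonality to R is orthogonality to
    -- (R)_(2).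
    have : WeightTwo.generated (lieGenerators K) (lieTwoOneBi K).relations m n (-d) ≤
        LinearMap.ker (weightTwoForm rfl z) := by
      refine Submodule.span_le.2 ?_
      rintro _ ⟨σ, τ, y, hy, rfl⟩
      rw [SetLike.mem_coe, LinearMap.mem_ker, LieRelation.act_eq hy, Units.smul_def, map_zsmul,
        hz y hy, smul_zero]
    exact fun y hy => this hy
  refine le_antisymm ?_ fun w hw => ?_
  · rintro _ ⟨z, hz, rfl⟩
    exact (key z).1 hz
  · obtain ⟨z, rfl⟩ := WeightTwo.map_surjective (dualIso K) m n d w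
    exact ⟨z, (key z).2 hw, rfl⟩

end DualRelations

end Dioperads

open Dioperads in
theorem mainTheorem10 (K : Type*) [Field K] [CharZero K] :
    ∃ θ : (dualGenerators K).Iso (lieGenerators K).czechDual,
      -- `θ` maps the natural basis of `N` to the dual of the natural basis of `M`
      ((lieGenerators K).czechEval (θ.toEquiv (dualProduct K)) (lieBracket K) = 1 ∧
        ∀ c c' : Fin 2, (lieGenerators K).czechEval (θ.toEquiv (dualCoproduct K c))
          (lieCobracket K c') = if c = c' then 1 else 0) ∧
      -- `(S)_(2)` is the orthogonal complement of `(R)_(2)`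
      (∀ (m n : ℕ) (d : ℤ),
        (WeightTwo.generated (dualGenerators K)
            (totallyCompatibleFrobenius K).relations m n d).map (WeightTwo.map θ m n d) =
          WeightTwo.orthogonal (lieGenerators K)
            (WeightTwo.generated (lieGenerators K) (lieTwoOneBi K).relations m n (-d))) ∧
      -- the Koszul dual dioperad is `F(N)/(S)`
      ∃ Φ : (lieTwoOneBi K).koszulDual.dioperad.Iso (totallyCompatibleFrobenius K).dioperad,
        ∀ (m n : ℕ) (d : ℤ) (x : (dualGenerators K).carrier m n d),
          Φ.toEquiv ((lieTwoOneBi K).koszulDual.gen (θ.toEquiv x)) =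
            (totallyCompatibleFrobenius K).gen x := by
  refine ⟨dualIso K, ⟨?_, fun c c' => ?_⟩, map_dualIdealTwo, ?_⟩
  · exact (czechEval_dualIso K _ _).trans (generatorForm_product K _)
  · exact (czechEval_dualIso K _ _).trans (generatorForm_coproduct K c c' _)
  · obtain ⟨Φ, hΦ⟩ := QuadraticData.exists_iso (Q := (lieTwoOneBi K).koszulDual)
      (Q' := totallyCompatibleFrobenius K) (dualIso K).symm
      -- The relations of the Koszul dual form the whole orthogonal complement, that is, the image
      -- of (S)_(2) under θ; applying θ⁻¹ returns to (S)_(2).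
      (fun m n d x hx => by
        obtain ⟨z, hz, rfl⟩ := (map_dualIdealTwo m n d).ge hx
        have := WeightTwo.map_map_symm (dualIso K).symm z
        exact this.symm ▸ hz)
      -- Conversely, θ maps S into the orthogonal complement, each element of which is itself a
      -- relation of the Koszul dual.
      (fun m n d x hx => WeightTwo.mem_generated
        ((map_dualIdealTwo m n d).le ⟨x, WeightTwo.mem_generated hx, rfl⟩))
    refine ⟨Φ, fun m n d x => (hΦ m n d _).trans ?_⟩
    exact congrArg _ ((dualIso K).toEquiv.symm_apply_apply x)
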